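/- **Setting.** Let $\lambda\in\mathbb C$ with $\lambda\notin\frac12-\frac12\mathbb Z_{\ge0}$, let $\ell\in\mathbb Z$ and let $N$ be a positive integer. Let $\mathcal V^\infty_{\lambda,\ell}$ be the space of $C^\infty$ functions $f:\mathbb R\to\mathbb C$ for which $f_\infty(x)=(\operatorname{sgn}x)^{\ell/2}|x|^{-2\lambda}f(-1/x)$ $(x\ne0)$ extends to a $C^\infty$ function $f_\infty$ on $\mathbb R$; here $(\operatorname{sgn}x)^{\ell/2}=1$ for $x>0$ and $=i^\ell$ for $x<0$. Put $f(\infty)=f_\infty(0)$, so that $f_\infty(\infty)=(f_\infty)_\infty(0)=i^\ell f(0)$. For $f\in\mathcal V^\infty_{\lambda,\ell}$ let $\Phi_\pm(f;s)$ be the meromorphic function on $\mathbb C$ given, for every $m\in\mathbb Z_{\ge0}$, on the strip $-m<\Re(s)<2\Re(\lambda)$ by $$\Phi_\pm(f;s)=\frac{(\mp1)^m}{s(s+1)\cdots(s+m-1)}\int_0^\infty x^{s+m-1}f^{(m)}(\pm x)\,dx .$$ The generalized Fourier transform of $f$ is $$\mathcal Ff(t)=\Bigl(\frac{-1}{2\pi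 it}\Bigr)^m\int_{\mathbb R}f^{(m)}(x)e^{2\pi ixt}\,dx\quad(t\ne0),\qquad \mathcal Ff(0)=\Phi_+(f;1)+\Phi_-(f;1),$$ where $m$ is a positive integer with $\Re(\lambda)+\frac m2>\frac12$ (the value does not depend on $m$). Let $\alpha,\beta:\mathbb Z\to\mathbb C$ be sequences of polynomial growth and let $\alpha(\infty),\beta(\infty)\in\mathbb C$. Define $\xi_\pm(\alpha;s)=\sum_{n\ge1}\alpha(\pm n)n^{-s}$ and $\xi_\pm(\beta;s)=\sum_{n\ge1}\beta(\pm n)n^{-s}$, which converge absolutely for $\Re(s)$ sufficiently large. **Theorem.** Assume that the Ferrar–Suzuki summation formula of level $N$ $$\alpha(\infty)f(\infty)+\sum_{n\in\mathbb Z}\alpha(n)(\mathcal Ff)(n)=\beta(\infty)f_\infty(\infty)+\sum_{n\in\mathbb Z}\beta(n)(\mathcal Ff_\infty)\Bigl(\frac nN\Bigr)$$ holds for all $f\in\mathcal V^\infty_{\lambda,\ell}$. Then: (1) $\xi_\pm(\alpha;s)$ and $\xi_\pm(\beta;s)$ continue to meromorphic functions on $\mathbb C$ with poles only at $s=1$ and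 $s=2-2\lambda$, of order at most $1$, and with residues $$\operatorname*{Res}_{s=1}\xi_\pm(\alpha;s)=i^\ell\beta(\infty),\qquad \operatorname*{Res}_{s=1}\xi_\pm(\beta;s)=\frac{\alpha(\infty)}N,$$ $$\operatorname*{Res}_{s=2-2\lambda}\xi_\pm(\alpha;s)=\pm i(2\pi)^{-(2\lambda-1)}\Gamma(2\lambda-1)\bigl(i^\ell e^{\mp\lambda\pi i}-e^{\pm\lambda\pi i}\bigr)\beta(0),$$ $$\operatorname*{Res}_{s=2-2\lambda}\xi_\pm(\beta;s)=\mp iN^{2\lambda-2}(2\pi)^{-(2\lambda-1)}\Gamma(2\lambda-1)\bigl(i^{-\ell}e^{\pm\pi i\lambda}-e^{\mp\pi i\lambda}\bigr)\alpha(0).$$ (2) Put $\Xi_\pm(\ast;s)=(2\pi)^{-s}\Gamma(s)\xi_\pm(\ast;s)$ for $\ast=\alpha,\beta$, and $$\gamma(s)=\begin{pmatrix}e^{\pi si/2}&e^{-\pi si/2}\\ e^{-\pi si/2}&e^{\pi si/2}\end{pmatrix},\qquad \Sigma(\ell)=\begin{pmatrix}0&i^\ell\\1&0\end{pmatrix}.$$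 Then, as an identity of meromorphic functions of $s$, $$\gamma(s)\begin{pmatrix}\Xi_+(\alpha;s)\\ \Xi_-(\alpha;s)\end{pmatrix}=N^{2-2\lambda-s}\,\Sigma(\ell)\,\gamma(2-2\lambda-s)\begin{pmatrix}\Xi_+(\beta;2-2\lambda-s)\\ \Xi_-(\beta;2-2\lambda-s)\end{pmatrix}.$$ (3) The functions $(s-1)(s+2\lambda-2)\xi_\pm(\alpha;s)$ and $(s-1)(s+2\lambda-2)\xi_\pm(\beta;s)$ are entire functions of order at most $1$. -/

import Mathlib

open Complex MeasureTheory Filter Topology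
open scoped ContDiff

noncomputable section

namespace FerrarSuzuki

/-! ### The line model of the principal series -/

/-- `(sgn x)^(ℓ/2)` with the principal value: `1` for `0 < x` and `i^ℓ` for `x < 0`. -/
def sgnHalfPow (ell : ℤ) (x : ℝ) : ℂ := if 0 < x then 1 else I ^ ell

/-- The function `x ↦ (sgn x)^(ℓ/2) |x|^(-2λ) f(-1/x)`, meaningful for `x ≠ 0`. -/
def inversionFormula (lam : ℂ) (ell : ℤ) (f : ℝ → ℂ) (x : ℝ) : ℂ :=
  sgnHalfPow ell x * ((|x| : ℝ) : ℂ) ^ (-2 * lam) * f (-1 / x)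

/-- The space `V_{λ,ℓ}^∞` of smooth functions `f` on `ℝ` such that
`(sgn x)^(ℓ/2) |x|^(-2λ) f(-1/x)` extends from `x ≠ 0` to a smooth function on `ℝ`. -/
def lineModel (lam : ℂ) (ell : ℤ) : Set (ℝ → ℂ) :=
  {f | ContDiff ℝ ∞ f ∧
    ∃ g : ℝ → ℂ, ContDiff ℝ ∞ g ∧ ∀ x : ℝ, x ≠ 0 → g x = inversionFormula lam ell f x}

/-- The function `f_∞`: given by the inversion formula for `x ≠ 0` and by continuity at `0`. -/
def atInfty (lam : ℂ) (ell : ℤ) (f : ℝ → ℂ) (x : ℝ) : ℂ :=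
  if x = 0 then limUnder (𝓝[≠] (0 : ℝ)) (inversionFormula lam ell f)
  else inversionFormula lam ell f x

/-- Any continuous extension of the inversion formula is `f_∞`. -/
theorem atInfty_eq {lam : ℂ} {ell : ℤ} {f g : ℝ → ℂ} (hg : Continuous g)
    (h : ∀ x : ℝ, x ≠ 0 → g x = inversionFormula lam ell f x) : atInfty lam ell f = g := by
  funext x
  unfold atInfty
  split_ifs with hx
  · subst hx
    apply Tendsto.limUnder_eq
    have h1 : Tendsto g (𝓝[≠] (0 : ℝ)) (𝓝 (g 0)) :=
      hg.continuousAt.tendsto.mono_left nhdsWithin_le_nhds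
    refine h1.congr' ?_
    filter_upwards [self_mem_nhdsWithin] with y hy
    exact h y hy
  · exact (h x hx).symm

/-- `f_∞` is smooth on the whole real line for `f` in the line model. -/
theorem contDiff_atInfty {lam : ℂ} {ell : ℤ} {f : ℝ → ℂ} (hf : f ∈ lineModel lam ell) :
    ContDiff ℝ ∞ (atInfty lam ell f) := by
  obtain ⟨_, g, hg, h⟩ := hf
  rw [atInfty_eq hg.continuous h]
  exact hg

/-! ### Local zeta functions and the generalized Fourier transform

A sign `±` is an element `ε` of `ℤˣ = {1, -1}`. -/

/-- The expression
`(∓1)^m / (s (s+1) ⋯ (s+m-1)) * ∫_0^∞ x^(s+m-1) f^(m)(± x) dx`.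
For `f` in `V_{λ,ℓ}^∞` the integral converges absolutely for `-m < Re s < 2 Re λ`; for `m = 0` it
is the Mellin integral `∫_0^∞ x^(s-1) f(± x) dx`. -/
def localZetaIntegral (ε : ℤˣ) (f : ℝ → ℂ) (m : ℕ) (s : ℂ) : ℂ :=
  (-((ε : ℤ) : ℂ)) ^ m / (∏ j ∈ Finset.range m, (s + j)) *
    ∫ x in Set.Ioi (0 : ℝ), (x : ℂ) ^ (s + m - 1) * iteratedDeriv m f (((ε : ℤ) : ℝ) * x)

/-- `Φ` is the local zeta function `Φ_±(f; ·)` of `f ∈ V_{λ,ℓ}^∞`, continued to `ℂ`: a meromorphic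
function (in normal form, i.e. with its correct value at every regular point) which on each strip
`-m < Re s < 2 Re λ` is given by the integral expression above. -/
structure IsLocalZeta (lam : ℂ) (ε : ℤˣ) (f : ℝ → ℂ) (Φ : ℂ → ℂ) : Prop where
  meromorphic : MeromorphicNFOn Φ Set.univ
  eq_integral : ∀ (m : ℕ) (s : ℂ), -(m : ℝ) < s.re → s.re < 2 * lam.re →
    (∀ k : ℕ, s ≠ -(k : ℂ)) → Φ s = localZetaIntegral ε f m s

open Classical in
/-- The local zeta function `Φ_±(f; s)`, as a meromorphic function on `ℂ`. -/
def localZeta (lam : ℂ) (ε : ℤˣ) (f : ℝ → ℂ) : ℂ → ℂ :=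
  if h : ∃ Φ : ℂ → ℂ, IsLocalZeta lam ε f Φ then h.choose else 0

/-- The least positive integer `m` with `Re λ + m/2 > 1/2`. -/
def fourierOrder (lam : ℂ) : ℕ := ⌊1 - 2 * lam.re⌋₊ + 1

/-- The generalized Fourier transform of `f ∈ V_{λ,ℓ}^∞`. For `t ≠ 0` it is
`(-1/(2πit))^m ∫ f^(m)(x) e^(2πixt) dx`, where `m` is a positive integer with
`Re λ + m/2 > 1/2` (the result does not depend on which one; the least one is taken).
At `t = 0` it is the regularized value `Φ_+(f; 1) + Φ_-(f; 1)`. -/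
def fourier (lam : ℂ) (f : ℝ → ℂ) (t : ℝ) : ℂ :=
  if t = 0 then localZeta lam 1 f 1 + localZeta lam (-1) f 1
  else (-1 / (2 * Real.pi * I * t)) ^ fourierOrder lam *
    ∫ x : ℝ, iteratedDeriv (fourierOrder lam) f x * cexp (2 * Real.pi * I * x * t)

/-! ### The summation formula -/

/-- A two-sided sequence of polynomial growth. -/
def PolynomialGrowth (a : ℤ → ℂ) : Prop :=
  ∃ (C : ℝ) (k : ℕ), ∀ n : ℤ, ‖a n‖ ≤ C * (1 + |(n : ℝ)|) ^ k

/-- The Ferrar–Suzuki summation formula of level `N` holds for the test function `f`: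
`α(∞) f(∞) + ∑ α(n) (𝓕f)(n) = β(∞) f_∞(∞) + ∑ β(n) (𝓕f_∞)(n/N)`,
where `f(∞) = f_∞(0)` and `f_∞(∞) = (f_∞)_∞(0)`. -/
def SummationFormula (lam : ℂ) (ell : ℤ) (N : ℕ) (α β : ℤ → ℂ) (αinf βinf : ℂ)
    (f : ℝ → ℂ) : Prop :=
  αinf * atInfty lam ell f 0 + ∑' n : ℤ, α n * fourier lam f n =
    βinf * atInfty lam ell (atInfty lam ell f) 0 +
      ∑' n : ℤ, β n * fourier lam (atInfty lam ell f) ((n : ℝ) / N)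

/-! ### L-functions -/

/-- The coefficients `n ↦ a(± n)` of `ξ_±(a; s) = ∑_{n ≥ 1} a(± n) n^(-s)`. -/
def coeff (a : ℤ → ℂ) (ε : ℤˣ) (n : ℕ) : ℂ := a ((ε : ℤ) * n)

/-- `F` is a meromorphic continuation to `ℂ` of the Dirichlet series
`ξ_±(a; s) = ∑_{n ≥ 1} a(± n) n^(-s)`, which converges absolutely on some right half-plane. -/
def IsContinuationOfXi (a : ℤ → ℂ) (ε : ℤˣ) (F : ℂ → ℂ) : Prop :=
  Meromorphic F ∧ ∃ σ : ℝ, ∀ s : ℂ, σ < s.re →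
    LSeriesSummable (coeff a ε) s ∧ F s = LSeries (coeff a ε) s

/-- `F` is meromorphic at `c`, has at most a simple pole there, and its residue there is `r`. -/
def HasSimpleResidueAt (F : ℂ → ℂ) (c r : ℂ) : Prop :=
  MeromorphicAt F c ∧ (-1 : WithTop ℤ) ≤ meromorphicOrderAt F c ∧
    Tendsto (fun s => (s - c) * F s) (𝓝[≠] c) (𝓝 r)

/-- The completed function `(2π)^(-s) Γ(s) ξ(s)`. -/
def completed (ξ : ℂ → ℂ) (s : ℂ) : ℂ := (2 * Real.pi : ℂ) ^ (-s) * Complex.Gamma s * ξ s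

/-- The matrix `γ(s)`. -/
def gammaMatrix (s : ℂ) : Matrix (Fin 2) (Fin 2) ℂ :=
  !![cexp (Real.pi * s * I / 2), cexp (-(Real.pi * s * I / 2));
     cexp (-(Real.pi * s * I / 2)), cexp (Real.pi * s * I / 2)]

/-- The matrix `Σ(ℓ)`. -/
def sigmaMatrix (ell : ℤ) : Matrix (Fin 2) (Fin 2) ℂ := !![0, I ^ ell; 1, 0]

/-- `g` is an entire function of order at most `ρ`: for every `ρ' > ρ` one has
`g(s) = O(exp(|s|^ρ'))` as `|s| → ∞`. -/
def EntireOfOrderAtMost (ρ : ℝ) (g : ℂ → ℂ) : Prop :=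
  Differentiable ℂ g ∧ ∀ ρ' : ℝ, ρ < ρ' →
    g =O[Bornology.cobounded ℂ] fun s => Real.exp (‖s‖ ^ ρ')

end FerrarSuzuki

end

/-! The argument is Riemann's: feed dilated Gaussians into the summation formula, obtain a theta
relation, and take Mellin transforms in the dilation parameter.

The test functions are `gaussPower k` for `k = 0, 1`, one even and one odd. Away from the origin
their Fourier transform is `I ^ k` times the function itself. Their inversion `gaussFlat` is, up to
a constant on each half-line, `|x| ^ (-2λ-k) exp (-π/x²)`; it is flat at `0`, so the term with
`α(∞)` drops out. Dilation turns the summation formula into `GaussRelation`, which links `t` with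
`1/(Nt)`. Since `(f_∞)_∞ = i^ℓ f`, applying the formula to `f_∞` instead gives a relation of the
same shape, with `β` in the role of `α` and `i^(-ℓ) N^(2λ-2) α` in the role of `β`. One argument
therefore treats both sequences.

Both theta series decay rapidly, so cutting the Mellin integral at `1` (`exists_mellin_split`)
writes both Mellin transforms as one entire function plus polar terms at `1`, `2 - 2λ` and `0`. On
one side the Mellin transform is `Gammaℝ (s + k)` times `ξ_+ + (-1)^k ξ_-`. On the other it is
computed by the local functional equation `exists_mellin_flatFourier`: the Mellin transform at `w`
of a half-line Fourier transform is `(2π)^(-w) Γ(w) e^(±πiw/2)` times the Mellin transform at `1 -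
w` of the function. Dividing by `Gammaℝ (s + k)` removes the pole at `0`. Half the sum and half the
difference of the two parities give `ξ_±`. The reflection formulas for `Gammaℝ` produce the residues
at `2 - 2λ` and the matrix `γ(s)`, and the identity theorem extends the functional equation from a
half-plane.

For the order, every estimate is kept in the form `exp (C (r + 2) log (r + 2))`. The `m`-th
derivative of `x ^ (-μ) exp (-π/x²)` is at most a power of `m!` in size, so the theta series are
bounded by `exp (C m log m) t ^ (-m)` with `C` independent of `m`. Taking `m` close to `|s|` bounds
the incomplete Mellin transforms, and `1/Γ` has growth of the same type. -/

noncomputable section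

namespace FerrarSuzuki

/-! ### Functions of growth `exp (O(|s| log |s|))` -/

/-- The function `r ↦ (r + 2) log (r + 2)`. -/
def logExponent (r : ℝ) : ℝ := (r + 2) * Real.log (r + 2)

/-- The shift by `2` keeps the logarithm above `log 2 > 1/2`. Hence `logExponent` is at least `1`
and dominates linear functions, and constant factors can always be absorbed into the exponent. -/
theorem half_le_log {r : ℝ} (hr : 0 ≤ r) : 1 / 2 ≤ Real.log (r + 2) := by
  have h1 : Real.log 2 ≤ Real.log (r + 2) := Real.log_le_log (by norm_num) (by linarith)
  linarith [Real.log_two_gt_d9]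

theorem logExponent_mono {r r' : ℝ} (hr : 0 ≤ r) (h : r ≤ r') : logExponent r ≤ logExponent r' := by
  unfold logExponent
  have h1 := half_le_log hr
  have h2 : Real.log (r + 2) ≤ Real.log (r' + 2) := Real.log_le_log (by linarith) (by linarith)
  exact mul_le_mul (by linarith) h2 (by linarith) (by linarith)

theorem add_two_le_logExponent {r : ℝ} (hr : 0 ≤ r) : r + 2 ≤ 2 * logExponent r := by
  unfold logExponent
  nlinarith [half_le_log hr]

theorem logExponent_pos {r : ℝ} (hr : 0 ≤ r) : 1 ≤ logExponent r := by
  linarith [add_two_le_logExponent hr]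

theorem logExponent_scale_le {K r : ℝ} (hK : 1 ≤ K) (hr : 0 ≤ r) {x : ℝ} (hx0 : 0 ≤ x)
    (hx : x + 2 ≤ K * (r + 2)) : logExponent x ≤ K * (1 + 2 * K) * logExponent r := by
  unfold logExponent
  have h1 := half_le_log hr
  have h2 : Real.log (x + 2) ≤ Real.log K + Real.log (r + 2) := by
    rw [← Real.log_mul (by linarith) (by linarith)]
    exact Real.log_le_log (by linarith) hx
  have h3 : Real.log K ≤ K := (Real.log_le_sub_one_of_pos (by linarith)).trans (by linarith)
  have h4 : Real.log (x + 2) ≤ (1 + 2 * K) * Real.log (r + 2) := by nlinarith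
  have h5 := half_le_log hx0
  calc (x + 2) * Real.log (x + 2) ≤ (K * (r + 2)) * ((1 + 2 * K) * Real.log (r + 2)) :=
        mul_le_mul hx h4 (by linarith) (by nlinarith)
    _ = _ := by ring

theorem exists_logExponent_affine_le {a b : ℝ} (ha : 0 ≤ a) (hb : 0 ≤ b) :
    ∃ C : ℝ, 0 ≤ C ∧ ∀ r : ℝ, 0 ≤ r → ∀ x, 0 ≤ x → x ≤ a * r + b →
      logExponent x ≤ C * logExponent r := by
  refine ⟨(a + b + 1) * (1 + 2 * (a + b + 1)), by positivity, fun r hr x hx0 hx => ?_⟩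
  exact logExponent_scale_le (by linarith) hr hx0 (by nlinarith)

theorem factorial_le_exp_logExponent (n : ℕ) : (n.factorial : ℝ) ≤ Real.exp (logExponent n) := by
  have h1 : (n.factorial : ℝ) ≤ (n : ℝ) ^ n := by exact_mod_cast Nat.factorial_le_pow n
  have h2 : Real.exp (logExponent n) = ((n : ℝ) + 2) ^ (n + 2) := by
    unfold logExponent
    rw [mul_comm, Real.exp_mul, Real.exp_log (by positivity)]
    exact_mod_cast rfl
  rw [h2]
  calc (n.factorial : ℝ) ≤ (n : ℝ) ^ n := h1
    _ ≤ ((n : ℝ) + 2) ^ n := by gcongr; linarith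
    _ ≤ ((n : ℝ) + 2) ^ (n + 2) := by
      apply pow_le_pow_right₀ _ (by omega)
      have : (0 : ℝ) ≤ n := by positivity
      linarith

/-- Since `log K ≤ K`, the base is at most `exp (K + log (n + 2))`. This absorbs dilation factors `c
^ (-m)` and products of `m` factors of size `O(m)`. -/
theorem pow_le_exp_logExponent {K x : ℝ} (hK : 1 ≤ K) (n : ℕ) (hx0 : 0 ≤ x)
    (hx : x ≤ K * ((n : ℝ) + 2)) : x ^ n ≤ Real.exp ((2 * K + 1) * logExponent n) := by
  have hn : (0 : ℝ) ≤ n := by positivity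
  have h1 : x ≤ Real.exp (K + Real.log ((n : ℝ) + 2)) := by
    rw [Real.exp_add, Real.exp_log (by linarith)]
    refine hx.trans (mul_le_mul_of_nonneg_right ?_ (by linarith))
    linarith [Real.add_one_le_exp K]
  calc x ^ n ≤ (Real.exp (K + Real.log ((n : ℝ) + 2))) ^ n := by gcongr
    _ = Real.exp (n * (K + Real.log ((n : ℝ) + 2))) := by rw [← Real.exp_nat_mul]
    _ ≤ _ := by
      apply Real.exp_le_exp.mpr
      have h2 := half_le_log hn
      have h3 := add_two_le_logExponent hn
      have h4 : n * Real.log ((n : ℝ) + 2) ≤ logExponent n := by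
        unfold logExponent; nlinarith
      nlinarith

/-- A function on `ℂ` bounded by `exp (C (|s| + 2) log (|s| + 2))`. -/
def LogGrowth (g : ℂ → ℂ) : Prop := ∃ C : ℝ, 0 ≤ C ∧ ∀ s, ‖g s‖ ≤ Real.exp (C * logExponent ‖s‖)

theorem LogGrowth.mul {f g : ℂ → ℂ} (hf : LogGrowth f) (hg : LogGrowth g) :
    LogGrowth fun s => f s * g s := by
  obtain ⟨C, hC, h⟩ := hf
  obtain ⟨D, hD, h'⟩ := hg
  refine ⟨C + D, by positivity, fun s => ?_⟩
  rw [norm_mul, add_mul, Real.exp_add]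
  exact mul_le_mul (h s) (h' s) (norm_nonneg _) (Real.exp_pos _).le

theorem LogGrowth.add {f g : ℂ → ℂ} (hf : LogGrowth f) (hg : LogGrowth g) :
    LogGrowth fun s => f s + g s := by
  obtain ⟨C, hC, h⟩ := hf
  obtain ⟨D, hD, h'⟩ := hg
  -- The extra `1` pays for the factor `2` that appears when two exponentials are added.
  refine ⟨C + D + 1, by positivity, fun s => ?_⟩
  have hL := logExponent_pos (norm_nonneg s)
  have h1 : Real.exp (C * logExponent ‖s‖) ≤ Real.exp ((C + D) * logExponent ‖s‖) :=
    Real.exp_le_exp.mpr (by nlinarith)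
  have h2 : Real.exp (D * logExponent ‖s‖) ≤ Real.exp ((C + D) * logExponent ‖s‖) :=
    Real.exp_le_exp.mpr (by nlinarith)
  have h3 : 2 ≤ Real.exp (logExponent ‖s‖) := by
    linarith [Real.add_one_le_exp (logExponent ‖s‖)]
  rw [add_mul (C + D), Real.exp_add, one_mul]
  have h4 := Real.exp_pos ((C + D) * logExponent ‖s‖)
  calc ‖f s + g s‖ ≤ ‖f s‖ + ‖g s‖ := norm_add_le _ _
    _ ≤ _ := by nlinarith [h s, h' s]

theorem logGrowth_of_le {g : ℂ → ℂ} {A B : ℝ} (h : ∀ s, ‖g s‖ ≤ Real.exp (A * ‖s‖ + B)) :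
    LogGrowth g := by
  refine ⟨2 * (|A| + |B|), by positivity, fun s => (h s).trans (Real.exp_le_exp.mpr ?_)⟩
  have h1 := add_two_le_logExponent (norm_nonneg s)
  have h2 := norm_nonneg s
  have h3 := le_abs_self A
  have h4 := le_abs_self B
  have h5 := abs_nonneg A
  have h6 := abs_nonneg B
  calc A * ‖s‖ + B ≤ |A| * (‖s‖ + 2) + |B| * (‖s‖ + 2) := by nlinarith
    _ ≤ _ := by nlinarith

theorem logGrowth_const (c : ℂ) : LogGrowth fun _ => c :=
  logGrowth_of_le (A := 0) (B := ‖c‖) fun s => by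
    rw [zero_mul, zero_add]; linarith [Real.add_one_le_exp ‖c‖]

theorem logGrowth_id : LogGrowth fun s => s :=
  logGrowth_of_le (A := 1) (B := 0) fun s => by
    rw [one_mul, add_zero]; linarith [Real.add_one_le_exp ‖s‖]

theorem logGrowth_exp (a : ℂ) : LogGrowth fun s => cexp (a * s) :=
  logGrowth_of_le (A := ‖a‖) (B := 0) fun s => by
    rw [Complex.norm_exp, add_zero, ← norm_mul]
    exact Real.exp_le_exp.mpr (Complex.re_le_norm _)

theorem LogGrowth.const_mul {f : ℂ → ℂ} (hf : LogGrowth f) (c : ℂ) : LogGrowth fun s => c * f s :=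
  (logGrowth_const c).mul hf

theorem LogGrowth.comp_affine {f : ℂ → ℂ} (hf : LogGrowth f) (a b : ℂ) :
    LogGrowth fun s => f (a * s + b) := by
  obtain ⟨C, hC, h⟩ := hf
  obtain ⟨D, hD, h'⟩ := exists_logExponent_affine_le (norm_nonneg a) (norm_nonneg b)
  refine ⟨C * D, by positivity, fun s => (h _).trans (Real.exp_le_exp.mpr ?_)⟩
  rw [mul_assoc]
  refine mul_le_mul_of_nonneg_left (h' _ (norm_nonneg s) _ (norm_nonneg _) ?_) hC
  exact (norm_add_le _ _).trans (by rw [norm_mul])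

theorem logGrowth_const_cpow {x : ℂ} (hx : x ≠ 0) (a b : ℂ) :
    LogGrowth fun s => x ^ (a * s + b) := by
  have := (logGrowth_exp (Complex.log x)).comp_affine a b
  simpa only [Complex.cpow_def_of_ne_zero hx] using this

theorem norm_sin_le_mul_exp (w : ℂ) : ‖Complex.sin w‖ ≤ ‖w‖ * Real.exp ‖w‖ := by
  have h1 := Complex.norm_exp_sub_sum_le_norm_mul_exp (-w * I) 1
  have h2 := Complex.norm_exp_sub_sum_le_norm_mul_exp (w * I) 1
  simp only [Finset.sum_range_one, pow_zero, Nat.factorial_zero, Nat.cast_one, div_one, pow_one,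
    norm_mul, norm_neg, norm_I, mul_one] at h1 h2
  have h3 : Complex.sin w = ((cexp (-w * I) - 1) - (cexp (w * I) - 1)) * I / 2 := by
    rw [Complex.sin]; ring
  rw [h3, norm_div, norm_mul, norm_I, mul_one, Complex.norm_ofNat]
  have := norm_sub_le (cexp (-w * I) - 1) (cexp (w * I) - 1)
  linarith

theorem norm_Gamma_le_Gamma_re {z : ℂ} (hz : 0 < z.re) : ‖Complex.Gamma z‖ ≤ Real.Gamma z.re := by
  rw [Complex.Gamma_eq_integral hz, Real.Gamma_eq_integral hz, Complex.GammaIntegral]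
  refine (norm_integral_le_integral_norm _).trans (le_of_eq ?_)
  refine setIntegral_congr_fun measurableSet_Ioi fun x hx => ?_
  have hx : 0 < x := hx
  simp only [norm_mul]
  rw [Complex.norm_cpow_eq_rpow_re_of_pos hx, Complex.norm_real, Real.norm_eq_abs,
    abs_of_pos (Real.exp_pos _)]
  simp

/-- `Γ` is monotone only from `2` on, so the comparison with a factorial is made at `x + 2`. Going
back divides by `x (x + 1) ≥ 3/4`. -/
theorem Gamma_le_exp_logExponent {x : ℝ} (hx : 1 / 2 ≤ x) :
    Real.Gamma x ≤ 2 * Real.exp (logExponent (x + 3)) := by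
  have h1 : Real.Gamma (x + 1) = x * Real.Gamma x := Real.Gamma_add_one (by linarith)
  have h1' : Real.Gamma (x + 2) = (x + 1) * Real.Gamma (x + 1) := by
    rw [← Real.Gamma_add_one (by linarith)]; ring_nf
  have h2 : Real.Gamma (x + 2) ≤ Real.exp (logExponent (x + 3)) := by
    set n := ⌈x + 2⌉₊ with hn
    have hn1 : x + 2 ≤ n := Nat.le_ceil _
    have hn2 : (n : ℝ) < x + 2 + 1 := Nat.ceil_lt_add_one (by linarith)
    have h3 : Real.Gamma (x + 2) ≤ Real.Gamma (n + 1) :=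
      (Real.Gamma_strictMonoOn_Ici.monotoneOn) (by simp; linarith) (by simp; linarith) (by linarith)
    rw [Real.Gamma_nat_eq_factorial] at h3
    exact h3.trans ((factorial_le_exp_logExponent n).trans
      (Real.exp_le_exp.mpr (logExponent_mono (by linarith) (by linarith))))
  have h4 := Real.Gamma_pos_of_pos (show 0 < x by linarith)
  rw [h1', h1] at h2
  have h5 : 3 / 4 * Real.Gamma x ≤ (x + 1) * x * Real.Gamma x :=
    mul_le_mul_of_nonneg_right (by nlinarith) h4.le
  linarith

/-- Reflection in the form `1/Γ(z) = Γ(2-z) sin(π(1-z)) / (π(1-z))`. Here `Re (2 - z) ≥ 1/2`, so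
`Γ(2-z)` is bounded by its value at the real part, and `|sin w| ≤ |w| e^|w|` cancels the
denominator. -/
theorem exists_norm_inv_Gamma_le_left :
    ∃ C : ℝ, 0 ≤ C ∧ ∀ z : ℂ, z.re ≤ 3 / 2 →
      ‖(Complex.Gamma z)⁻¹‖ ≤ Real.exp (C * logExponent ‖z‖) := by
  obtain ⟨D, hD, h'⟩ := exists_logExponent_affine_le (zero_le_one) (show (0 : ℝ) ≤ 5 by norm_num)
  refine ⟨D + 11, by positivity, fun z hz => ?_⟩
  have hL := logExponent_pos (norm_nonneg z)
  have hL' := add_two_le_logExponent (norm_nonneg z)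
  by_cases h1 : z = 1
  · subst h1
    rw [Complex.Gamma_one, inv_one, norm_one] at *
    exact Real.one_le_exp (mul_nonneg (by positivity) (by linarith))
  have hz1 : 1 - z ≠ 0 := sub_ne_zero.mpr (Ne.symm h1)
  have key : (Complex.Gamma z)⁻¹ =
      Complex.Gamma (2 - z) * (Complex.sin (Real.pi * (1 - z)) / (Real.pi * (1 - z))) := by
    have e1 : Complex.Gamma (2 - z) = (1 - z) * Complex.Gamma (1 - z) := by
      rw [← Complex.Gamma_add_one _ hz1]; ring_nf
    have e2 := Complex.Gamma_mul_Gamma_one_sub z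
    have e3 : Complex.sin (Real.pi * (1 - z)) = Complex.sin (Real.pi * z) := by
      rw [mul_sub, mul_one, Complex.sin_pi_sub]
    have hpi : (Real.pi : ℂ) ≠ 0 := by exact_mod_cast Real.pi_ne_zero
    rw [e3, e1]
    -- At a zero of the sine the point is a pole of `Γ`, where `Complex.Gamma` has the value `0`;
    -- both sides of `key` are then `0`. The bound on `Re z` and `z ≠ 1` make `Γ(1 - z)` nonzero.
    by_cases hs : Complex.sin (Real.pi * z) = 0
    · have hne : Complex.Gamma (1 - z) ≠ 0 := by
        apply Complex.Gamma_ne_zero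
        intro m hm
        have h2 : z = 1 + m := by linear_combination -hm
        rw [h2] at hz
        simp at hz
        have : m = 0 := by
          by_contra h0
          have : (1 : ℝ) ≤ m := by exact_mod_cast Nat.one_le_iff_ne_zero.mpr h0
          linarith
        subst this
        simp at h2
        exact h1 h2
      rw [hs, div_zero] at e2
      rw [hs, (mul_eq_zero.mp e2).resolve_right hne]
      simp
    · have hg : Complex.Gamma z ≠ 0 := by
        intro h0
        rw [h0, zero_mul] at e2
        exact (div_ne_zero hpi hs) e2.symm
      rw [eq_div_iff hs] at e2
      rw [inv_eq_of_mul_eq_one_right]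
      rw [← mul_assoc, ← mul_div_assoc, div_eq_one_iff_eq (mul_ne_zero hpi hz1)]
      linear_combination (1 - z) * e2
  rw [key, norm_mul]
  have b1 : ‖Complex.Gamma (2 - z)‖ ≤ 2 * Real.exp (D * logExponent ‖z‖) := by
    have hre : 1 / 2 ≤ (2 - z).re := by simp; linarith
    refine (norm_Gamma_le_Gamma_re (by linarith)).trans ((Gamma_le_exp_logExponent hre).trans ?_)
    have : (2 - z).re ≤ 2 + ‖z‖ := by
      simp
      linarith [neg_abs_le z.re, Complex.abs_re_le_norm z]
    have := h' _ (norm_nonneg z) ((2 - z).re + 3) (by linarith) (by linarith)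
    gcongr
  have b2 : ‖Complex.sin (Real.pi * (1 - z)) / (Real.pi * (1 - z))‖ ≤
      Real.exp (10 * logExponent ‖z‖) := by
    have hpos : 0 < ‖(Real.pi : ℂ) * (1 - z)‖ :=
      norm_pos_iff.mpr (mul_ne_zero (by exact_mod_cast Real.pi_ne_zero) hz1)
    rw [norm_div, div_le_iff₀ hpos, mul_comm (Real.exp _)]
    refine (norm_sin_le_mul_exp _).trans (mul_le_mul_of_nonneg_left ?_ hpos.le)
    apply Real.exp_le_exp.mpr
    rw [norm_mul, Complex.norm_real, Real.norm_eq_abs, abs_of_pos Real.pi_pos]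
    have : ‖1 - z‖ ≤ 1 + ‖z‖ := (norm_sub_le _ _).trans (by simp)
    nlinarith [Real.pi_lt_four, Real.pi_pos, norm_nonneg (1 - z)]
  have b3 : (2 : ℝ) ≤ Real.exp (logExponent ‖z‖) := by
    linarith [Real.add_one_le_exp (logExponent ‖z‖)]
  calc _ ≤ (2 * Real.exp (D * logExponent ‖z‖)) * Real.exp (10 * logExponent ‖z‖) :=
        mul_le_mul b1 b2 (norm_nonneg _) (by positivity)
    _ ≤ (Real.exp (logExponent ‖z‖) * Real.exp (D * logExponent ‖z‖)) *
          Real.exp (10 * logExponent ‖z‖) := by gcongr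
    _ = _ := by rw [← Real.exp_add, ← Real.exp_add]; ring_nf

/-- To the right of `3/2` the recursion `Γ(s) = (s-1) Γ(s-1)` moves left. Each step costs at most a
factor `2` because `|s - 1| ≥ 1/2`, and about `|s|` steps are needed, so the total loss is only
exponential in `|s|`. -/
theorem logGrowth_inv_Gamma : LogGrowth fun s => (Complex.Gamma s)⁻¹ := by
  obtain ⟨C, hC, h⟩ := exists_norm_inv_Gamma_le_left
  have step : ∀ n : ℕ, ∀ s : ℂ, s.re ≤ 3 / 2 + n →
      ‖(Complex.Gamma s)⁻¹‖ ≤ 2 ^ n * Real.exp (C * logExponent ‖s‖) := by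
    intro n
    induction n with
    | zero => intro s hs; simpa using h s (by simpa using hs)
    | succ n ih =>
      intro s hs
      push_cast at hs
      by_cases h1 : s.re ≤ 3 / 2
      · refine (h s h1).trans (le_mul_of_one_le_left (Real.exp_pos _).le ?_)
        exact one_le_pow₀ (by norm_num)
      · push Not at h1
        have h2 := ih (s - 1) (by simp; linarith)
        have h3 : s - 1 ≠ 0 := fun h0 => by
          have := congrArg Complex.re h0; simp at this; linarith
        have h4 : Complex.Gamma s = (s - 1) * Complex.Gamma (s - 1) := by
          rw [← Complex.Gamma_add_one _ h3]; ring_nf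
        have h5 : ‖s - 1‖ ≤ ‖s‖ := by
          rw [Complex.norm_def, Complex.norm_def]
          apply Real.sqrt_le_sqrt
          simp [Complex.normSq_apply]
          nlinarith
        have h6 : 1 / 2 ≤ ‖s - 1‖ := by
          refine le_trans ?_ (Complex.re_le_norm _)
          simp; linarith
        rw [h4, mul_inv, norm_mul, norm_inv, pow_succ]
        have h7 : ‖s - 1‖⁻¹ ≤ 2 := by
          rw [inv_le_comm₀ (by linarith) (by norm_num)]; linarith
        have h8 : Real.exp (C * logExponent ‖s - 1‖) ≤ Real.exp (C * logExponent ‖s‖) :=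
          Real.exp_le_exp.mpr
            (mul_le_mul_of_nonneg_left (logExponent_mono (norm_nonneg _) h5) hC)
        calc _ ≤ 2 * (2 ^ n * Real.exp (C * logExponent ‖s - 1‖)) :=
              mul_le_mul h7 h2 (norm_nonneg _) (by norm_num)
          _ ≤ 2 * (2 ^ n * Real.exp (C * logExponent ‖s‖)) := by gcongr
          _ = _ := by ring
  refine ⟨C + 2, by positivity, fun s => ?_⟩
  have h1 := step ⌈‖s‖⌉₊ s (by
    have := Nat.le_ceil ‖s‖
    linarith [Complex.re_le_norm s])
  refine h1.trans ?_
  have hL' := add_two_le_logExponent (norm_nonneg s)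
  rw [add_mul, add_comm, Real.exp_add]
  refine mul_le_mul_of_nonneg_right ?_ (Real.exp_pos _).le
  calc (2 : ℝ) ^ ⌈‖s‖⌉₊ ≤ (Real.exp 1) ^ ⌈‖s‖⌉₊ := by
        gcongr; linarith [Real.add_one_le_exp 1]
    _ = Real.exp ⌈‖s‖⌉₊ := by rw [← Real.exp_nat_mul, mul_one]
    _ ≤ _ := Real.exp_le_exp.mpr (by linarith [Nat.ceil_lt_add_one (norm_nonneg s)])

theorem logGrowth_inv_GammaR (b : ℂ) : LogGrowth fun s => (Gammaℝ (s + b))⁻¹ := by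
  have hpi : (Real.pi : ℂ) ≠ 0 := by exact_mod_cast Real.pi_ne_zero
  have h1 := logGrowth_const_cpow hpi (1 / 2) (b / 2)
  have h2 := logGrowth_inv_Gamma.comp_affine (1 / 2) (b / 2)
  refine (funext fun s => ?_ : (fun s => _) = _) ▸ h1.mul h2
  rw [Gammaℝ_def, mul_inv, ← Complex.cpow_neg]
  ring_nf

/-- For every `ρ > 1` one has `log r = o(r ^ (ρ - 1))`, hence `r log r` is eventually below `r ^ ρ`,
whatever the constant. -/
theorem LogGrowth.entireOfOrderAtMost_one {g : ℂ → ℂ} (hg : LogGrowth g)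
    (hd : Differentiable ℂ g) : EntireOfOrderAtMost 1 g := by
  refine ⟨hd, fun ρ hρ => ?_⟩
  obtain ⟨C, hC, h⟩ := hg
  have key : ∀ᶠ r : ℝ in atTop, C * logExponent r ≤ r ^ ρ := by
    have h1 : (fun r : ℝ => Real.log r) =o[atTop] fun r : ℝ => r ^ (ρ - 1) :=
      isLittleO_log_rpow_atTop (by linarith)
    have h2 := h1.bound (show 0 < (1 / (4 * (C + 1)) : ℝ) by positivity)
    filter_upwards [h2, eventually_ge_atTop 2] with r hr hr2
    have hlog : 0 ≤ Real.log r := Real.log_nonneg (by linarith)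
    rw [Real.norm_of_nonneg hlog, Real.norm_of_nonneg (by positivity)] at hr
    have h3 : Real.log (r + 2) ≤ 2 * Real.log r := by
      rw [← Real.log_rpow (by linarith)]
      apply Real.log_le_log (by linarith)
      norm_num
      nlinarith
    have h4 : r ^ ρ = r * r ^ (ρ - 1) := by
      rw [← Real.rpow_one_add' (by linarith) (by linarith)]; ring_nf
    have h5 : logExponent r ≤ 4 * r * Real.log r := by
      unfold logExponent
      have : 0 ≤ Real.log (r + 2) := Real.log_nonneg (by linarith)
      nlinarith
    rw [h4]
    have hp : 0 ≤ r ^ (ρ - 1) := by positivity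
    have h6 : 4 * (C + 1) * Real.log r ≤ r ^ (ρ - 1) := by
      rw [div_mul_eq_mul_div, one_mul, le_div_iff₀ (by positivity)] at hr
      linarith
    have h7 : C * logExponent r ≤ C * (4 * r * Real.log r) := mul_le_mul_of_nonneg_left h5 hC
    have h8 : 0 ≤ r * Real.log r := by positivity
    have h9 : r * (4 * (C + 1) * Real.log r) ≤ r * r ^ (ρ - 1) :=
      mul_le_mul_of_nonneg_left h6 (by linarith)
    nlinarith
  refine Asymptotics.IsBigO.of_bound 1 ?_
  have h2 := (tendsto_norm_cobounded_atTop (E := ℂ)).eventually key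
  filter_upwards [h2] with s hs
  rw [one_mul, Real.norm_of_nonneg (Real.exp_pos _).le]
  exact (h s).trans (Real.exp_le_exp.mpr hs)

/-! ### Rapidly decaying functions on the half-line -/

/-- Continuous functions on `(0, ∞)` bounded by `exp (C (m + 2) log (m + 2)) t ^ (-m)` for all
sufficiently large `m`. -/
def RapidDecay (K : ℝ → ℂ) : Prop :=
  ContinuousOn K (Set.Ioi 0) ∧ ∃ C : ℝ, 0 ≤ C ∧ ∃ m₀ : ℕ, ∀ m : ℕ, m₀ ≤ m → ∀ t : ℝ, 0 < t →
    ‖K t‖ ≤ Real.exp (C * logExponent m) / t ^ m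

theorem RapidDecay.congr {K K' : ℝ → ℂ} (hK : RapidDecay K) (h : ∀ t, 0 < t → K' t = K t) :
    RapidDecay K' := by
  obtain ⟨h1, C, hC, m₀, h2⟩ := hK
  refine ⟨h1.congr fun t ht => h t ht, C, hC, m₀, fun m hm t ht => ?_⟩
  rw [h t ht]; exact h2 m hm t ht

theorem RapidDecay.add {K K' : ℝ → ℂ} (hK : RapidDecay K) (hK' : RapidDecay K') :
    RapidDecay fun t => K t + K' t := by
  obtain ⟨h1, C, hC, m₀, h2⟩ := hK
  obtain ⟨h1', C', hC', m₀', h2'⟩ := hK'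
  refine ⟨h1.add h1', C + C' + 1, by positivity, max m₀ m₀', fun m hm t ht => ?_⟩
  have hL := logExponent_pos (Nat.cast_nonneg (α := ℝ) m)
  have a1 := h2 m (le_of_max_le_left hm) t ht
  have a2 := h2' m (le_of_max_le_right hm) t ht
  have b1 : Real.exp (C * logExponent m) ≤ Real.exp ((C + C') * logExponent m) :=
    Real.exp_le_exp.mpr (by nlinarith)
  have b2 : Real.exp (C' * logExponent m) ≤ Real.exp ((C + C') * logExponent m) :=
    Real.exp_le_exp.mpr (by nlinarith)
  have b3 : 2 ≤ Real.exp (logExponent m) := by linarith [Real.add_one_le_exp (logExponent (m : ℝ))]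
  have b4 := Real.exp_pos ((C + C') * logExponent m)
  calc ‖K t + K' t‖ ≤ ‖K t‖ + ‖K' t‖ := norm_add_le _ _
    _ ≤ (Real.exp (C * logExponent m) + Real.exp (C' * logExponent m)) / t ^ m := by
        rw [add_div]; exact add_le_add a1 a2
    _ ≤ _ := by
        apply div_le_div_of_nonneg_right _ (by positivity)
        rw [add_mul (C + C'), Real.exp_add, one_mul]
        nlinarith

theorem RapidDecay.const_mul {K : ℝ → ℂ} (hK : RapidDecay K) (c : ℂ) :
    RapidDecay fun t => c * K t := by
  obtain ⟨h1, C, hC, m₀, h2⟩ := hK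
  refine ⟨h1.const_smul c, C + ‖c‖, by positivity, m₀, fun m hm t ht => ?_⟩
  have hL := logExponent_pos (Nat.cast_nonneg (α := ℝ) m)
  have b : ‖c‖ ≤ Real.exp (‖c‖ * logExponent m) := by
    have := Real.add_one_le_exp (‖c‖ * logExponent m)
    nlinarith [norm_nonneg c]
  rw [norm_mul, add_comm, add_mul, Real.exp_add, mul_div_assoc]
  exact mul_le_mul b (h2 m hm t ht) (norm_nonneg _) (Real.exp_pos _).le

theorem RapidDecay.comp_mul_left {K : ℝ → ℂ} (hK : RapidDecay K) {c : ℝ} (hc : 0 < c) :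
    RapidDecay fun t => K (c * t) := by
  obtain ⟨h1, C, hC, m₀, h2⟩ := hK
  refine ⟨h1.comp (by fun_prop) fun t ht => mul_pos hc ht, C + (2 * (1 + c⁻¹) + 1), by positivity,
    m₀, fun m hm t ht => ?_⟩
  refine (h2 m hm (c * t) (by positivity)).trans ?_
  rw [mul_pow, add_mul, Real.exp_add, ← div_div]
  apply div_le_div_of_nonneg_right _ (by positivity)
  rw [div_eq_mul_inv, ← inv_pow]
  apply mul_le_mul_of_nonneg_left _ (Real.exp_pos _).le
  have : 0 < c⁻¹ := by positivity
  exact pow_le_exp_logExponent (by linarith) m (by positivity) (by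
    have : (0 : ℝ) ≤ m := by positivity
    nlinarith)

theorem RapidDecay.locallyIntegrableOn {K : ℝ → ℂ} (hK : RapidDecay K) :
    LocallyIntegrableOn K (Set.Ioi 0) :=
  hK.1.locallyIntegrableOn measurableSet_Ioi

theorem RapidDecay.isBigO_atTop {K : ℝ → ℂ} (hK : RapidDecay K) (a : ℝ) :
    K =O[atTop] fun t => t ^ (-a) := by
  obtain ⟨-, C, hC, m₀, h2⟩ := hK
  set m := max m₀ ⌈a⌉₊
  refine Asymptotics.IsBigO.of_bound (Real.exp (C * logExponent m)) ?_
  filter_upwards [eventually_ge_atTop 1] with t ht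
  have ht0 : 0 < t := by linarith
  refine (h2 m (le_max_left _ _) t ht0).trans ?_
  rw [div_eq_mul_inv, Real.norm_of_nonneg (by positivity)]
  apply mul_le_mul_of_nonneg_left _ (Real.exp_pos _).le
  rw [← Real.rpow_natCast, ← Real.rpow_neg ht0.le]
  apply Real.rpow_le_rpow_of_exponent_le ht
  have h3 : (⌈a⌉₊ : ℝ) ≤ (m : ℝ) := by exact_mod_cast le_max_right _ _
  linarith [Nat.le_ceil a]

theorem RapidDecay.exists_isBigO_zero {K : ℝ → ℂ} (hK : RapidDecay K) :
    ∃ b : ℝ, K =O[𝓝[>] 0] fun t => t ^ (-b) := by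
  obtain ⟨-, C, hC, m₀, h2⟩ := hK
  refine ⟨m₀, Asymptotics.IsBigO.of_bound (Real.exp (C * logExponent m₀)) ?_⟩
  filter_upwards [self_mem_nhdsWithin] with t ht
  have ht0 : 0 < t := ht
  refine (h2 m₀ le_rfl t ht0).trans (le_of_eq ?_)
  rw [div_eq_mul_inv, Real.norm_of_nonneg (by positivity), Real.rpow_neg ht0.le, Real.rpow_natCast]

theorem RapidDecay.exists_mellinConvergent {K : ℝ → ℂ} (hK : RapidDecay K) :
    ∃ σ : ℝ, ∀ s : ℂ, σ < s.re → MellinConvergent K s := by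
  obtain ⟨b, hb⟩ := hK.exists_isBigO_zero
  exact ⟨b, fun s hs => mellinConvergent_of_isBigO_rpow hK.locallyIntegrableOn
    (hK.isBigO_atTop (s.re + 1)) (by linarith) hb hs⟩

/-! ### The incomplete Mellin transform -/

/-- The integral `∫_1^∞ t^(s-1) K(t) dt`. -/
def upperMellin (K : ℝ → ℂ) (s : ℂ) : ℂ := mellin (Set.indicator (Set.Ioi 1) K) s

theorem RapidDecay.upper_aux {K : ℝ → ℂ} (hK : RapidDecay K) (a b : ℝ) :
    LocallyIntegrableOn (Set.indicator (Set.Ioi 1) K) (Set.Ioi 0) ∧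
    (Set.indicator (Set.Ioi 1) K =O[atTop] fun t => t ^ (-a)) ∧
    (Set.indicator (Set.Ioi 1) K =O[𝓝[>] 0] fun t => t ^ (-b)) := by
  refine ⟨fun x hx => ?_, ?_, ?_⟩
  · obtain ⟨t, ht, h⟩ := hK.locallyIntegrableOn x hx
    exact ⟨t, ht, h.indicator measurableSet_Ioi⟩
  · refine (hK.isBigO_atTop a).congr' ?_ EventuallyEq.rfl
    filter_upwards [eventually_gt_atTop 1] with t ht
    rw [Set.indicator_of_mem (show t ∈ Set.Ioi 1 from ht)]
  · refine (Asymptotics.isBigO_zero _ _).congr' ?_ EventuallyEq.rfl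
    have : Set.Iio (1 : ℝ) ∈ 𝓝[>] (0 : ℝ) := mem_nhdsWithin_of_mem_nhds (Iio_mem_nhds one_pos)
    filter_upwards [this] with t ht
    rw [Set.indicator_of_notMem (by simpa using (show t < 1 from ht).le)]

theorem RapidDecay.upper_mellinConvergent {K : ℝ → ℂ} (hK : RapidDecay K) (s : ℂ) :
    MellinConvergent (Set.indicator (Set.Ioi 1) K) s := by
  obtain ⟨h1, h2, h3⟩ := hK.upper_aux (s.re + 1) (s.re - 1)
  exact mellinConvergent_of_isBigO_rpow h1 h2 (by linarith) h3 (by linarith)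

theorem RapidDecay.differentiable_upperMellin {K : ℝ → ℂ} (hK : RapidDecay K) :
    Differentiable ℂ (upperMellin K) := by
  intro s
  obtain ⟨h1, h2, h3⟩ := hK.upper_aux (s.re + 1) (s.re - 1)
  exact mellin_differentiableAt_of_isBigO_rpow h1 h2 (by linarith) h3 (by linarith)

theorem RapidDecay.logGrowth_upperMellin {K : ℝ → ℂ} (hK : RapidDecay K) :
    LogGrowth (upperMellin K) := by
  obtain ⟨-, C, hC, m₀, h⟩ := hK
  obtain ⟨D, hD, h'⟩ := exists_logExponent_affine_le (zero_le_one)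
    (show (0 : ℝ) ≤ m₀ + 2 by positivity)
  refine ⟨C * D, by positivity, fun s => ?_⟩
  -- The decay exponent follows `s`: with `m ≥ |s| + 1` the integrand is at most a constant times `t
  -- ^ (-2)`. As `m = |s| + O(1)`, that constant is `exp (O(|s| log |s|))`. This needs the `C` in
  -- `RapidDecay` to be uniform in `m`.
  set m : ℕ := ⌈‖s‖⌉₊ + 1 + m₀ with hm
  have hm1 : ‖s‖ + 1 ≤ m := by
    rw [hm]; push_cast
    linarith [Nat.le_ceil ‖s‖, Nat.cast_nonneg (α := ℝ) m₀]
  have hm2 : (m : ℝ) ≤ 1 * ‖s‖ + (m₀ + 2) := by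
    rw [hm]; push_cast
    linarith [Nat.ceil_lt_add_one (norm_nonneg s)]
  have e1 : upperMellin K s = ∫ t in Set.Ioi (1 : ℝ), (t : ℂ) ^ (s - 1) * K t := by
    unfold upperMellin mellin
    rw [← integral_indicator measurableSet_Ioi, ← integral_indicator measurableSet_Ioi]
    congr 1
    ext t
    by_cases h1 : 1 < t
    · rw [Set.indicator_of_mem (show t ∈ Set.Ioi 0 from by simpa using by linarith),
        Set.indicator_of_mem (show t ∈ Set.Ioi 1 from h1),
        Set.indicator_of_mem (show t ∈ Set.Ioi 1 from h1), smul_eq_mul]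
    · rw [Set.indicator_of_notMem (show t ∉ Set.Ioi 1 from h1)]
      by_cases h0 : 0 < t
      · rw [Set.indicator_of_mem (show t ∈ Set.Ioi 0 from h0),
          Set.indicator_of_notMem (show t ∉ Set.Ioi 1 from h1), smul_zero]
      · rw [Set.indicator_of_notMem (show t ∉ Set.Ioi 0 from h0)]
  rw [e1]
  have hint : IntegrableOn (fun t : ℝ => Real.exp (C * logExponent m) * t ^ (-2 : ℝ))
      (Set.Ioi 1) := (integrableOn_Ioi_rpow_of_lt (by norm_num) one_pos).const_mul _
  have hbd : ∀ t ∈ Set.Ioi (1 : ℝ), ‖(t : ℂ) ^ (s - 1) * K t‖ ≤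
      Real.exp (C * logExponent m) * t ^ (-2 : ℝ) := by
    intro t ht
    have ht1 : 1 < t := ht
    have ht0 : 0 < t := by linarith
    rw [norm_mul, Complex.norm_cpow_eq_rpow_re_of_pos ht0]
    have h1 := h m (by omega) t ht0
    calc t ^ (s - 1).re * ‖K t‖ ≤ t ^ ((m : ℝ) - 2) * (Real.exp (C * logExponent m) / t ^ m) := by
          apply mul_le_mul _ h1 (norm_nonneg _) (by positivity)
          apply Real.rpow_le_rpow_of_exponent_le ht1.le
          simp
          linarith [Complex.re_le_norm s]
      _ = _ := by
          rw [sub_eq_add_neg, Real.rpow_add ht0, Real.rpow_natCast]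
          field_simp
  refine (norm_integral_le_of_norm_le hint
    ((ae_restrict_iff' measurableSet_Ioi).mpr (Eventually.of_forall hbd))).trans ?_
  rw [integral_const_mul, integral_Ioi_rpow_of_lt (by norm_num) one_pos]
  norm_num
  rw [mul_assoc]
  exact mul_le_mul_of_nonneg_left (h' _ (norm_nonneg s) _ (by positivity) hm2) hC

/-- Splitting the Mellin integral at `1`. -/
theorem RapidDecay.mellin_eq_upperMellin_add {K K' : ℝ → ℂ} (hK : RapidDecay K)
    (hK' : RapidDecay K') {k c₁ c₂ c₃ a₁ a₂ a₃ : ℂ}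
    (h : ∀ t : ℝ, 0 < t → K t = (t : ℂ) ^ (-k) * K' t⁻¹ +
      (c₁ * (t : ℂ) ^ a₁ + c₂ * (t : ℂ) ^ a₂ + c₃ * (t : ℂ) ^ a₃))
    {s : ℂ} (h₁ : 0 < s.re + a₁.re) (h₂ : 0 < s.re + a₂.re) (h₃ : 0 < s.re + a₃.re) :
    mellin K s = upperMellin K s + upperMellin K' (k - s) +
      (c₁ / (s + a₁) + c₂ / (s + a₂) + c₃ / (s + a₃)) := by
  have hp : ∀ {c a : ℂ}, 0 < s.re + a.re →
      HasMellin (fun t : ℝ => c * (Set.Ioc (0 : ℝ) 1).indicator (fun t : ℝ => (t : ℂ) ^ a) t) s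
        (c / (s + a)) := by
    intro c a ha
    have h1 := hasMellin_cpow_Ioc a ha
    have h2 := hasMellin_const_smul h1.1 c
    simp only [smul_eq_mul] at h2
    refine ⟨h2.1, ?_⟩
    rw [h2.2, h1.2]; ring
  have e1 : HasMellin (Set.indicator (Set.Ioi 1) K) s (upperMellin K s) :=
    ⟨hK.upper_mellinConvergent s, rfl⟩
  -- The contribution of `(0, 1)`: after cutting `K'` off to `(1, ∞)`, the function `t ^ (-k)
  -- K'(1/t)` lives on `(0, 1)`, and inversion moves its Mellin transform to `k - s`.
  have e2 : HasMellin (fun t : ℝ => (t : ℂ) ^ (-k) • (Set.indicator (Set.Ioi 1) K') t⁻¹) s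
      (upperMellin K' (k - s)) := by
    refine ⟨?_, ?_⟩
    · rw [MellinConvergent.cpow_smul]
      have := MellinConvergent.comp_rpow (f := Set.indicator (Set.Ioi 1) K') (s := s + -k)
        (a := -1) (by norm_num)
      simp only [Real.rpow_neg_one] at this
      rw [this]
      exact hK'.upper_mellinConvergent _
    · rw [mellin_cpow_smul, mellin_comp_inv, upperMellin]
      congr 1; ring
  have e3 := hasMellin_add e1.1 e2.1
  have e4 := hasMellin_add (hp (c := c₁) h₁).1 (hp (c := c₂) h₂).1
  have e5 := hasMellin_add e4.1 (hp (c := c₃) h₃).1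
  have e6 := hasMellin_add e3.1 e5.1
  rw [e3.2, e5.2, e4.2, e1.2, e2.2, (hp h₁).2, (hp h₂).2, (hp h₃).2] at e6
  rw [← e6.2, mellin, mellin]
  refine setIntegral_congr_ae measurableSet_Ioi ?_
  -- At `t = 1` both cut-offs to `(1, ∞)` vanish and the decomposition can fail, so this null point
  -- is removed.
  have hne : ∀ᵐ t : ℝ, t ≠ 1 := by simp [ae_iff, measure_singleton]
  filter_upwards [hne] with t ht1 ht
  have ht0 : 0 < t := ht
  congr 1
  rcases lt_or_gt_of_ne ht1 with h1 | h1
  · have hinv : t⁻¹ ∈ Set.Ioi (1 : ℝ) := (one_lt_inv₀ ht0).mpr h1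
    have hioc : t ∈ Set.Ioc (0 : ℝ) 1 := ⟨ht0, h1.le⟩
    rw [Set.indicator_of_notMem (show t ∉ Set.Ioi 1 from by simpa using h1.le),
      Set.indicator_of_mem hinv, Set.indicator_of_mem hioc, Set.indicator_of_mem hioc,
      Set.indicator_of_mem hioc, zero_add, smul_eq_mul]
    exact h t ht0
  · have hinv : t⁻¹ ∉ Set.Ioi (1 : ℝ) := by
      simpa using inv_le_one_of_one_le₀ h1.le
    have hioc : t ∉ Set.Ioc (0 : ℝ) 1 := fun h2 => absurd h2.2 (not_le.mpr h1)
    rw [Set.indicator_of_mem (show t ∈ Set.Ioi 1 from h1),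
      Set.indicator_of_notMem hinv, Set.indicator_of_notMem hioc, Set.indicator_of_notMem hioc,
      Set.indicator_of_notMem hioc]
    simp

/-! ### Theta series -/

/-- Polynomial growth of a sequence on the positive integers. -/
def NatGrowth (a : ℕ → ℂ) : Prop :=
  ∃ c : ℝ, 0 ≤ c ∧ ∃ k : ℕ, ∀ n : ℕ, n ≠ 0 → ‖a n‖ ≤ c * (n : ℝ) ^ k

/-- The series `∑_{n ≥ 1} a(n) K(nt)`. -/
def thetaSeries (a : ℕ → ℂ) (K : ℝ → ℂ) (t : ℝ) : ℂ :=
  ∑' n : ℕ, a (n + 1) * K (((n + 1 : ℕ) : ℝ) * t)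

theorem summable_inv_succ_sq : Summable fun n : ℕ => 1 / (((n + 1 : ℕ) : ℝ)) ^ 2 :=
  (summable_nat_add_iff (f := fun n : ℕ => 1 / (n : ℝ) ^ 2) 1).mpr
    (Real.summable_one_div_nat_pow.mpr (by norm_num))

/-- If `a(n)` grows like `n ^ k`, decay of order `m ≥ k + 2` leaves `n ^ (-2)`, so one convergent
series majorizes the theta series for all `m` at once. -/
theorem RapidDecay.exists_term_bound {a : ℕ → ℂ} {K : ℝ → ℂ} (ha : NatGrowth a)
    (hK : RapidDecay K) :
    ∃ c C : ℝ, 0 ≤ c ∧ 0 ≤ C ∧ ∃ m₀ : ℕ, ∀ m : ℕ, m₀ ≤ m → ∀ t : ℝ, 0 < t → ∀ n : ℕ,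
      ‖a (n + 1) * K (((n + 1 : ℕ) : ℝ) * t)‖ ≤
        c * Real.exp (C * logExponent m) / t ^ m * (1 / (((n + 1 : ℕ) : ℝ)) ^ 2) := by
  obtain ⟨c, hc, k, ha⟩ := ha
  obtain ⟨-, C, hC, m₀, h⟩ := hK
  refine ⟨c, C, hc, hC, max m₀ (k + 2), fun m hm t ht n => ?_⟩
  have h1 := ha (n + 1) (by omega)
  have hn : (1 : ℝ) ≤ ((n + 1 : ℕ) : ℝ) := by exact_mod_cast Nat.le_add_left 1 n
  set x : ℝ := ((n + 1 : ℕ) : ℝ)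
  have h2 := h m (le_of_max_le_left hm) (x * t) (by positivity)
  rw [norm_mul]
  calc ‖a (n + 1)‖ * ‖K (x * t)‖ ≤ (c * x ^ k) * (Real.exp (C * logExponent m) / (x * t) ^ m) :=
        mul_le_mul h1 h2 (norm_nonneg _) (by positivity)
    _ = c * Real.exp (C * logExponent m) / t ^ m * (x ^ k / x ^ m) := by
        rw [mul_pow]; field_simp
    _ ≤ _ := by
        apply mul_le_mul_of_nonneg_left _ (by positivity)
        rw [div_le_div_iff₀ (by positivity) (by positivity), one_mul, ← pow_add]
        exact pow_le_pow_right₀ hn (le_of_max_le_right hm)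

theorem RapidDecay.summable_thetaSeries {a : ℕ → ℂ} {K : ℝ → ℂ} (ha : NatGrowth a)
    (hK : RapidDecay K) {t : ℝ} (ht : 0 < t) :
    Summable fun n : ℕ => a (n + 1) * K (((n + 1 : ℕ) : ℝ) * t) := by
  obtain ⟨c, C, hc, hC, m₀, h⟩ := hK.exists_term_bound ha
  exact Summable.of_norm_bounded (summable_inv_succ_sq.mul_left _) (h m₀ le_rfl t ht)

theorem RapidDecay.thetaSeries {a : ℕ → ℂ} {K : ℝ → ℂ} (ha : NatGrowth a)
    (hK : RapidDecay K) : RapidDecay (thetaSeries a K) := by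
  obtain ⟨c, C, hc, hC, m₀, h⟩ := hK.exists_term_bound ha
  set S := ∑' n : ℕ, 1 / (((n + 1 : ℕ) : ℝ)) ^ 2 with hS
  have hS0 : 0 ≤ S := tsum_nonneg fun n => by positivity
  refine ⟨?_, C + c * S, by positivity, m₀, fun m hm t ht => ?_⟩
  · intro t₀ ht₀
    have ht₀' : 0 < t₀ := ht₀
    have h1 : ContinuousOn (FerrarSuzuki.thetaSeries a K) (Set.Ioi (t₀ / 2)) := by
      refine continuousOn_tsum (u := fun n : ℕ => c * Real.exp (C * logExponent m₀) /
        (t₀ / 2) ^ m₀ * (1 / (((n + 1 : ℕ) : ℝ)) ^ 2)) (fun n => ?_)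
        (summable_inv_succ_sq.mul_left _) (fun n t ht => ?_)
      · refine ContinuousOn.mul continuousOn_const (hK.1.comp (by fun_prop) fun t ht => ?_)
        have ht' : t₀ / 2 < t := ht
        have : 0 < t := by linarith
        exact Set.mem_Ioi.mpr (by positivity)
      · have ht' : t₀ / 2 < t := ht
        refine (h m₀ le_rfl t (by linarith) n).trans ?_
        gcongr
    exact (h1.continuousAt (Ioi_mem_nhds (by linarith))).continuousWithinAt
  · have h1 := tsum_of_norm_bounded (summable_inv_succ_sq.hasSum.mul_left _) (h m hm t ht)
    refine h1.trans ?_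
    rw [← hS, add_mul, Real.exp_add]
    have hL := logExponent_pos (Nat.cast_nonneg (α := ℝ) m)
    have b : c * S ≤ Real.exp (c * S * logExponent m) := by
      have h2 : c * S ≤ c * S * logExponent m := le_mul_of_one_le_right (by positivity) hL
      linarith [Real.add_one_le_exp (c * S * logExponent m)]
    calc c * Real.exp (C * logExponent m) / t ^ m * S
        = Real.exp (C * logExponent m) / t ^ m * (c * S) := by ring
      _ ≤ Real.exp (C * logExponent m) / t ^ m * Real.exp (c * S * logExponent m) := by gcongr
      _ = _ := by ring

theorem NatGrowth.exists_LSeriesSummable {a : ℕ → ℂ} (ha : NatGrowth a) :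
    ∃ σ : ℝ, ∀ s : ℂ, σ < s.re → LSeriesSummable a s := by
  obtain ⟨c, hc, k, h⟩ := ha
  refine ⟨k + 1, fun s hs => LSeriesSummable_of_le_const_mul_rpow hs ⟨c, fun n hn => ?_⟩⟩
  rw [add_sub_cancel_right, Real.rpow_natCast]
  exact h n hn

/-- The Mellin transform of a theta series is a Dirichlet series times a Mellin transform. -/
theorem RapidDecay.exists_mellin_thetaSeries {a : ℕ → ℂ} {K : ℝ → ℂ} (ha : NatGrowth a)
    (hK : RapidDecay K) :
    ∃ σ : ℝ, ∀ s : ℂ, σ < s.re → LSeriesSummable a s ∧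
      HasMellin (FerrarSuzuki.thetaSeries a K) s (LSeries a s * mellin K s) := by
  obtain ⟨σ₁, h₁⟩ := ha.exists_LSeriesSummable
  obtain ⟨σ₂, h₂⟩ := hK.exists_mellinConvergent
  obtain ⟨σ₃, h₃⟩ := (hK.thetaSeries ha).exists_mellinConvergent
  refine ⟨max σ₁ (max σ₂ σ₃), fun s hs => ?_⟩
  have hs1 := h₁ s (lt_of_le_of_lt (le_max_left _ _) hs)
  have hs2 := h₂ s (lt_of_le_of_lt ((le_max_left _ _).trans (le_max_right _ _)) hs)
  have hs3 := h₃ s (lt_of_le_of_lt ((le_max_right _ _).trans (le_max_right _ _)) hs)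
  refine ⟨hs1, hs3, ?_⟩
  set G : ℝ → ℂ := fun t => (t : ℂ) ^ (s - 1) • K t with hG
  have hGi : IntegrableOn G (Set.Ioi 0) := hs2
  have hterm : ∀ n : ℕ, LSeries.term a s (n + 1) =
      a (n + 1) * ((n + 1 : ℕ) : ℂ) ^ (-s) := fun n => by
    rw [LSeries.term_of_ne_zero (by omega), Complex.cpow_neg, div_eq_mul_inv]
  have hsum : HasSum (fun n : ℕ => LSeries.term a s (n + 1)) (LSeries a s) := by
    have := (hasSum_nat_add_iff (f := LSeries.term a s) 1 (g := LSeries a s)).mpr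
    simp only [Finset.sum_range_one, LSeries.term_zero, add_zero] at this
    exact this hs1.hasSum
  -- The `n`-th term of the theta series times `t ^ (s - 1)`, written as a dilate of one function
  -- `G`. Scaling then gives both its integral and its `L¹` norm as the Dirichlet term times a fixed
  -- number.
  set F : ℕ → ℝ → ℂ := fun n t => (a (n + 1) * ((n + 1 : ℕ) : ℂ) ^ (-(s - 1))) *
    G (((n + 1 : ℕ) : ℝ) * t) with hF
  have hFint : ∀ n, IntegrableOn (F n) (Set.Ioi 0) := fun n => by
    refine Integrable.const_mul ?_ _
    rw [← IntegrableOn, integrableOn_Ioi_comp_mul_left_iff _ _ (by positivity), mul_zero]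
    exact hGi
  have hx : ∀ n : ℕ, ((n + 1 : ℕ) : ℂ) ≠ 0 := fun n => by exact_mod_cast n.succ_ne_zero
  have hcoef : ∀ n : ℕ, a (n + 1) * ((n + 1 : ℕ) : ℂ) ^ (-(s - 1)) * (((n + 1 : ℕ) : ℂ))⁻¹ =
      LSeries.term a s (n + 1) := fun n => by
    rw [hterm, show -(s - 1) = -s + 1 by ring, Complex.cpow_add _ _ (hx n), Complex.cpow_one]
    field_simp [hx n]
  have hFval : ∀ n, ∫ t in Set.Ioi 0, F n t = LSeries.term a s (n + 1) * mellin K s := fun n => by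
    simp only [hF]
    rw [integral_const_mul, integral_comp_mul_left_Ioi _ _ (by positivity), mul_zero, mellin,
      ← hcoef, Complex.real_smul]
    push_cast
    ring
  have hFnorm : ∀ n, ∫ t in Set.Ioi 0, ‖F n t‖ =
      ‖LSeries.term a s (n + 1)‖ * ∫ t in Set.Ioi 0, ‖G t‖ := fun n => by
    simp only [hF, norm_mul]
    rw [integral_const_mul, integral_comp_mul_left_Ioi (fun t => ‖G t‖) _ (by positivity), mul_zero,
      ← hcoef, smul_eq_mul, norm_mul, norm_mul, norm_inv, Complex.norm_natCast]
    ring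
  have hmain := hasSum_integral_of_summable_integral_norm hFint (by
    simp only [hFnorm]
    exact hsum.summable.norm.mul_right _)
  simp only [hFval] at hmain
  have e := hmain.unique (hsum.mul_right (mellin K s))
  rw [← e, mellin]
  refine setIntegral_congr_fun measurableSet_Ioi fun t ht => ?_
  have ht0 : 0 < t := ht
  simp only [hF, hG, FerrarSuzuki.thetaSeries, smul_eq_mul]
  rw [← tsum_mul_left]
  refine tsum_congr fun n => ?_
  rw [Complex.ofReal_mul, Complex.mul_cpow_ofReal_nonneg (by positivity) ht0.le,
    Complex.cpow_neg, Complex.ofReal_natCast]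
  have : ((n + 1 : ℕ) : ℂ) ^ (s - 1) ≠ 0 := by
    rw [Complex.cpow_def_of_ne_zero (hx n)]; exact Complex.exp_ne_zero _
  field_simp

/-! ### The flat functions `x ^ (-μ) exp (-π / x²)` -/

/-- The function equal to `x ^ (-μ) exp (-π / x ^ 2)` for `0 < x` and to `0` for `x ≤ 0`. -/
def flatPower (μ : ℂ) (x : ℝ) : ℂ :=
  if 0 < x then (x : ℂ) ^ (-μ) * cexp (-Real.pi / (x : ℂ) ^ 2) else 0

theorem flatPower_of_pos (μ : ℂ) {x : ℝ} (hx : 0 < x) :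
    flatPower μ x = (x : ℂ) ^ (-μ) * cexp (-Real.pi / (x : ℂ) ^ 2) := if_pos hx

theorem flatPower_of_nonpos (μ : ℂ) {x : ℝ} (hx : x ≤ 0) : flatPower μ x = 0 :=
  if_neg (not_lt.mpr hx)

theorem norm_flatPower (μ : ℂ) {x : ℝ} (hx : 0 < x) :
    ‖flatPower μ x‖ = x ^ (-μ.re) * Real.exp (-Real.pi / x ^ 2) := by
  rw [flatPower_of_pos μ hx, norm_mul, Complex.norm_cpow_eq_rpow_re_of_pos hx, Complex.norm_exp]
  congr 2
  have : (-Real.pi / (x : ℂ) ^ 2) = ((-Real.pi / x ^ 2 : ℝ) : ℂ) := by push_cast; ring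
  rw [this, Complex.ofReal_re]

/-- With `y = x⁻²`, `y ^ n ≤ n! e^y` and `e^(y - πy) ≤ 1`. This is the source of the factorial
growth of the derivatives. -/
theorem rpow_mul_exp_le_factorial {Y : ℝ} {n : ℕ} (hY : Y ≤ 2 * n) {x : ℝ} (hx : 0 < x)
    (hx1 : x ≤ 1) : x ^ (-Y) * Real.exp (-Real.pi / x ^ 2) ≤ n.factorial := by
  have h1 : x ^ (-Y) ≤ ((x ^ 2)⁻¹) ^ n := by
    rw [← inv_pow, ← pow_mul, ← Real.rpow_natCast, Real.inv_rpow hx.le, ← Real.rpow_neg hx.le]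
    exact Real.rpow_le_rpow_of_exponent_ge hx hx1 (by push_cast; linarith)
  have h2 := Real.pow_div_factorial_le_exp (x := (x ^ 2)⁻¹) (by positivity) n
  rw [div_le_iff₀ (by positivity)] at h2
  have h3 : Real.exp ((x ^ 2)⁻¹) * Real.exp (-Real.pi / x ^ 2) ≤ 1 := by
    rw [← Real.exp_add]
    apply Real.exp_le_one_iff.mpr
    have : 0 < (x ^ 2)⁻¹ := by positivity
    have h4 : (x ^ 2)⁻¹ + -Real.pi / x ^ 2 = (x ^ 2)⁻¹ * (1 - Real.pi) := by ring
    rw [h4]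
    nlinarith [Real.pi_gt_three]
  have hf : (0 : ℝ) ≤ n.factorial := by positivity
  calc x ^ (-Y) * Real.exp (-Real.pi / x ^ 2)
      ≤ (Real.exp ((x ^ 2)⁻¹) * n.factorial) * Real.exp (-Real.pi / x ^ 2) := by
        gcongr; exact h1.trans h2
    _ = n.factorial * (Real.exp ((x ^ 2)⁻¹) * Real.exp (-Real.pi / x ^ 2)) := by ring
    _ ≤ n.factorial * 1 := by gcongr
    _ = _ := mul_one _

/-- The family of flat functions is closed under differentiation, with `μ` shifted by `1` and `3`.
Smoothness, derivative bounds and Mellin transforms of derivatives all follow by induction from this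
relation. At the origin it suffices that the function is `O(y²)`. -/
theorem hasDerivAt_flatPower (μ : ℂ) (x : ℝ) :
    HasDerivAt (flatPower μ) (-μ * flatPower (μ + 1) x + 2 * Real.pi * flatPower (μ + 3) x) x := by
  rcases lt_trichotomy x 0 with hx | hx | hx
  · rw [flatPower_of_nonpos _ hx.le, flatPower_of_nonpos _ hx.le, mul_zero, mul_zero, add_zero]
    refine (hasDerivAt_const x (0 : ℂ)).congr_of_eventuallyEq ?_
    filter_upwards [Iio_mem_nhds hx] with y hy
    exact flatPower_of_nonpos _ (le_of_lt hy)
  · subst hx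
    rw [flatPower_of_nonpos _ le_rfl, flatPower_of_nonpos _ le_rfl, mul_zero, mul_zero, add_zero,
      hasDerivAt_iff_isLittleO]
    simp only [flatPower_of_nonpos _ le_rfl, sub_zero, smul_zero]
    have h1 : (fun y : ℝ => flatPower μ y) =O[𝓝 0] fun y : ℝ => y ^ 2 := by
      set n := ⌈|μ.re| + 2⌉₊
      have hn : |μ.re| + 2 ≤ n := Nat.le_ceil _
      refine Asymptotics.IsBigO.of_bound n.factorial ?_
      filter_upwards [Iio_mem_nhds (show (0 : ℝ) < 1 by norm_num)] with y hy
      rcases le_or_gt y 0 with h | h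
      · rw [flatPower_of_nonpos _ h, norm_zero]; positivity
      · rw [norm_flatPower _ h, Real.norm_of_nonneg (by positivity)]
        have h2 := rpow_mul_exp_le_factorial (Y := μ.re + 2) (n := n) (by
          linarith [le_abs_self μ.re, abs_nonneg μ.re]) h (le_of_lt hy)
        have h3 : y ^ (-μ.re) = y ^ (-(μ.re + 2)) * y ^ 2 := by
          rw [← Real.rpow_natCast, ← Real.rpow_add h]; congr 1; push_cast; ring
        rw [h3]
        nlinarith [sq_nonneg y]
    exact h1.trans_isLittleO (Asymptotics.isLittleO_pow_id (by norm_num))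
  · have hxc : (x : ℂ) ∈ slitPlane := Complex.ofReal_mem_slitPlane.mpr hx
    have hx0 : (x : ℂ) ≠ 0 := by exact_mod_cast hx.ne'
    have h1 : HasDerivAt (fun z : ℂ => z ^ (-μ)) (-μ * (x : ℂ) ^ (-μ - 1) * 1) (x : ℂ) :=
      (hasDerivAt_id (x : ℂ)).cpow_const hxc
    have h2 : HasDerivAt (fun z : ℂ => -Real.pi / z ^ 2) (2 * Real.pi / (x : ℂ) ^ 3) (x : ℂ) := by
      have := ((hasDerivAt_pow 2 (x : ℂ)).inv (pow_ne_zero 2 hx0)).const_mul (-(Real.pi : ℂ))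
      refine (this.congr_deriv ?_).congr_of_eventuallyEq
        (Eventually.of_forall fun z => by simp [div_eq_mul_inv])
      push_cast
      field_simp
    have h3 := (h1.mul h2.cexp).comp_ofReal
    have h4 : HasDerivAt (flatPower μ) (-μ * (x : ℂ) ^ (-μ - 1) * 1 *
        cexp (-Real.pi / (x : ℂ) ^ 2) + (x : ℂ) ^ (-μ) * (cexp (-Real.pi / (x : ℂ) ^ 2) *
        (2 * Real.pi / (x : ℂ) ^ 3))) x := by
      refine h3.congr_of_eventuallyEq ?_
      filter_upwards [Ioi_mem_nhds hx] with y hy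
      rw [flatPower_of_pos _ hy]
      rfl
    convert h4 using 1
    rw [flatPower_of_pos _ hx, flatPower_of_pos _ hx, show -(μ + 1) = -μ - 1 by ring,
      show -(μ + 3) = -μ - (3 : ℕ) by push_cast; ring, Complex.cpow_sub _ (3 : ℕ) hx0,
      Complex.cpow_natCast]
    ring

theorem deriv_flatPower (μ : ℂ) : deriv (flatPower μ) =
    fun x => -μ * flatPower (μ + 1) x + 2 * Real.pi * flatPower (μ + 3) x :=
  funext fun x => (hasDerivAt_flatPower μ x).deriv

theorem contDiff_flatPower_nat (n : ℕ) (μ : ℂ) : ContDiff ℝ n (flatPower μ) := by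
  induction n generalizing μ with
  | zero =>
    exact contDiff_zero.mpr
      (continuous_iff_continuousAt.mpr fun x => (hasDerivAt_flatPower μ x).continuousAt)
  | succ n ih =>
    push_cast
    rw [contDiff_succ_iff_deriv]
    refine ⟨fun x => (hasDerivAt_flatPower μ x).differentiableAt, by simp, ?_⟩
    rw [deriv_flatPower]
    exact (contDiff_const.mul (ih _)).add (contDiff_const.mul (ih _))

theorem contDiff_flatPower (μ : ℂ) : ContDiff ℝ ∞ (flatPower μ) :=
  contDiff_infty.mpr fun n => contDiff_flatPower_nat n μ

theorem iteratedDeriv_succ_flatPower (m : ℕ) (μ : ℂ) (x : ℝ) :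
    iteratedDeriv (m + 1) (flatPower μ) x = -μ * iteratedDeriv m (flatPower (μ + 1)) x +
      2 * Real.pi * iteratedDeriv m (flatPower (μ + 3)) x := by
  have h : ∀ ν, ContDiffAt ℝ m (flatPower ν) x := fun ν => (contDiff_flatPower_nat m ν).contDiffAt
  rw [iteratedDeriv_succ', deriv_flatPower,
    iteratedDeriv_fun_add (contDiffAt_const.mul (h _)) (contDiffAt_const.mul (h _)),
    iteratedDeriv_const_mul_field, iteratedDeriv_const_mul_field]

theorem iteratedDeriv_flatPower_of_nonpos (m : ℕ) (μ : ℂ) {x : ℝ} (hx : x ≤ 0) :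
    iteratedDeriv m (flatPower μ) x = 0 := by
  induction m generalizing μ with
  | zero => rw [iteratedDeriv_zero, flatPower_of_nonpos _ hx]
  | succ m ih => rw [iteratedDeriv_succ_flatPower, ih, ih, mul_zero, mul_zero, add_zero]

/-- Each derivative costs a factor `|μ| + 2π ≤ |μ| + 7`, with `|μ|` growing by at most `3` per step,
and multiplies the profile by at most `x⁻¹ (1 + x⁻²)`. -/
theorem norm_iteratedDeriv_flatPower_le (m : ℕ) (μ : ℂ) {x : ℝ} (hx : 0 < x) :
    ‖iteratedDeriv m (flatPower μ) x‖ ≤ (‖μ‖ + 3 * m + 7) ^ m *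
      (x ^ (-μ.re) * (x⁻¹) ^ m * (1 + (x⁻¹) ^ 2) ^ m * Real.exp (-Real.pi / x ^ 2)) := by
  induction m generalizing μ with
  | zero => simp [norm_flatPower μ hx]
  | succ m ih =>
    rw [iteratedDeriv_succ_flatPower]
    have hxi : 0 < x⁻¹ := by positivity
    set W := x ^ (-μ.re) * (x⁻¹) ^ (m + 1) * (1 + (x⁻¹) ^ 2) ^ (m + 1) *
      Real.exp (-Real.pi / x ^ 2) with hW
    have hW0 : 0 ≤ W := by positivity
    have hpow : ∀ k : ℕ, x ^ (-(μ + k).re) = x ^ (-μ.re) * (x⁻¹) ^ k := fun k => by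
      rw [Complex.add_re, Complex.natCast_re, neg_add, Real.rpow_add hx, Real.rpow_neg hx.le (k : ℝ),
        Real.rpow_natCast, inv_pow]
    have h1 := ih (μ + 1)
    have h3 := ih (μ + 3)
    have e1 := hpow 1
    have e3 := hpow 3
    push_cast at e1 e3
    rw [e1] at h1
    rw [e3] at h3
    set B : ℝ := (‖μ‖ + 3 * (m + 1 : ℕ) + 7) ^ m with hB
    have hB0 : 0 ≤ B := by positivity
    have n1 : ‖μ + 1‖ ≤ ‖μ‖ + 1 := (norm_add_le _ _).trans (by simp)
    have n3 : ‖μ + 3‖ ≤ ‖μ‖ + 3 := (norm_add_le _ _).trans (by simp)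
    have b1 : (‖μ + 1‖ + 3 * m + 7) ^ m ≤ B := by
      rw [hB]; push_cast
      apply pow_le_pow_left₀ (by positivity); linarith
    have b3 : (‖μ + 3‖ + 3 * m + 7) ^ m ≤ B := by
      rw [hB]; push_cast
      apply pow_le_pow_left₀ (by positivity); linarith
    have c1 : x ^ (-μ.re) * x⁻¹ ^ 1 * (x⁻¹) ^ m * (1 + (x⁻¹) ^ 2) ^ m *
        Real.exp (-Real.pi / x ^ 2) ≤ W := by
      have : W = x ^ (-μ.re) * x⁻¹ ^ 1 * (x⁻¹) ^ m * (1 + (x⁻¹) ^ 2) ^ m *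
        Real.exp (-Real.pi / x ^ 2) * (1 + (x⁻¹) ^ 2) := by rw [hW]; ring
      rw [this]
      exact le_mul_of_one_le_right (by positivity) (by nlinarith)
    have c3 : x ^ (-μ.re) * x⁻¹ ^ 3 * (x⁻¹) ^ m * (1 + (x⁻¹) ^ 2) ^ m *
        Real.exp (-Real.pi / x ^ 2) ≤ W := by
      have e : W = x ^ (-μ.re) * x⁻¹ ^ 1 * (x⁻¹) ^ m * (1 + (x⁻¹) ^ 2) ^ m *
        Real.exp (-Real.pi / x ^ 2) * (1 + (x⁻¹) ^ 2) := by rw [hW]; ring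
      have e' : x ^ (-μ.re) * x⁻¹ ^ 3 * (x⁻¹) ^ m * (1 + (x⁻¹) ^ 2) ^ m *
        Real.exp (-Real.pi / x ^ 2) = x ^ (-μ.re) * x⁻¹ ^ 1 * (x⁻¹) ^ m * (1 + (x⁻¹) ^ 2) ^ m *
        Real.exp (-Real.pi / x ^ 2) * (x⁻¹) ^ 2 := by ring
      rw [e, e']
      exact mul_le_mul_of_nonneg_left (by linarith) (by positivity)
    have d1 : ‖iteratedDeriv m (flatPower (μ + 1)) x‖ ≤ B * W :=
      h1.trans (mul_le_mul b1 c1 (by positivity) hB0)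
    have d3 : ‖iteratedDeriv m (flatPower (μ + 3)) x‖ ≤ B * W :=
      h3.trans (mul_le_mul b3 c3 (by positivity) hB0)
    have hpi : ‖(2 * Real.pi : ℂ)‖ ≤ 7 := by
      rw [norm_mul, Complex.norm_real, Complex.norm_ofNat, Real.norm_of_nonneg Real.pi_pos.le]
      linarith [Real.pi_lt_d2]
    calc _ ≤ ‖μ‖ * (B * W) + 7 * (B * W) := by
          refine (norm_add_le _ _).trans (add_le_add ?_ ?_)
          · rw [norm_mul, norm_neg]; gcongr
          · rw [norm_mul]; gcongr
      _ = (‖μ‖ + 7) * B * W := by ring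
      _ ≤ (‖μ‖ + 3 * (m + 1 : ℕ) + 7) * B * W := by
          gcongr
          have : (0 : ℝ) ≤ ((m + 1 : ℕ) : ℝ) := by positivity
          linarith
      _ = _ := by rw [hB]; ring

/-- Near `0` the negative powers, of order about `3m`, are beaten by `exp (-π/x²)` at the price of
`(R + 2m)!`; beyond `1` the factor `x ^ (-(Re μ + m)) ≤ x ^ (-2)` gives integrability. All constants
are `exp (O(m log m))`. -/
theorem exists_iteratedDeriv_flatPower_bound (μ : ℂ) :
    ∃ C : ℝ, 0 ≤ C ∧ ∀ m : ℕ, 2 ≤ μ.re + m → ∀ x : ℝ,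
      ‖iteratedDeriv m (flatPower μ) x‖ ≤ Real.exp (C * logExponent m) * (1 + x ^ 2)⁻¹ := by
  set R := ⌈|μ.re|⌉₊ with hR
  have hR1 : |μ.re| ≤ R := Nat.le_ceil _
  obtain ⟨D, hD, h'⟩ := exists_logExponent_affine_le (show (0 : ℝ) ≤ 2 by norm_num)
    (show (0 : ℝ) ≤ R by positivity)
  set K : ℝ := ‖μ‖ + 10 with hK
  have hK1 : 1 ≤ K := by rw [hK]; linarith [norm_nonneg μ]
  refine ⟨(2 * K + 1) + 5 + D + 1, by positivity, fun m hm x => ?_⟩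
  have hm0 : (0 : ℝ) ≤ m := by positivity
  have hL := logExponent_pos hm0
  have p1 : (‖μ‖ + 3 * m + 7) ^ m ≤ Real.exp ((2 * K + 1) * logExponent m) :=
    pow_le_exp_logExponent hK1 m (by positivity) (by rw [hK]; nlinarith [norm_nonneg μ])
  have p2 : (2 : ℝ) ^ m ≤ Real.exp (5 * logExponent m) := by
    have := pow_le_exp_logExponent (K := 2) (by norm_num) m (x := 2) (by norm_num) (by linarith)
    norm_num at this
    exact this
  have p3 : ((R + 2 * m : ℕ).factorial : ℝ) ≤ Real.exp (D * logExponent m) :=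
    (factorial_le_exp_logExponent _).trans (Real.exp_le_exp.mpr
      (h' _ hm0 _ (by positivity) (by push_cast; linarith)))
  have p4 : (2 : ℝ) ≤ Real.exp (1 * logExponent m) := by
    linarith [Real.add_one_le_exp (1 * logExponent (m : ℝ))]
  rcases le_or_gt x 0 with hx | hx
  · rw [iteratedDeriv_flatPower_of_nonpos _ _ hx, norm_zero]; positivity
  have key : x ^ (-μ.re) * (x⁻¹) ^ m * (1 + (x⁻¹) ^ 2) ^ m * Real.exp (-Real.pi / x ^ 2) ≤
      2 ^ m * (R + 2 * m : ℕ).factorial * (2 * (1 + x ^ 2)⁻¹) := by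
    have hfac : (1 : ℝ) ≤ (R + 2 * m : ℕ).factorial := by
      exact_mod_cast Nat.one_le_iff_ne_zero.mpr (Nat.factorial_ne_zero _)
    have hxm : x ^ (-μ.re) * (x⁻¹) ^ m = x ^ (-(μ.re + m)) := by
      rw [neg_add, Real.rpow_add hx, Real.rpow_neg hx.le (m : ℝ), Real.rpow_natCast, inv_pow]
    rcases le_or_gt x 1 with h1 | h1
    · have q1 : (1 + (x⁻¹) ^ 2) ^ m ≤ 2 ^ m * ((x⁻¹) ^ 2) ^ m := by
        rw [← mul_pow]
        have : 1 ≤ (x⁻¹) ^ 2 := one_le_pow₀ ((one_le_inv₀ hx).mpr h1)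
        gcongr
        linarith
      have q2 : 1 ≤ 2 * (1 + x ^ 2)⁻¹ := by
        rw [← div_eq_mul_inv, one_le_div (by positivity)]
        nlinarith
      have q3 := rpow_mul_exp_le_factorial (Y := μ.re + m + 2 * m) (n := R + 2 * m) (by
        push_cast
        linarith [le_abs_self μ.re, abs_nonneg μ.re]) hx h1
      have q4 : x ^ (-(μ.re + m + 2 * m)) = x ^ (-(μ.re + m)) * ((x⁻¹) ^ 2) ^ m := by
        rw [neg_add (μ.re + m), Real.rpow_add hx, ← pow_mul, Real.rpow_neg hx.le (2 * m), inv_pow]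
        congr 2
        exact_mod_cast Real.rpow_natCast x (2 * m)
      rw [hxm]
      calc _ ≤ x ^ (-(μ.re + m)) * (2 ^ m * ((x⁻¹) ^ 2) ^ m) * Real.exp (-Real.pi / x ^ 2) := by
            gcongr
        _ = 2 ^ m * (x ^ (-(μ.re + m + 2 * m)) * Real.exp (-Real.pi / x ^ 2)) := by
            rw [q4]; ring
        _ ≤ 2 ^ m * (R + 2 * m : ℕ).factorial := by gcongr
        _ ≤ _ := le_mul_of_one_le_right (by positivity) q2
    · have q1 : (1 + (x⁻¹) ^ 2) ^ m ≤ 2 ^ m := by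
        have : (x⁻¹) ^ 2 ≤ 1 := pow_le_one₀ (by positivity) (inv_le_one_of_one_le₀ h1.le)
        gcongr
        linarith
      have q2 : x ^ (-(μ.re + m)) ≤ 2 * (1 + x ^ 2)⁻¹ := by
        calc x ^ (-(μ.re + m)) ≤ x ^ (-2 : ℝ) :=
              Real.rpow_le_rpow_of_exponent_le h1.le (by linarith)
          _ = (x ^ 2)⁻¹ := by
              rw [Real.rpow_neg hx.le]; norm_num
          _ ≤ _ := by
              rw [← div_eq_mul_inv, inv_eq_one_div, div_le_div_iff₀ (by positivity) (by positivity)]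
              nlinarith
      have q3 : Real.exp (-Real.pi / x ^ 2) ≤ 1 := by
        apply Real.exp_le_one_iff.mpr
        rw [neg_div]
        have : 0 < Real.pi / x ^ 2 := div_pos Real.pi_pos (by positivity)
        linarith
      rw [hxm]
      calc _ ≤ (2 * (1 + x ^ 2)⁻¹) * 2 ^ m * 1 := by gcongr
        _ = 2 ^ m * 1 * (2 * (1 + x ^ 2)⁻¹) := by ring
        _ ≤ _ := by gcongr
  refine (norm_iteratedDeriv_flatPower_le m μ hx).trans ?_
  calc _ ≤ (‖μ‖ + 3 * m + 7) ^ m * (2 ^ m * (R + 2 * m : ℕ).factorial * (2 * (1 + x ^ 2)⁻¹)) := by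
        gcongr
    _ ≤ Real.exp ((2 * K + 1) * logExponent m) * (Real.exp (5 * logExponent m) *
        Real.exp (D * logExponent m) * (Real.exp (1 * logExponent m) * (1 + x ^ 2)⁻¹)) := by
        gcongr
    _ = _ := by
        rw [show (2 * K + 1 + 5 + D + 1) * logExponent (m : ℝ) = (2 * K + 1) * logExponent m +
          5 * logExponent m + D * logExponent m + 1 * logExponent m by ring, Real.exp_add,
          Real.exp_add, Real.exp_add]
        ring

/-! ### Mellin transforms of flat functions -/

theorem hasMellin_exp_neg_pi {w : ℂ} (hw : 0 < w.re) :
    HasMellin (fun t : ℝ => cexp (-(Real.pi * t : ℝ))) w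
      ((Real.pi : ℂ) ^ (-w) * Complex.Gamma w) := by
  have h1 : MellinConvergent (fun t : ℝ => ((Real.exp (-t) : ℝ) : ℂ)) w := by
    refine (Complex.GammaIntegral_convergent hw).congr_fun (fun x hx => ?_) measurableSet_Ioi
    simp only [smul_eq_mul]; ring
  have h2 : mellin (fun t : ℝ => ((Real.exp (-t) : ℝ) : ℂ)) w = Complex.Gamma w := by
    rw [Complex.Gamma_eq_integral hw, Complex.GammaIntegral_eq_mellin]
  have h3 := (MellinConvergent.comp_mul_left Real.pi_pos).mpr h1
  have h4 := mellin_comp_mul_left (fun t : ℝ => ((Real.exp (-t) : ℝ) : ℂ)) w Real.pi_pos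
  rw [h2, smul_eq_mul] at h4
  have e : (fun t : ℝ => cexp (-(Real.pi * t : ℝ))) =
      fun t : ℝ => ((Real.exp (-(Real.pi * t)) : ℝ) : ℂ) := by
    funext t; push_cast; rfl
  rw [e]
  exact ⟨h3, h4⟩

theorem hasMellin_flatPower {μ v : ℂ} (hv : v.re < μ.re) :
    HasMellin (flatPower μ) v (Gammaℝ (μ - v) / 2) := by
  have hw : 0 < ((μ - v) / 2).re := by
    rw [show (μ - v) / 2 = (μ - v) / ((2 : ℝ) : ℂ) by norm_num, Complex.div_ofReal_re]
    simp; linarith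
  have hcv : (v + -μ) / ((-2 : ℝ) : ℂ) = (μ - v) / 2 := by push_cast; ring
  obtain ⟨h1, h2⟩ := hasMellin_exp_neg_pi hw
  set g : ℝ → ℂ := fun t : ℝ => cexp (-(Real.pi * t : ℝ))
  set G : ℝ → ℂ := fun t : ℝ => (t : ℂ) ^ (-μ) • g (t ^ (-2 : ℝ))
  have hGv : MellinConvergent G v := by
    rw [MellinConvergent.cpow_smul, MellinConvergent.comp_rpow (by norm_num), hcv]
    exact h1
  have hGm : mellin G v = Gammaℝ (μ - v) / 2 := by
    rw [mellin_cpow_smul, mellin_comp_rpow, hcv, h2, Gammaℝ_def, neg_div]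
    simp
    ring
  have heq : ∀ t ∈ Set.Ioi (0 : ℝ), flatPower μ t = G t := by
    intro t ht
    have ht0 : 0 < t := ht
    rw [flatPower_of_pos _ ht0]
    simp only [G, g, smul_eq_mul]
    rw [Real.rpow_neg ht0.le]
    norm_num
    left
    congr 1
    ring
  refine ⟨?_, ?_⟩
  · refine hGv.congr_fun (fun t ht => ?_) measurableSet_Ioi
    simp only [heq t ht]
  · rw [← hGm, mellin, mellin]
    refine setIntegral_congr_fun measurableSet_Ioi fun t ht => ?_
    simp only [heq t ht]

/-- No integration by parts is needed: the derivative relation reduces the step to `Gammaℝ (z + 2) =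
Gammaℝ z * z / (2π)` at `z = μ - v`. -/
theorem hasMellin_iteratedDeriv_flatPower (m : ℕ) {μ v : ℂ} (hv : v.re < μ.re) :
    HasMellin (iteratedDeriv m (flatPower μ)) (v + m)
      ((-1) ^ m * (∏ j ∈ Finset.range m, (v + j)) * (Gammaℝ (μ - v) / 2)) := by
  induction m generalizing μ v with
  | zero => simpa using hasMellin_flatPower hv
  | succ m ih =>
    have h1 := ih (μ := μ + 1) (v := v + 1) (by simpa using hv)
    have h3 := ih (μ := μ + 3) (v := v + 1) (by simp; linarith)
    have e : v + ((m + 1 : ℕ) : ℂ) = v + 1 + m := by push_cast; ring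
    have k1 := hasMellin_const_smul h1.1 (-μ)
    have k3 := hasMellin_const_smul h3.1 (2 * Real.pi : ℂ)
    have k := hasMellin_add k1.1 k3.1
    rw [k1.2, k3.2, h1.2, h3.2] at k
    have hf : iteratedDeriv (m + 1) (flatPower μ) = fun x =>
        (-μ) • iteratedDeriv m (flatPower (μ + 1)) x +
          (2 * Real.pi : ℂ) • iteratedDeriv m (flatPower (μ + 3)) x :=
      funext fun x => iteratedDeriv_succ_flatPower m μ x
    rw [hf, e]
    convert k using 1
    have hne : μ - v ≠ 0 := fun h0 => by
      have := congrArg Complex.re h0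
      simp at this
      linarith
    have hg := Gammaℝ_add_two hne
    rw [show μ + 3 - (v + 1) = μ - v + 2 by ring, show μ + 1 - (v + 1) = μ - v by ring, hg,
      Finset.prod_range_succ']
    have hpi : (Real.pi : ℂ) ≠ 0 := by exact_mod_cast Real.pi_ne_zero
    have hprod : ∏ j ∈ Finset.range m, (v + ((j + 1 : ℕ) : ℂ)) =
        ∏ j ∈ Finset.range m, (v + 1 + (j : ℂ)) :=
      Finset.prod_congr rfl fun j _ => by push_cast; ring
    rw [hprod]
    simp only [smul_eq_mul, Nat.cast_zero, add_zero]
    field_simp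
    ring

/-! ### Local zeta functions: uniqueness and change of variables -/

/-- Two candidates agree near a point of a strip, hence up to a discrete set by the identity theorem
for meromorphic functions; the normal form upgrades this to equality at every point. -/
theorem IsLocalZeta.unique {lam : ℂ} {ε : ℤˣ} {f : ℝ → ℂ} {Φ Ψ : ℂ → ℂ}
    (hΦ : IsLocalZeta lam ε f Φ) (hΨ : IsLocalZeta lam ε f Ψ) : Φ = Ψ := by
  obtain ⟨m, hm⟩ := exists_nat_gt (1 - 2 * lam.re)
  -- This point lies inside the strip for the chosen `m`, and its positive imaginary part keeps it
  -- off the poles at `0, -1, -2, …`.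
  set s₀ : ℂ := ⟨2 * lam.re - 1, 1⟩ with hs₀
  have hmer : MeromorphicOn (Φ - Ψ) Set.univ :=
    hΦ.meromorphic.meromorphicOn.sub hΨ.meromorphic.meromorphicOn
  have h0 : meromorphicOrderAt (Φ - Ψ) s₀ = ⊤ := by
    rw [meromorphicOrderAt_eq_top_iff]
    apply Filter.Eventually.filter_mono nhdsWithin_le_nhds
    have h1 : ∀ᶠ s : ℂ in 𝓝 s₀, -(m : ℝ) < s.re :=
      Complex.continuous_re.continuousAt.eventually_const_lt (by rw [hs₀]; linarith)
    have h2 : ∀ᶠ s : ℂ in 𝓝 s₀, s.re < 2 * lam.re :=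
      Complex.continuous_re.continuousAt.eventually_lt_const (by rw [hs₀]; linarith)
    have h3 : ∀ᶠ s : ℂ in 𝓝 s₀, 0 < s.im :=
      Complex.continuous_im.continuousAt.eventually_const_lt (by rw [hs₀]; norm_num)
    filter_upwards [h1, h2, h3] with s a b c
    have hne : ∀ k : ℕ, s ≠ -(k : ℂ) := fun k hk => by
      rw [hk] at c; simp at c
    rw [Pi.sub_apply, hΦ.eq_integral m s a b hne, hΨ.eq_integral m s a b hne, sub_self]
  funext s
  have hs : meromorphicOrderAt (Φ - Ψ) s = ⊤ := by
    by_contra hne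
    exact hmer.meromorphicOrderAt_ne_top_of_isPreconnected isPreconnected_univ
      (Set.mem_univ s) (Set.mem_univ s₀) hne h0
  rw [meromorphicOrderAt_eq_top_iff] at hs
  have he : Φ =ᶠ[𝓝[≠] s] Ψ := by
    filter_upwards [hs] with z hz
    exact sub_eq_zero.mp hz
  exact ((hΦ.meromorphic (Set.mem_univ s)).eventuallyEq_nhdsNE_iff_eventuallyEq_nhds
    (hΨ.meromorphic (Set.mem_univ s))).mp he |>.eq_of_nhds

theorem IsLocalZeta.localZeta_eq {lam : ℂ} {ε : ℤˣ} {f : ℝ → ℂ} {Φ : ℂ → ℂ}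
    (h : IsLocalZeta lam ε f Φ) : localZeta lam ε f = Φ := by
  have hex : ∃ Φ : ℂ → ℂ, IsLocalZeta lam ε f Φ := ⟨Φ, h⟩
  rw [localZeta, dif_pos hex]
  exact hex.choose_spec.unique h

/-- As `c` has no zeros, a continuation exists for one function if and only if it exists for the
other; if neither exists, both values are the default `0`. The change-of-variable rules thus never
require existence of the local zeta function, in particular not for Gaussians. -/
theorem localZeta_eq_mul {lam : ℂ} {ε ε' : ℤˣ} {f f' : ℝ → ℂ} {c : ℂ → ℂ}
    (hc : Differentiable ℂ c) (hc0 : ∀ s, c s ≠ 0)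
    (h : ∀ m s, localZetaIntegral ε' f' m s = c s * localZetaIntegral ε f m s) (s : ℂ) :
    localZeta lam ε' f' s = c s * localZeta lam ε f s := by
  have hcan : ∀ s, AnalyticAt ℂ c s := fun s => hc.analyticAt s
  have key : ∀ {ε ε' : ℤˣ} {f f' : ℝ → ℂ} {c : ℂ → ℂ}, (∀ s, AnalyticAt ℂ c s) → (∀ s, c s ≠ 0) →
      (∀ m s, localZetaIntegral ε' f' m s = c s * localZetaIntegral ε f m s) →
      ∀ Φ, IsLocalZeta lam ε f Φ → IsLocalZeta lam ε' f' (c * Φ) := by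
    intro ε ε' f f' c hc hc0 h Φ hΦ
    refine ⟨fun s hs => ?_, fun m s h1 h2 h3 => ?_⟩
    · rw [meromorphicNFAt_mul_iff_right (hc s) (hc0 s)]
      exact hΦ.meromorphic hs
    · rw [Pi.mul_apply, hΦ.eq_integral m s h1 h2 h3, h]
  by_cases hex : ∃ Φ, IsLocalZeta lam ε f Φ
  · obtain ⟨Φ, hΦ⟩ := hex
    rw [hΦ.localZeta_eq, (key hcan hc0 h Φ hΦ).localZeta_eq, Pi.mul_apply]
  · have hex' : ¬ ∃ Φ, IsLocalZeta lam ε' f' Φ := fun ⟨Φ, hΦ⟩ => hex ⟨_, key (c := fun s => (c s)⁻¹)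
      (fun s => (hcan s).inv (hc0 s)) (fun s => inv_ne_zero (hc0 s)) (fun m s => by
        rw [h, inv_mul_cancel_left₀ (hc0 s)]) Φ hΦ⟩
    rw [localZeta, localZeta, dif_neg hex, dif_neg hex']
    simp

theorem iteratedDeriv_comp_mul_left {f : ℝ → ℂ} (hf : ContDiff ℝ ∞ f) (c : ℝ) (m : ℕ) (x : ℝ) :
    iteratedDeriv m (fun x => f (c * x)) x = (c : ℂ) ^ m * iteratedDeriv m f (c * x) := by
  have := congrFun (iteratedDeriv_comp_const_smul (n := m) (f := f) (hf.of_le (by exact_mod_cast le_top)) c) x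
  rw [this, Complex.real_smul]
  push_cast
  rfl

theorem localZeta_comp_mul_left {lam : ℂ} {ε : ℤˣ} {f : ℝ → ℂ} (hf : ContDiff ℝ ∞ f) {c : ℝ}
    (hc : 0 < c) (s : ℂ) :
    localZeta lam ε (fun x => f (c * x)) s = (c : ℂ) ^ (-s) * localZeta lam ε f s := by
  have hc' : (c : ℂ) ≠ 0 := by exact_mod_cast hc.ne'
  refine localZeta_eq_mul (c := fun s => (c : ℂ) ^ (-s)) ?_ ?_ ?_ s
  · exact fun s => (differentiableAt_id.neg).const_cpow (Or.inl hc')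
  · intro s
    rw [Complex.cpow_def_of_ne_zero hc']; exact Complex.exp_ne_zero _
  · intro m s
    have h1 := integral_comp_mul_left_Ioi
      (fun x : ℝ => (x : ℂ) ^ (s + m - 1) * iteratedDeriv m f (((ε : ℤ) : ℝ) * x)) 0 hc
    rw [mul_zero] at h1
    have h2 : ∫ x in Set.Ioi (0 : ℝ), (x : ℂ) ^ (s + m - 1) *
        iteratedDeriv m (fun x => f (c * x)) (((ε : ℤ) : ℝ) * x) =
        (c : ℂ) ^ m * (c : ℂ) ^ (-(s + m - 1)) * ∫ x in Set.Ioi (0 : ℝ),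
          ((c * x : ℝ) : ℂ) ^ (s + m - 1) * iteratedDeriv m f (((ε : ℤ) : ℝ) * (c * x)) := by
      rw [← integral_const_mul]
      refine setIntegral_congr_fun measurableSet_Ioi fun x hx => ?_
      have hx0 : 0 < x := hx
      have hcp : (c : ℂ) ^ (s + m - 1) ≠ 0 := by
        rw [Complex.cpow_def_of_ne_zero hc']; exact Complex.exp_ne_zero _
      rw [iteratedDeriv_comp_mul_left hf, Complex.ofReal_mul,
        Complex.mul_cpow_ofReal_nonneg hc.le hx0.le, Complex.cpow_neg,
        show c * (((ε : ℤ) : ℝ) * x) = ((ε : ℤ) : ℝ) * (c * x) by ring]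
      field_simp
    unfold localZetaIntegral
    rw [h2, h1, Complex.real_smul, show -(s + m - 1) = -s - m + 1 by ring,
      Complex.cpow_add _ _ hc', Complex.cpow_sub _ _ hc', Complex.cpow_natCast, Complex.cpow_one]
    push_cast
    field_simp

theorem localZeta_const_mul {lam : ℂ} {ε : ℤˣ} (f : ℝ → ℂ) {c : ℂ} (hc : c ≠ 0) (s : ℂ) :
    localZeta lam ε (fun x => c * f x) s = c * localZeta lam ε f s := by
  refine localZeta_eq_mul (c := fun _ => c) (differentiable_const _) (fun _ => hc) ?_ s
  intro m s
  have h : ∀ x : ℝ, (x : ℂ) ^ (s + m - 1) *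
      iteratedDeriv m (fun x => c * f x) (((ε : ℤ) : ℝ) * x) =
      c * ((x : ℂ) ^ (s + m - 1) * iteratedDeriv m f (((ε : ℤ) : ℝ) * x)) := fun x => by
    rw [iteratedDeriv_const_mul_field]
    ring
  unfold localZetaIntegral
  simp only [h]
  rw [integral_const_mul]
  ring

theorem localZeta_of_odd {lam : ℂ} {f : ℝ → ℂ} (hf : ∀ x, f (-x) = -f x) (s : ℂ) :
    localZeta lam (-1) f s = -localZeta lam 1 f s := by
  rw [show -localZeta lam 1 f s = -1 * localZeta lam 1 f s by ring]
  refine localZeta_eq_mul (c := fun _ => -1) (differentiable_const _) (by simp) ?_ s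
  intro m s
  have h1 : ∀ x : ℝ, iteratedDeriv m f (-x) = (-1) ^ m * -iteratedDeriv m f x := by
    intro x
    have h2 := iteratedDeriv_comp_neg m f x
    have h3 : (fun x => f (-x)) = fun x => -f x := funext hf
    rw [h3, iteratedDeriv_fun_neg] at h2
    rw [h2, Complex.real_smul]
    push_cast
    rw [← mul_assoc, ← mul_pow]
    simp
  unfold localZetaIntegral
  simp only [Units.val_neg, Units.val_one, Int.cast_neg, Int.cast_one, neg_neg, one_pow, neg_mul,
    one_mul, h1]
  have h4 : ∀ x : ℝ, (x : ℂ) ^ (s + m - 1) * ((-1) ^ m * -iteratedDeriv m f x) =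
      -(-1) ^ m * ((x : ℂ) ^ (s + m - 1) * iteratedDeriv m f x) := fun x => by ring
  simp only [h4]
  rw [integral_const_mul]
  ring

/-! ### The exponential integral -/

/-- The integral `∫ φ(x) e^(2πixt) dx`. -/
def expIntegral (φ : ℝ → ℂ) (t : ℝ) : ℂ := ∫ x : ℝ, φ x * cexp (2 * Real.pi * I * x * t)

theorem fourier_of_ne_zero (lam : ℂ) (f : ℝ → ℂ) {t : ℝ} (ht : t ≠ 0) :
    fourier lam f t = (-1 / (2 * Real.pi * I * t)) ^ fourierOrder lam *
      expIntegral (iteratedDeriv (fourierOrder lam) f) t := if_neg ht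

theorem fourier_zero (lam : ℂ) (f : ℝ → ℂ) :
    fourier lam f 0 = localZeta lam 1 f 1 + localZeta lam (-1) f 1 := if_pos rfl

theorem expIntegral_eq_fourier (φ : ℝ → ℂ) (t : ℝ) :
    expIntegral φ t = FourierTransform.fourier φ (-t) := by
  rw [Real.fourier_real_eq_integral_exp_smul, expIntegral]
  congr 1
  ext x
  rw [smul_eq_mul, mul_comm]
  congr 2
  push_cast
  ring

theorem expIntegral_deriv {φ : ℝ → ℂ} (h : Integrable φ) (hd : Differentiable ℝ φ)
    (h' : Integrable (deriv φ)) (t : ℝ) :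
    expIntegral (deriv φ) t = -(2 * Real.pi * I * t) * expIntegral φ t := by
  rw [expIntegral_eq_fourier, expIntegral_eq_fourier, Real.fourier_deriv h hd h']
  simp only [smul_eq_mul]
  push_cast
  ring

/-- Integration by parts: the generalized Fourier transform does not depend on the order, so one may
raise it to gain decay or lower it to reach the classical transform. -/
theorem expIntegral_iteratedDeriv {f : ℝ → ℂ} (hf : ContDiff ℝ ∞ f) {m n : ℕ} (hmn : m ≤ n)
    (hint : ∀ j, m ≤ j → Integrable (iteratedDeriv j f)) {t : ℝ} (ht : t ≠ 0) :
    (-1 / (2 * Real.pi * I * t)) ^ n * expIntegral (iteratedDeriv n f) t =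
      (-1 / (2 * Real.pi * I * t)) ^ m * expIntegral (iteratedDeriv m f) t := by
  induction n, hmn using Nat.le_induction with
  | base => rfl
  | succ n hmn ih =>
    rw [← ih, iteratedDeriv_succ, expIntegral_deriv (hint n hmn)
      (hf.differentiable_iteratedDeriv n (by exact_mod_cast WithTop.coe_lt_top _))
      (by rw [← iteratedDeriv_succ]; exact hint (n + 1) (by omega)), pow_succ]
    have h1 : (2 * Real.pi * I * t : ℂ) ≠ 0 := by
      have : (t : ℂ) ≠ 0 := by exact_mod_cast ht
      simp [Real.pi_ne_zero, this]
    have h2 : -1 / (2 * Real.pi * I * t : ℂ) * -(2 * Real.pi * I * t) = 1 := by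
      rw [div_mul_eq_mul_div, neg_one_mul, neg_neg, div_self h1]
    linear_combination (-1 / (2 * Real.pi * I * t : ℂ)) ^ n *
      expIntegral (iteratedDeriv n f) t * h2

theorem continuous_expIntegral {φ : ℝ → ℂ} (h : Integrable φ) : Continuous (expIntegral φ) := by
  have h1 : Continuous (FourierTransform.fourier φ : ℝ → ℂ) :=
    VectorFourier.fourierIntegral_continuous Real.continuous_fourierChar continuous_inner h
  have h2 : expIntegral φ = fun t => FourierTransform.fourier φ (-t) :=
    funext fun t => expIntegral_eq_fourier φ t
  rw [h2]
  exact h1.comp continuous_neg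

theorem norm_exp_two_pi_I (x t : ℝ) : ‖cexp (2 * Real.pi * I * x * t)‖ = 1 := by
  have : (2 * Real.pi * I * x * t : ℂ) = ((2 * Real.pi * x * t : ℝ) : ℂ) * I := by
    push_cast; ring
  rw [this, Complex.norm_exp_ofReal_mul_I]

theorem norm_expIntegral_le (φ : ℝ → ℂ) (t : ℝ) : ‖expIntegral φ t‖ ≤ ∫ x, ‖φ x‖ := by
  refine (norm_integral_le_integral_norm _).trans (le_of_eq ?_)
  congr 1
  ext x
  rw [norm_mul, norm_exp_two_pi_I, mul_one]

theorem expIntegral_comp_mul_left (φ : ℝ → ℂ) {c : ℝ} (hc : 0 < c) (t : ℝ) :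
    expIntegral (fun x => φ (c * x)) t = (c : ℂ)⁻¹ * expIntegral φ (t / c) := by
  have h := Measure.integral_comp_mul_left
    (fun y : ℝ => φ y * cexp (2 * Real.pi * I * y * (t / c : ℝ))) c
  rw [abs_of_pos (by positivity), Complex.real_smul] at h
  push_cast at h
  unfold expIntegral
  push_cast
  rw [← h]
  congr 1
  ext x
  have : (c : ℂ) ≠ 0 := by exact_mod_cast hc.ne'
  congr 2
  field_simp

theorem expIntegral_comp_neg (φ : ℝ → ℂ) (t : ℝ) :
    expIntegral (fun x => φ (-x)) t = expIntegral φ (-t) := by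
  unfold expIntegral
  rw [← integral_neg_eq_self (fun x : ℝ => φ x * cexp (2 * Real.pi * I * x * (-t : ℝ)))]
  congr 1
  ext x
  congr 2
  push_cast
  ring

theorem expIntegral_const_mul (φ : ℝ → ℂ) (c : ℂ) (t : ℝ) :
    expIntegral (fun x => c * φ x) t = c * expIntegral φ t := by
  unfold expIntegral
  rw [← integral_const_mul]
  congr 1
  ext x
  ring

theorem integrable_mul_exp {φ : ℝ → ℂ} (h : Integrable φ) (t : ℝ) :
    Integrable fun x : ℝ => φ x * cexp (2 * Real.pi * I * x * t) := by
  refine h.mul_bdd (c := 1) (by fun_prop) (Eventually.of_forall fun x => ?_)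
  rw [norm_exp_two_pi_I]

theorem expIntegral_add {φ ψ : ℝ → ℂ} (h : Integrable φ) (h' : Integrable ψ) (t : ℝ) :
    expIntegral (fun x => φ x + ψ x) t = expIntegral φ t + expIntegral ψ t := by
  unfold expIntegral
  rw [← integral_add (integrable_mul_exp h t) (integrable_mul_exp h' t)]
  congr 1
  ext x
  ring

/-! ### Change of variables for the generalized Fourier transform -/

theorem fourier_comp_mul_left {lam : ℂ} {f : ℝ → ℂ} (hf : ContDiff ℝ ∞ f) {c : ℝ} (hc : 0 < c)
    (t : ℝ) : fourier lam (fun x => f (c * x)) t = (c : ℂ)⁻¹ * fourier lam f (t / c) := by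
  have hc' : (c : ℂ) ≠ 0 := by exact_mod_cast hc.ne'
  by_cases ht : t = 0
  · subst ht
    rw [zero_div, fourier_zero, fourier_zero, localZeta_comp_mul_left hf hc,
      localZeta_comp_mul_left hf hc, Complex.cpow_neg, Complex.cpow_one]
    ring
  · have htc : t / c ≠ 0 := div_ne_zero ht hc.ne'
    have ht' : (t : ℂ) ≠ 0 := by exact_mod_cast ht
    rw [fourier_of_ne_zero _ _ ht, fourier_of_ne_zero _ _ htc]
    have h1 : iteratedDeriv (fourierOrder lam) (fun x => f (c * x)) = fun x =>
        (c : ℂ) ^ (fourierOrder lam) * iteratedDeriv (fourierOrder lam) f (c * x) :=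
      funext fun x => iteratedDeriv_comp_mul_left hf c _ x
    rw [h1, expIntegral_const_mul, expIntegral_comp_mul_left _ hc]
    have h2 : (-1 / (2 * Real.pi * I * (t / c : ℝ)) : ℂ) = (-1 / (2 * Real.pi * I * t)) * c := by
      push_cast
      field_simp
    rw [h2, mul_pow]
    ring

theorem fourier_const_mul {lam : ℂ} (f : ℝ → ℂ) {c : ℂ} (hc : c ≠ 0) (t : ℝ) :
    fourier lam (fun x => c * f x) t = c * fourier lam f t := by
  by_cases ht : t = 0
  · subst ht
    rw [fourier_zero, fourier_zero, localZeta_const_mul f hc, localZeta_const_mul f hc]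
    ring
  · rw [fourier_of_ne_zero _ _ ht, fourier_of_ne_zero _ _ ht]
    have h1 : iteratedDeriv (fourierOrder lam) (fun x => c * f x) = fun x =>
        c * iteratedDeriv (fourierOrder lam) f x :=
      funext fun x => iteratedDeriv_const_mul_field _ _
    rw [h1, expIntegral_const_mul]
    ring

theorem fourierOrder_spec (lam : ℂ) : 1 < 2 * lam.re + fourierOrder lam := by
  unfold fourierOrder
  push_cast
  linarith [Nat.lt_floor_add_one (1 - 2 * lam.re)]

/-! ### The Gamma integral along a complex ray -/

theorem norm_cpow_mul_exp {z r : ℂ} {t : ℝ} (ht : 0 < t) :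
    ‖(t : ℂ) ^ z * cexp (-(r * t))‖ = t ^ z.re * Real.exp (-(r.re * t)) := by
  rw [norm_mul, Complex.norm_cpow_eq_rpow_re_of_pos ht, Complex.norm_exp]
  congr 2
  simp

theorem integrableOn_rpow_mul_exp {a b : ℝ} (ha : -1 < a) (hb : 0 < b) :
    IntegrableOn (fun t : ℝ => t ^ a * Real.exp (-(b * t))) (Set.Ioi 0) := by
  have := integrableOn_rpow_mul_exp_neg_mul_rpow ha one_pos hb
  simpa only [Real.rpow_one, neg_mul] using this

theorem aestronglyMeasurable_cpow_mul_exp (z r : ℂ) :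
    AEStronglyMeasurable (fun t : ℝ => (t : ℂ) ^ z * cexp (-(r * t)))
      (volume.restrict (Set.Ioi 0)) := by
  refine ContinuousOn.aestronglyMeasurable (fun t ht => ?_) measurableSet_Ioi
  have ht0 : 0 < t := ht
  refine ContinuousAt.continuousWithinAt (ContinuousAt.mul ?_ (by fun_prop))
  exact (continuousAt_ofReal_cpow_const _ _ (Or.inr ht0.ne'))

theorem integrableOn_cpow_mul_exp {z r : ℂ} (hz : -1 < z.re) (hr : 0 < r.re) :
    IntegrableOn (fun t : ℝ => (t : ℂ) ^ z * cexp (-(r * t))) (Set.Ioi 0) := by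
  refine (integrableOn_rpow_mul_exp hz hr).mono' (aestronglyMeasurable_cpow_mul_exp z r) ?_
  refine (ae_restrict_iff' measurableSet_Ioi).mpr (Eventually.of_forall fun t ht => ?_)
  rw [norm_cpow_mul_exp ht]

/-- Both sides are holomorphic in `r` on the right half-plane and agree at real `r > 1`, which
accumulate at `1`. -/
theorem integral_cpow_mul_exp_neg_mul_of_re_pos {z r : ℂ} (hz : 0 < z.re) (hr : 0 < r.re) :
    ∫ t in Set.Ioi (0 : ℝ), (t : ℂ) ^ (z - 1) * cexp (-(r * t)) =
      (1 / r) ^ z * Complex.Gamma z := by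
  set U : Set ℂ := {r | 0 < r.re} with hU
  have hUo : IsOpen U := isOpen_lt continuous_const Complex.continuous_re
  have hz1 : -1 < (z - 1).re := by simp; linarith
  have hF : DifferentiableOn ℂ
      (fun r : ℂ => ∫ t in Set.Ioi (0 : ℝ), (t : ℂ) ^ (z - 1) * cexp (-(r * t))) U := by
    intro r₀ hr₀
    have hr₀' : 0 < r₀.re := hr₀
    have hball : ∀ r ∈ Metric.ball r₀ (r₀.re / 2), r₀.re / 2 < r.re := by
      intro r hr
      rw [Metric.mem_ball, dist_eq_norm] at hr
      have h1 := Complex.abs_re_le_norm (r - r₀)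
      rw [Complex.sub_re] at h1
      linarith [neg_abs_le (r.re - r₀.re)]
    refine (hasDerivAt_integral_of_dominated_loc_of_deriv_le
      (F' := fun r (t : ℝ) => -((t : ℂ) ^ z * cexp (-(r * t))))
      (bound := fun t : ℝ => t ^ z.re * Real.exp (-(r₀.re / 2 * t)))
      (Metric.ball_mem_nhds r₀ (by linarith : 0 < r₀.re / 2))
      (Eventually.of_forall fun r => aestronglyMeasurable_cpow_mul_exp _ r)
      (integrableOn_cpow_mul_exp hz1 hr₀') (aestronglyMeasurable_cpow_mul_exp _ r₀).neg
      ?_ (integrableOn_rpow_mul_exp (by linarith) (by linarith))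
      ?_).2.differentiableAt.differentiableWithinAt
    · refine (ae_restrict_iff' measurableSet_Ioi).mpr (Eventually.of_forall fun t ht r hr => ?_)
      have ht0 : 0 < t := ht
      rw [norm_neg, norm_cpow_mul_exp ht0]
      have := hball r hr
      gcongr
    · refine (ae_restrict_iff' measurableSet_Ioi).mpr (Eventually.of_forall fun t ht r hr => ?_)
      have ht0 : (t : ℂ) ≠ 0 := by exact_mod_cast (ne_of_gt ht)
      have h1 : HasDerivAt (fun r : ℂ => cexp (-(r * t))) (cexp (-(r * t)) * -(1 * t)) r :=
        ((hasDerivAt_id r).mul_const (t : ℂ)).neg.cexp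
      refine (h1.const_mul ((t : ℂ) ^ (z - 1))).congr_deriv ?_
      rw [Complex.cpow_sub _ _ ht0, Complex.cpow_one]
      field_simp
  have hG : DifferentiableOn ℂ (fun r : ℂ => (1 / r) ^ z * Complex.Gamma z) U := by
    intro r hr
    have hr' : 0 < r.re := hr
    have hr0 : r ≠ 0 := fun h => by rw [h] at hr'; simp at hr'
    have h1 : 1 / r ∈ slitPlane := by
      left
      rw [one_div, Complex.inv_re]
      exact div_pos hr' (Complex.normSq_pos.mpr hr0)
    refine DifferentiableAt.differentiableWithinAt (DifferentiableAt.mul_const ?_ _)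
    refine DifferentiableAt.cpow_const ?_ h1
    exact (differentiableAt_const _).div differentiableAt_id hr0
  have hUc : IsPreconnected U := (convex_halfSpace_re_gt 0).isPreconnected
  have h1U : (1 : ℂ) ∈ U := by simp [hU]
  have hfreq : ∃ᶠ r : ℂ in 𝓝[≠] 1,
      ∫ t in Set.Ioi (0 : ℝ), (t : ℂ) ^ (z - 1) * cexp (-(r * t)) =
        (1 / r) ^ z * Complex.Gamma z := by
    have hseq : Tendsto (fun x : ℝ => (x : ℂ)) (𝓝[>] 1) (𝓝[≠] 1) := by
      refine tendsto_nhdsWithin_iff.mpr ⟨?_, ?_⟩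
      · exact (Complex.continuous_ofReal.tendsto' 1 1 (by simp)).mono_left nhdsWithin_le_nhds
      · filter_upwards [self_mem_nhdsWithin] with x hx
        have : (1 : ℝ) < x := hx
        simpa using this.ne'
    refine hseq.frequently (Eventually.frequently ?_)
    filter_upwards [self_mem_nhdsWithin] with x hx
    have hx1 : (1 : ℝ) < x := hx
    exact Complex.integral_cpow_mul_exp_neg_mul_Ioi hz (by linarith)
  exact (hF.analyticOnNhd hUo).eqOn_of_preconnected_of_frequently_eq (hG.analyticOnNhd hUo) hUc
    h1U hfreq hr

/-! ### The Mellin transform of a half-line Fourier transform -/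

/-- Because `ε = ±1`, the base is `(2πx)⁻¹ ε i`, whose principal argument is `επ/2`. This is where
the factors `e^(±πiz/2)` of `γ` come from. -/
theorem inv_neg_two_pi_I_cpow (ε : ℤˣ) {x : ℝ} (hx : 0 < x) (z : ℂ) :
    (1 / -(2 * Real.pi * I * (((ε : ℤ) : ℝ) * x : ℝ))) ^ z =
      (2 * Real.pi : ℂ) ^ (-z) * cexp ((ε : ℤ) * (Real.pi * z * I / 2)) * (x : ℂ) ^ (-z) := by
  have h2 : (0 : ℝ) < (2 * Real.pi * x)⁻¹ := by have := Real.pi_pos; positivity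
  have hxc : (x : ℂ) ≠ 0 := by exact_mod_cast hx.ne'
  have hpi : (Real.pi : ℂ) ≠ 0 := by exact_mod_cast Real.pi_ne_zero
  have hεI : ((ε : ℤ) : ℂ) * I ≠ 0 := by
    rcases Int.units_eq_one_or ε with h | h <;> subst h <;> simp
  have e1 : (1 / -(2 * Real.pi * I * (((ε : ℤ) : ℝ) * x : ℝ)) : ℂ) =
      (((2 * Real.pi * x)⁻¹ : ℝ) : ℂ) * (((ε : ℤ) : ℂ) * I) := by
    push_cast
    rcases Int.units_eq_one_or ε with h | h <;> subst h <;> simp <;> field_simp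
  have e2 : Complex.log (((ε : ℤ) : ℂ) * I) = (ε : ℤ) * (Real.pi * I / 2) := by
    rcases Int.units_eq_one_or ε with h | h <;> subst h
    · simp [Complex.log_I]; ring
    · simp [Complex.log_neg_I]; ring
  have e3 : (2 * Real.pi : ℂ) = ((2 * Real.pi : ℝ) : ℂ) := by push_cast; rfl
  have h2pi : (2 * Real.pi : ℂ) ≠ 0 := mul_ne_zero two_ne_zero hpi
  rw [e1, Complex.cpow_def_of_ne_zero (mul_ne_zero (by exact_mod_cast h2.ne') hεI),
    Complex.log_ofReal_mul h2 hεI, e2, Complex.cpow_def_of_ne_zero h2pi,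
    Complex.cpow_def_of_ne_zero hxc, ← Complex.exp_add, ← Complex.exp_add, Real.log_inv,
    Real.log_mul (by have := Real.pi_pos; positivity) hx.ne', e3,
    ← Complex.ofReal_log (by have := Real.pi_pos; positivity), ← Complex.ofReal_log hx.le]
  congr 1
  push_cast
  ring

/-- The Mellin transform of the Fourier transform of a function on the half-line. -/
theorem mellin_expIntegral (ε : ℤˣ) {φ : ℝ → ℂ} {z : ℂ} (hz : 0 < z.re) (hφ : Integrable φ)
    (hφ0 : ∀ x, x ≤ 0 → φ x = 0)
    (hφz : MellinConvergent φ (1 - z))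
    (hconv : MellinConvergent (fun t => expIntegral φ (((ε : ℤ) : ℝ) * t)) z) :
    mellin (fun t => expIntegral φ (((ε : ℤ) : ℝ) * t)) z =
      Complex.Gamma z * (2 * Real.pi : ℂ) ^ (-z) * cexp ((ε : ℤ) * (Real.pi * z * I / 2)) *
        mellin φ (1 - z) := by
  have hexp : ∀ t : ℝ, expIntegral φ (((ε : ℤ) : ℝ) * t) =
      ∫ x in Set.Ioi 0, φ x * cexp (2 * Real.pi * I * x * (((ε : ℤ) : ℝ) * t : ℝ)) := by
    intro t
    rw [expIntegral, ← integral_indicator measurableSet_Ioi]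
    congr 1
    ext x
    by_cases hx : 0 < x
    · rw [Set.indicator_of_mem (show x ∈ Set.Ioi 0 from hx)]
    · rw [Set.indicator_of_notMem (show x ∉ Set.Ioi 0 from hx), hφ0 x (not_lt.mp hx), zero_mul]
  -- Abel regularization: `t ^ (z - 1)` is not integrable against `φ` in two variables, so Fubini is
  -- applied with the factor `e^(-δt)` and `δ` is then sent to `0`.
  set J : ℝ → ℂ := fun δ => ∫ t in Set.Ioi (0 : ℝ),
    (t : ℂ) ^ (z - 1) • expIntegral φ (((ε : ℤ) : ℝ) * t) * cexp (-(δ * t)) with hJ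
  have hJ0 : Tendsto J (𝓝[>] 0) (𝓝 (mellin (fun t => expIntegral φ (((ε : ℤ) : ℝ) * t)) z)) := by
    refine tendsto_integral_filter_of_dominated_convergence
      (fun t : ℝ => ‖(t : ℂ) ^ (z - 1) • expIntegral φ (((ε : ℤ) : ℝ) * t)‖) ?_ ?_ hconv.norm ?_
    · exact Eventually.of_forall fun δ => hconv.aestronglyMeasurable.mul (by fun_prop)
    · filter_upwards [self_mem_nhdsWithin] with δ hδ
      refine (ae_restrict_iff' measurableSet_Ioi).mpr (Eventually.of_forall fun t ht => ?_)
      have ht0 : (0 : ℝ) < t := ht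
      have hδ0 : (0 : ℝ) < δ := hδ
      rw [norm_mul]
      refine mul_le_of_le_one_right (norm_nonneg _) ?_
      rw [Complex.norm_exp]
      apply Real.exp_le_one_iff.mpr
      simp
      positivity
    · refine Eventually.of_forall fun t => ?_
      have : Tendsto (fun δ : ℝ => (t : ℂ) ^ (z - 1) • expIntegral φ (((ε : ℤ) : ℝ) * t) *
          cexp (-(δ * t))) (𝓝 0) (𝓝 ((t : ℂ) ^ (z - 1) • expIntegral φ (((ε : ℤ) : ℝ) * t) *
          cexp (-((0 : ℝ) * t)))) := by
        apply Continuous.tendsto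
        fun_prop
      simp only [Complex.ofReal_zero, zero_mul, neg_zero, Complex.exp_zero, mul_one] at this
      exact this.mono_left nhdsWithin_le_nhds
  have hre : ∀ δ x : ℝ, ((δ : ℂ) - 2 * Real.pi * I * (((ε : ℤ) : ℝ) * x : ℝ)).re = δ := by
    intro δ x
    have : (2 * Real.pi * I * (((ε : ℤ) : ℝ) * x : ℝ) : ℂ) =
        ((2 * Real.pi * (((ε : ℤ) : ℝ) * x) : ℝ) : ℂ) * I := by push_cast; ring
    rw [this]
    simp
  have hJ1 : ∀ δ : ℝ, 0 < δ → J δ = ∫ x in Set.Ioi (0 : ℝ), φ x *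
      ((1 / ((δ : ℂ) - 2 * Real.pi * I * (((ε : ℤ) : ℝ) * x : ℝ))) ^ z * Complex.Gamma z) := by
    intro δ hδ
    have h1 : J δ = ∫ t in Set.Ioi (0 : ℝ), ∫ x in Set.Ioi (0 : ℝ),
        ((t : ℂ) ^ (z - 1) * cexp (-((δ : ℂ) * t))) * φ x *
          cexp (2 * Real.pi * I * x * (((ε : ℤ) : ℝ) * t : ℝ)) := by
      simp only [hJ]
      refine setIntegral_congr_fun measurableSet_Ioi fun t ht => ?_
      simp only [hexp t, smul_eq_mul]
      rw [mul_right_comm, ← integral_const_mul]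
      congr 1
      ext x
      ring
    rw [h1, integral_integral_swap]
    · refine setIntegral_congr_fun measurableSet_Ioi fun x hx => ?_
      have h2 := integral_cpow_mul_exp_neg_mul_of_re_pos
        (r := (δ : ℂ) - 2 * Real.pi * I * (((ε : ℤ) : ℝ) * x : ℝ)) hz (by rw [hre]; exact hδ)
      rw [← h2, ← integral_const_mul]
      congr 1
      ext t
      have h3 : cexp (-((δ : ℂ) * t)) * cexp (2 * Real.pi * I * x * (((ε : ℤ) : ℝ) * t : ℝ)) =
          cexp (-(((δ : ℂ) - 2 * Real.pi * I * (((ε : ℤ) : ℝ) * x : ℝ)) * t)) := by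
        rw [← Complex.exp_add]
        congr 1
        push_cast
        ring
      rw [← h3]
      ring
    · have h2 : Integrable (fun p : ℝ × ℝ => ((p.1 : ℂ) ^ (z - 1) * cexp (-((δ : ℂ) * p.1))) *
          φ p.2) ((volume.restrict (Set.Ioi 0)).prod (volume.restrict (Set.Ioi 0))) :=
        Integrable.mul_prod (integrableOn_cpow_mul_exp (z := z - 1) (by simp; linarith)
          (by simpa using hδ)) hφ.integrableOn
      refine h2.mul_bdd (c := 1) (by fun_prop) (Eventually.of_forall fun p => ?_)
      rw [norm_exp_two_pi_I]
  have hJ2 : Tendsto J (𝓝[>] 0) (𝓝 (∫ x in Set.Ioi (0 : ℝ), φ x *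
      ((1 / -(2 * Real.pi * I * (((ε : ℤ) : ℝ) * x : ℝ))) ^ z * Complex.Gamma z))) := by
    refine Tendsto.congr' (f₁ := fun δ : ℝ => ∫ x in Set.Ioi (0 : ℝ), φ x *
      ((1 / ((δ : ℂ) - 2 * Real.pi * I * (((ε : ℤ) : ℝ) * x : ℝ))) ^ z * Complex.Gamma z)) ?_ ?_
    · filter_upwards [self_mem_nhdsWithin] with δ hδ
      exact (hJ1 δ hδ).symm
    have hslit : ∀ δ x : ℝ, 0 < x →
        1 / ((δ : ℂ) - 2 * Real.pi * I * (((ε : ℤ) : ℝ) * x : ℝ)) ∈ slitPlane := by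
      intro δ x hx
      right
      have hne : (((δ : ℂ) - 2 * Real.pi * I * (((ε : ℤ) : ℝ) * x : ℝ))).im ≠ 0 := by
        have : (2 * Real.pi * I * (((ε : ℤ) : ℝ) * x : ℝ) : ℂ) =
          ((2 * Real.pi * (((ε : ℤ) : ℝ) * x) : ℝ) : ℂ) * I := by push_cast; ring
        rw [this]
        rcases Int.units_eq_one_or ε with h | h <;> subst h <;> simp [Real.pi_ne_zero, hx.ne']
      rw [one_div, Complex.inv_im]
      refine div_ne_zero (neg_ne_zero.mpr hne) (ne_of_gt (Complex.normSq_pos.mpr fun h => ?_))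
      rw [h] at hne; simp at hne
    -- The base stays at distance at least `2πx` from `0` for every `δ`, so its `z`-th power is
    -- bounded by a constant times `x ^ (-Re z)`. The convergence of the Mellin integral of `φ` at
    -- `1 - z` supplies the majorant.
    set B : ℝ := Real.exp (Real.pi * |z.im|) * (2 * Real.pi) ^ (-z.re) * ‖Complex.Gamma z‖ with hB
    refine tendsto_integral_filter_of_dominated_convergence
      (fun x : ℝ => B * ‖(x : ℂ) ^ (1 - z - 1) • φ x‖) ?_ ?_ (hφz.norm.const_mul B) ?_
    · refine Eventually.of_forall fun δ => hφ.aestronglyMeasurable.restrict.mul ?_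
      refine AEStronglyMeasurable.mul_const (ContinuousOn.aestronglyMeasurable
        (fun x hx => ContinuousAt.continuousWithinAt ?_) measurableSet_Ioi) _
      refine ContinuousAt.cpow ?_ continuousAt_const (hslit δ x hx)
      refine ContinuousAt.div continuousAt_const (by fun_prop) fun h => ?_
      have := hslit δ x hx
      rw [h, div_zero] at this
      exact Complex.zero_notMem_slitPlane this
    · refine Eventually.of_forall fun δ => ?_
      refine (ae_restrict_iff' measurableSet_Ioi).mpr (Eventually.of_forall fun x hx => ?_)
      have hx0 : (0 : ℝ) < x := hx
      set q : ℂ := (δ : ℂ) - 2 * Real.pi * I * (((ε : ℤ) : ℝ) * x : ℝ) with hq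
      have hqn : 2 * Real.pi * x ≤ ‖q‖ := by
        have him : |q.im| = 2 * Real.pi * x := by
          have : (2 * Real.pi * I * (((ε : ℤ) : ℝ) * x : ℝ) : ℂ) =
            ((2 * Real.pi * (((ε : ℤ) : ℝ) * x) : ℝ) : ℂ) * I := by push_cast; ring
          rw [hq, this]
          rcases Int.units_eq_one_or ε with h | h <;> subst h <;>
            simp [abs_of_pos, hx0, Real.pi_pos]
        rw [← him]; exact Complex.abs_im_le_norm q
      have hpos : 0 < 2 * Real.pi * x := by have := Real.pi_pos; positivity
      have h1 : ‖(1 / q) ^ z‖ ≤ (2 * Real.pi * x) ^ (-z.re) * Real.exp (Real.pi * |z.im|) := by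
        refine (Complex.norm_cpow_le _ _).trans ?_
        rw [div_eq_mul_inv, ← Real.exp_neg]
        have h2 : ‖1 / q‖ ^ z.re ≤ (2 * Real.pi * x) ^ (-z.re) := by
          rw [Real.rpow_neg hpos.le, ← Real.inv_rpow hpos.le, norm_div, norm_one, one_div]
          exact Real.rpow_le_rpow (by positivity) (inv_anti₀ hpos hqn) hz.le
        have h3 : Real.exp (-((1 / q).arg * z.im)) ≤ Real.exp (Real.pi * |z.im|) := by
          apply Real.exp_le_exp.mpr
          refine (neg_le_abs _).trans ?_
          rw [abs_mul]
          exact mul_le_mul_of_nonneg_right (Complex.abs_arg_le_pi _) (abs_nonneg _)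
        exact mul_le_mul h2 h3 (Real.exp_pos _).le (by positivity)
      have h4 : ‖(x : ℂ) ^ (1 - z - 1)‖ = x ^ (-z.re) := by
        rw [Complex.norm_cpow_eq_rpow_re_of_pos hx0]; congr 1; simp
      rw [norm_mul, norm_mul, norm_smul, h4, hB]
      rw [Real.mul_rpow (by positivity) hx0.le] at h1
      calc ‖φ x‖ * (‖(1 / q) ^ z‖ * ‖Complex.Gamma z‖)
          ≤ ‖φ x‖ * (((2 * Real.pi) ^ (-z.re) * x ^ (-z.re) * Real.exp (Real.pi * |z.im|)) *
            ‖Complex.Gamma z‖) := by gcongr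
        _ = _ := by ring
    · refine (ae_restrict_iff' measurableSet_Ioi).mpr (Eventually.of_forall fun x hx => ?_)
      refine Tendsto.mono_left ?_ (nhdsWithin_le_nhds (a := (0 : ℝ)) (s := Set.Ioi 0))
      have hc : ContinuousAt (fun δ : ℝ => φ x *
          ((1 / ((δ : ℂ) - 2 * Real.pi * I * (((ε : ℤ) : ℝ) * x : ℝ))) ^ z * Complex.Gamma z))
          0 := by
        refine continuousAt_const.mul (ContinuousAt.mul ?_ continuousAt_const)
        refine ContinuousAt.cpow ?_ continuousAt_const (hslit 0 x hx)
        refine ContinuousAt.div continuousAt_const (by fun_prop) fun h => ?_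
        have := hslit 0 x hx
        rw [h, div_zero] at this
        exact Complex.zero_notMem_slitPlane this
      have := hc.tendsto
      simpa only [Complex.ofReal_zero, zero_sub] using this
  rw [tendsto_nhds_unique hJ0 hJ2, mellin, ← integral_const_mul]
  refine setIntegral_congr_fun measurableSet_Ioi fun x hx => ?_
  have hx0 : (0 : ℝ) < x := hx
  rw [inv_neg_two_pi_I_cpow ε hx0 z, show 1 - z - 1 = -z by ring, smul_eq_mul]
  ring

/-! ### The Fourier transform of the flat functions -/

theorem integrable_iteratedDeriv_flatPower {μ : ℂ} {m : ℕ} (h : 1 < μ.re + m) :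
    Integrable (iteratedDeriv m (flatPower μ)) := by
  -- With `v = 1 - m` the Mellin transform is taken at `1`, where its convergence is plain
  -- integrability on `(0, ∞)`.
  have h1 := (hasMellin_iteratedDeriv_flatPower m (μ := μ) (v := 1 - m) (by simp; linarith)).1
  have h2 : IntegrableOn (iteratedDeriv m (flatPower μ)) (Set.Ioi 0) := by
    refine h1.congr_fun (fun t ht => ?_) measurableSet_Ioi
    simp
  have h3 : IntegrableOn (iteratedDeriv m (flatPower μ)) (Set.Iic 0) := by
    refine integrableOn_zero.congr_fun (fun t ht => ?_) measurableSet_Iic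
    exact (iteratedDeriv_flatPower_of_nonpos m μ ht).symm
  rw [← integrableOn_univ, ← Set.Iic_union_Ioi (a := (0 : ℝ))]
  exact h3.union h2

/-- The function `(-1 / (2πit)) ^ m ∫ u^(m)(x) e^(2πixt) dx` for `u = flatPower μ`. -/
def flatFourier (μ : ℂ) (m : ℕ) (t : ℝ) : ℂ :=
  (-1 / (2 * Real.pi * I * t)) ^ m * expIntegral (iteratedDeriv m (flatPower μ)) t

theorem sign_mul_ne_zero (ε : ℤˣ) {t : ℝ} (ht : t ≠ 0) : ((ε : ℤ) : ℝ) * t ≠ 0 := by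
  rcases Int.units_eq_one_or ε with h | h <;> subst h <;> simpa using ht

/-- Raising the order from `m` to `n` by parts gives `t ^ (-n)` times the `L¹` norm of the `n`-th
derivative, which is at most `π exp (C n log n)` by the bound with `(1 + x²)⁻¹`. -/
theorem rapidDecay_flatFourier {μ : ℂ} {m : ℕ} (h : 1 < μ.re + m) (ε : ℤˣ) :
    RapidDecay fun t => flatFourier μ m (((ε : ℤ) : ℝ) * t) := by
  refine ⟨?_, ?_⟩
  · intro t ht
    have ht0 : (0 : ℝ) < t := ht
    have hne := sign_mul_ne_zero ε ht0.ne'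
    refine ContinuousAt.continuousWithinAt (ContinuousAt.mul (ContinuousAt.pow
      (ContinuousAt.div continuousAt_const (by fun_prop) ?_) _) ?_)
    · have : ((((ε : ℤ) : ℝ) * t : ℝ) : ℂ) ≠ 0 := by exact_mod_cast hne
      simp only [ne_eq, mul_eq_zero, this, I_ne_zero, or_false, OfNat.ofNat_ne_zero, false_or]
      exact_mod_cast Real.pi_ne_zero
    · exact ((continuous_expIntegral (integrable_iteratedDeriv_flatPower h)).comp
        (by fun_prop)).continuousAt
  · obtain ⟨C, hC, hb⟩ := exists_iteratedDeriv_flatPower_bound μ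
    obtain ⟨m₁, hm₁⟩ := exists_nat_ge (2 - μ.re)
    refine ⟨C + 4, by positivity, max m m₁, fun n hn t ht => ?_⟩
    have hn1 : m ≤ n := le_of_max_le_left hn
    have hn2 : (m₁ : ℝ) ≤ n := by exact_mod_cast le_of_max_le_right hn
    have hn3 : 2 ≤ μ.re + n := by linarith
    have hne := sign_mul_ne_zero ε ht.ne'
    have hint : ∀ j, m ≤ j → Integrable (iteratedDeriv j (flatPower μ)) := fun j hj =>
      integrable_iteratedDeriv_flatPower (by
        have : (m : ℝ) ≤ j := by exact_mod_cast hj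
        linarith)
    beta_reduce
    rw [flatFourier, ← expIntegral_iteratedDeriv (contDiff_flatPower μ) hn1 hint hne, norm_mul,
      norm_pow]
    have e1 : ‖(-1 / (2 * Real.pi * I * ((((ε : ℤ) : ℝ) * t : ℝ) : ℂ)))‖ ≤ 1 / t := by
      have habs : |((ε : ℤ) : ℝ) * t| = t := by
        rcases Int.units_eq_one_or ε with h | h <;> subst h <;> simp [abs_of_pos ht]
      rw [norm_div, norm_neg, norm_one, norm_mul, norm_mul, norm_mul, Complex.norm_I,
        Complex.norm_real, Complex.norm_real, Real.norm_eq_abs, Real.norm_eq_abs, habs,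
        abs_of_pos Real.pi_pos, Complex.norm_ofNat]
      apply one_div_le_one_div_of_le ht
      nlinarith [Real.pi_gt_three]
    have e2 : ‖expIntegral (iteratedDeriv n (flatPower μ)) (((ε : ℤ) : ℝ) * t)‖ ≤
        Real.exp (C * logExponent n) * Real.pi := by
      refine (norm_expIntegral_le _ _).trans ?_
      rw [← integral_univ_inv_one_add_sq, ← integral_const_mul]
      exact integral_mono (hint n hn1).norm (integrable_inv_one_add_sq.const_mul _) (hb n hn3)
    have e3 : Real.pi ≤ Real.exp (4 * logExponent n) := by
      have h1 := logExponent_pos (Nat.cast_nonneg (α := ℝ) n)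
      linarith [Real.add_one_le_exp (4 * logExponent (n : ℝ)), Real.pi_lt_four]
    calc _ ≤ (1 / t) ^ n * (Real.exp (C * logExponent n) * Real.pi) := by gcongr
      _ ≤ (1 / t) ^ n * (Real.exp (C * logExponent n) * Real.exp (4 * logExponent n)) := by gcongr
      _ = _ := by rw [← Real.exp_add, ← add_mul, one_div, inv_pow]; ring

/-- The product is the one created by `m` derivatives in the Mellin transform. It restores `Γ(w)`
from the `Γ(w - m)` that the factor `t ^ (-m)` produces. -/
theorem Gamma_sub_nat_mul_prod (m : ℕ) {w : ℂ} (hw : (m : ℝ) < w.re) :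
    Complex.Gamma (w - m) * ∏ j ∈ Finset.range m, (w - 1 - j) = Complex.Gamma w := by
  induction m with
  | zero => simp
  | succ m ih =>
    push_cast at hw
    have hne : w - ((m + 1 : ℕ) : ℂ) ≠ 0 := fun h => by
      have := congrArg Complex.re h
      simp at this
      linarith
    rw [← ih (by linarith), Finset.prod_range_succ]
    have h1 : Complex.Gamma (w - m) = (w - ((m + 1 : ℕ) : ℂ)) * Complex.Gamma (w - ((m + 1 : ℕ) : ℂ)) := by
      rw [← Complex.Gamma_add_one _ hne]
      congr 1
      push_cast
      ring
    rw [h1]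
    push_cast
    ring

/-- The local functional equation for the flat functions. -/
theorem exists_mellin_flatFourier {μ : ℂ} {m : ℕ} (h : 1 < μ.re + m) (ε : ℤˣ) :
    ∃ σ : ℝ, ∀ w : ℂ, σ < w.re →
      mellin (fun t => flatFourier μ m (((ε : ℤ) : ℝ) * t)) w =
        (2 * Real.pi : ℂ) ^ (-w) * Complex.Gamma w * cexp ((ε : ℤ) * (Real.pi * w * I / 2)) *
          (Gammaℝ (μ + w - 1) / 2) := by
  obtain ⟨σ₁, h₁⟩ := (rapidDecay_flatFourier h ε).exists_mellinConvergent
  refine ⟨max σ₁ (max m (1 - μ.re)), fun w hw => ?_⟩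
  have hw1 := h₁ w (lt_of_le_of_lt (le_max_left _ _) hw)
  have hw2 : (m : ℝ) < w.re :=
    lt_of_le_of_lt ((le_max_left _ _).trans (le_max_right _ _)) hw
  have hw3 : 1 - μ.re < w.re :=
    lt_of_le_of_lt ((le_max_right _ _).trans (le_max_right _ _)) hw
  have hpi : (Real.pi : ℂ) ≠ 0 := by exact_mod_cast Real.pi_ne_zero
  have hε0 : ((ε : ℤ) : ℂ) ≠ 0 := by
    rcases Int.units_eq_one_or ε with h | h <;> subst h <;> simp
  set c : ℂ := (-1 / (2 * Real.pi * I * (ε : ℤ))) ^ m with hc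
  have hc0 : c ≠ 0 := pow_ne_zero _ (div_ne_zero (by norm_num)
    (mul_ne_zero (mul_ne_zero (mul_ne_zero two_ne_zero hpi) I_ne_zero) hε0))
  set E : ℝ → ℂ := fun t => expIntegral (iteratedDeriv m (flatPower μ)) (((ε : ℤ) : ℝ) * t) with hE
  have hK : ∀ t : ℝ, 0 < t → flatFourier μ m (((ε : ℤ) : ℝ) * t) =
      c • ((t : ℂ) ^ (-m : ℂ) • E t) := by
    intro t ht
    have ht0 : (t : ℂ) ≠ 0 := by exact_mod_cast ht.ne'
    simp only [flatFourier, smul_eq_mul, hc, hE]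
    rw [Complex.cpow_neg, Complex.cpow_natCast, ← mul_assoc, ← inv_pow, ← mul_pow]
    congr 2
    push_cast
    field_simp
  have hE1 : MellinConvergent (fun t : ℝ => (t : ℂ) ^ (-m : ℂ) • E t) w := by
    have h2 := hw1.const_smul c⁻¹
    refine h2.congr_fun (fun t ht => ?_) measurableSet_Ioi
    simp only [hK t ht, inv_smul_smul₀ hc0]
  rw [MellinConvergent.cpow_smul, ← sub_eq_add_neg] at hE1
  have hmel : mellin (fun t => flatFourier μ m (((ε : ℤ) : ℝ) * t)) w = c * mellin E (w - m) := by
    have h2 := mellin_const_smul (fun t : ℝ => (t : ℂ) ^ (-m : ℂ) • E t) w c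
    rw [mellin_cpow_smul, ← sub_eq_add_neg, smul_eq_mul] at h2
    rw [← h2, mellin, mellin]
    refine setIntegral_congr_fun measurableSet_Ioi fun t ht => ?_
    simp only [hK t ht]
  have hz : 0 < (w - m).re := by simp; linarith
  -- The factor `t ^ (-m)` moves `w` to `w - m`, and the dual point `1 - (w - m)` is `(1 - w) + m`,
  -- the point for the `m`-th derivative with `v = 1 - w`.
  have hM := hasMellin_iteratedDeriv_flatPower m (μ := μ) (v := 1 - w) (by simp; linarith)
  have hv : 1 - w + m = 1 - (w - m) := by ring
  rw [hv] at hM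
  have key := mellin_expIntegral ε hz (integrable_iteratedDeriv_flatPower h)
    (fun x hx => iteratedDeriv_flatPower_of_nonpos m μ hx) hM.1 hE1
  rw [hmel, key, hM.2, ← Gamma_sub_nat_mul_prod m hw2]
  have h2pi : (2 * Real.pi : ℂ) ≠ 0 := mul_ne_zero two_ne_zero hpi
  have hprod : (-1 : ℂ) ^ m * ∏ j ∈ Finset.range m, (1 - w + (j : ℂ)) =
      ∏ j ∈ Finset.range m, (w - 1 - (j : ℂ)) := by
    have h2 : (-1 : ℂ) ^ m = ∏ _j ∈ Finset.range m, (-1 : ℂ) := by simp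
    rw [h2, ← Finset.prod_mul_distrib]
    exact Finset.prod_congr rfl fun j _ => by ring
  -- The constant `(-1/(2πiε)) ^ m` exactly undoes the shift of `w` by `m` in the power of `2π` and
  -- in the exponential, so the result is independent of `m`.
  have hpow : c * ((2 * Real.pi : ℂ) ^ (-(w - m)) *
      cexp ((ε : ℤ) * (Real.pi * (w - m) * I / 2))) =
      (2 * Real.pi : ℂ) ^ (-w) * cexp ((ε : ℤ) * (Real.pi * w * I / 2)) := by
    have a1 : (2 * Real.pi : ℂ) ^ (-(w - m)) = (2 * Real.pi : ℂ) ^ (-w) * (2 * Real.pi) ^ m := by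
      rw [neg_sub, sub_eq_add_neg, add_comm, Complex.cpow_add _ _ h2pi, Complex.cpow_natCast]
    have a2 : cexp ((ε : ℤ) * (Real.pi * (w - m) * I / 2)) =
        cexp ((ε : ℤ) * (Real.pi * w * I / 2)) * (cexp (-((ε : ℤ) * (Real.pi * I / 2)))) ^ m := by
      rw [← Complex.exp_nat_mul, ← Complex.exp_add]
      congr 1
      ring
    have a3 : cexp (-((ε : ℤ) * (Real.pi * I / 2))) = -((ε : ℤ) * I) := by
      rcases Int.units_eq_one_or ε with h | h <;> subst h
      · have : (-(((1 : ℤˣ) : ℤ) * (Real.pi * I / 2)) : ℂ) = -(Real.pi / 2 * I) := by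
          push_cast; ring
        rw [this, Complex.exp_neg, Complex.exp_pi_div_two_mul_I]
        simp
      · have : (-((((-1 : ℤˣ) : ℤ) : ℂ) * (Real.pi * I / 2)) : ℂ) = Real.pi / 2 * I := by
          push_cast; ring
        rw [this, Complex.exp_pi_div_two_mul_I]
        simp
    have a4 : (-1 / (2 * Real.pi * I * (ε : ℤ)) : ℂ) * (2 * Real.pi) * -((ε : ℤ) * I) = 1 := by
      field_simp
    rw [a1, a2, a3, hc]
    have a5 : (-1 / (2 * Real.pi * I * (ε : ℤ)) : ℂ) ^ m * (2 * Real.pi) ^ m *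
        (-((ε : ℤ) * I)) ^ m = 1 := by
      rw [← mul_pow, ← mul_pow, a4, one_pow]
    linear_combination ((2 * Real.pi : ℂ) ^ (-w) * cexp ((ε : ℤ) * (Real.pi * w * I / 2))) * a5
  rw [show μ - (1 - w) = μ + w - 1 by ring, hprod]
  linear_combination (Complex.Gamma (w - m) * (∏ j ∈ Finset.range m, (w - 1 - (j : ℂ))) *
    (Gammaℝ (μ + w - 1) / 2)) * hpow

/-! ### Two-sided flat functions -/

/-- The function `A u(x) + B u(-x)` with `u = flatPower μ`. -/
def twoSidedFlat (μ A B : ℂ) (x : ℝ) : ℂ := A * flatPower μ x + B * flatPower μ (-x)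

theorem contDiff_twoSidedFlat (μ A B : ℂ) : ContDiff ℝ ∞ (twoSidedFlat μ A B) :=
  (contDiff_const.mul (contDiff_flatPower μ)).add
    (contDiff_const.mul ((contDiff_flatPower μ).comp contDiff_neg))

theorem iteratedDeriv_twoSidedFlat (μ A B : ℂ) (m : ℕ) (x : ℝ) :
    iteratedDeriv m (twoSidedFlat μ A B) x = A * iteratedDeriv m (flatPower μ) x +
      (B * (-1) ^ m) * iteratedDeriv m (flatPower μ) (-x) := by
  have h1 : ContDiffAt ℝ m (fun x => A * flatPower μ x) x :=
    (contDiff_const.mul (contDiff_flatPower_nat m μ)).contDiffAt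
  have h2 : ContDiffAt ℝ m (fun x => B * flatPower μ (-x)) x :=
    (contDiff_const.mul ((contDiff_flatPower_nat m μ).comp contDiff_neg)).contDiffAt
  have h3 : twoSidedFlat μ A B = fun x => A * flatPower μ x + B * flatPower μ (-x) := rfl
  rw [h3, iteratedDeriv_fun_add h1 h2, iteratedDeriv_const_mul_field,
    iteratedDeriv_const_mul_field, iteratedDeriv_comp_neg, Complex.real_smul]
  push_cast
  ring

theorem fourier_twoSidedFlat {lam μ A B : ℂ} (hμ : 2 * lam.re ≤ μ.re) {t : ℝ} (ht : t ≠ 0) :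
    fourier lam (twoSidedFlat μ A B) t = A * flatFourier μ (fourierOrder lam) t +
      B * flatFourier μ (fourierOrder lam) (-t) := by
  have hi : Integrable (iteratedDeriv (fourierOrder lam) (flatPower μ)) :=
    integrable_iteratedDeriv_flatPower (by linarith [fourierOrder_spec lam])
  rw [fourier_of_ne_zero _ _ ht]
  have h1 : iteratedDeriv (fourierOrder lam) (twoSidedFlat μ A B) = fun x =>
      A * iteratedDeriv (fourierOrder lam) (flatPower μ) x + (B * (-1) ^ (fourierOrder lam)) *
        iteratedDeriv (fourierOrder lam) (flatPower μ) (-x) :=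
    funext fun x => iteratedDeriv_twoSidedFlat μ A B _ x
  rw [h1, expIntegral_add (hi.const_mul A) (hi.comp_neg.const_mul _), expIntegral_const_mul,
    expIntegral_const_mul,
    expIntegral_comp_neg (iteratedDeriv (fourierOrder lam) (flatPower μ)) t, flatFourier,
    flatFourier]
  have h2 : (-1 / (2 * Real.pi * I * ((-t : ℝ) : ℂ))) = (-1) * (-1 / (2 * Real.pi * I * t)) := by
    push_cast
    rw [mul_neg, div_neg]
    ring
  rw [h2, mul_pow]
  ring

theorem meromorphicNFOn_GammaR_sub (μ c : ℂ) :
    MeromorphicNFOn (fun s => c * (Gammaℝ (μ - s) / 2)) Set.univ := by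
  by_cases hc : c = 0
  · subst hc
    simp only [zero_mul]
    exact fun s _ => analyticAt_const.meromorphicNFAt
  intro s _
  have hpi : (Real.pi : ℂ) ≠ 0 := by exact_mod_cast Real.pi_ne_zero
  have h1 : MeromorphicNFAt (Complex.Gamma ∘ fun s : ℂ => (μ - s) / 2) s :=
    MeromorphicNFAt.comp_analyticAt (MeromorphicNFOn.Gamma (Set.mem_univ _)) (by fun_prop)
  have hd : Differentiable ℂ fun s : ℂ => c / 2 * (Real.pi : ℂ) ^ (-(μ - s) / 2) := fun s =>
    ((((differentiableAt_const _).sub differentiableAt_id).neg.div_const _).const_cpow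
      (Or.inl hpi)).const_mul _
  have h3 : c / 2 * (Real.pi : ℂ) ^ (-(μ - s) / 2) ≠ 0 := by
    rw [Complex.cpow_def_of_ne_zero hpi]
    exact mul_ne_zero (div_ne_zero hc two_ne_zero) (Complex.exp_ne_zero _)
  have h4 := (meromorphicNFAt_mul_iff_right (hd.analyticAt s) h3).mpr h1
  have e : (fun s => c * (Gammaℝ (μ - s) / 2)) =
      (fun s : ℂ => c / 2 * (Real.pi : ℂ) ^ (-(μ - s) / 2)) *
        (Complex.Gamma ∘ fun s : ℂ => (μ - s) / 2) := by
    funext s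
    simp only [Pi.mul_apply, Function.comp_apply, Gammaℝ_def]
    ring
  rw [e]
  exact h4

/-- Each half-line sees only one summand, and the product and sign in the Mellin transform of the
derivative cancel those in `localZetaIntegral`. So the value at `t = 0` of the generalized Fourier
transform becomes explicit. -/
theorem isLocalZeta_twoSidedFlat {lam μ A B : ℂ} (hμ : 2 * lam.re ≤ μ.re) (ε : ℤˣ) :
    IsLocalZeta lam ε (twoSidedFlat μ A B)
      (fun s => (if ε = 1 then A else B) * (Gammaℝ (μ - s) / 2)) := by
  refine ⟨meromorphicNFOn_GammaR_sub μ _, fun m s _ h2 h3 => ?_⟩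
  have hM := (hasMellin_iteratedDeriv_flatPower m (μ := μ) (v := s) (by linarith)).2
  have hprod : ∏ j ∈ Finset.range m, (s + (j : ℂ)) ≠ 0 :=
    Finset.prod_ne_zero_iff.mpr fun j _ h => h3 j (eq_neg_of_add_eq_zero_left h)
  have hneg : ((-1 : ℂ) ^ m) * (-1) ^ m = 1 := by rw [← mul_pow]; simp
  have hval : ∀ x ∈ Set.Ioi (0 : ℝ), (x : ℂ) ^ (s + m - 1) *
      iteratedDeriv m (twoSidedFlat μ A B) (((ε : ℤ) : ℝ) * x) =
      ((if ε = 1 then A else B * (-1) ^ m)) *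
        ((x : ℂ) ^ (s + m - 1) • iteratedDeriv m (flatPower μ) x) := by
    intro x hx
    have hx0 : (0 : ℝ) < x := hx
    rw [iteratedDeriv_twoSidedFlat]
    rcases Int.units_eq_one_or ε with h | h <;> subst h
    · rw [iteratedDeriv_flatPower_of_nonpos m μ (x := -((((1 : ℤˣ) : ℤ) : ℝ) * x))
        (by simpa using hx0.le)]
      simp
      ring
    · rw [iteratedDeriv_flatPower_of_nonpos m μ (x := ((((-1 : ℤˣ) : ℤ) : ℝ) * x))
        (by simpa using hx0.le)]
      simp
      ring
  rw [localZetaIntegral, setIntegral_congr_fun measurableSet_Ioi hval, integral_const_mul]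
  rw [mellin] at hM
  rw [hM]
  rcases Int.units_eq_one_or ε with h | h <;> subst h
  · simp
    field_simp
    linear_combination -A * Gammaℝ (μ - s) * hneg
  · simp
    field_simp
    linear_combination -B * Gammaℝ (μ - s) * hneg

theorem fourier_twoSidedFlat_zero {lam μ A B : ℂ} (hμ : 2 * lam.re ≤ μ.re) :
    fourier lam (twoSidedFlat μ A B) 0 = (A + B) * (Gammaℝ (μ - 1) / 2) := by
  rw [fourier_zero, (isLocalZeta_twoSidedFlat hμ 1).localZeta_eq,
    (isLocalZeta_twoSidedFlat hμ (-1)).localZeta_eq]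
  simp
  ring

/-! ### Gaussian test functions -/

/-- The function `x ^ k exp (-π x ^ 2)`. -/
def gaussPower (k : ℕ) (x : ℝ) : ℂ := (x : ℂ) ^ k * cexp (-Real.pi * (x : ℂ) ^ 2)

theorem contDiff_gaussPower (k : ℕ) : ContDiff ℝ ∞ (gaussPower k) := by
  have h : ContDiff ℝ ∞ fun x : ℝ => (x : ℂ) := Complex.ofRealCLM.contDiff
  exact (h.pow k).mul (contDiff_const.mul (h.pow 2)).cexp

/-- For `k = 0` the truncated `k - 1` is harmless, since its coefficient is `0`. -/
theorem hasDerivAt_gaussPower (k : ℕ) (x : ℝ) : HasDerivAt (gaussPower k)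
    (k * gaussPower (k - 1) x - 2 * Real.pi * gaussPower (k + 1) x) x := by
  have h1 : HasDerivAt (fun z : ℂ => z ^ k) (k * (x : ℂ) ^ (k - 1)) (x : ℂ) := hasDerivAt_pow k _
  have h2 : HasDerivAt (fun z : ℂ => -Real.pi * z ^ 2) (-Real.pi * (2 * (x : ℂ))) (x : ℂ) := by
    refine ((hasDerivAt_pow 2 (x : ℂ)).const_mul (-(Real.pi : ℂ))).congr_deriv ?_
    norm_num
  refine (h1.mul h2.cexp).comp_ofReal.congr_deriv ?_
  simp only [gaussPower]
  ring

theorem deriv_gaussPower (k : ℕ) : deriv (gaussPower k) =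
    fun x => k * gaussPower (k - 1) x - 2 * Real.pi * gaussPower (k + 1) x :=
  funext fun x => (hasDerivAt_gaussPower k x).deriv

theorem integrable_gaussPower (k : ℕ) : Integrable (gaussPower k) := by
  have h := (integrable_rpow_mul_exp_neg_mul_sq Real.pi_pos (s := k)
    (by linarith [Nat.cast_nonneg (α := ℝ) k])).ofReal (𝕜 := ℂ)
  refine h.congr (Eventually.of_forall fun x => ?_)
  simp [gaussPower]

theorem integrable_iteratedDeriv_gaussPower (j k : ℕ) :
    Integrable (iteratedDeriv j (gaussPower k)) := by
  induction j generalizing k with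
  | zero => simpa using integrable_gaussPower k
  | succ j ih =>
    have h : ∀ (l : ℕ) (c : ℂ) (x : ℝ), ContDiffAt ℝ j (fun x => c * gaussPower l x) x := fun l c x =>
      (contDiff_const.mul ((contDiff_gaussPower l).of_le (by exact_mod_cast le_top))).contDiffAt
    have e : iteratedDeriv (j + 1) (gaussPower k) = fun x =>
        k * iteratedDeriv j (gaussPower (k - 1)) x -
          2 * Real.pi * iteratedDeriv j (gaussPower (k + 1)) x := by
      funext x
      rw [iteratedDeriv_succ', deriv_gaussPower]
      have := iteratedDeriv_sub (h (k - 1) k x) (h (k + 1) (2 * Real.pi) x)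
      rw [iteratedDeriv_const_mul_field, iteratedDeriv_const_mul_field] at this
      exact this
    rw [e]
    exact ((ih _).const_mul _).sub ((ih _).const_mul _)

theorem fourier_gaussPower_eq_expIntegral (lam : ℂ) (k : ℕ) {t : ℝ} (ht : t ≠ 0) :
    fourier lam (gaussPower k) t = expIntegral (gaussPower k) t := by
  rw [fourier_of_ne_zero _ _ ht, expIntegral_iteratedDeriv (contDiff_gaussPower k)
    (Nat.zero_le _) (fun j _ => integrable_iteratedDeriv_gaussPower j k) ht, pow_zero, one_mul,
    iteratedDeriv_zero]

theorem expIntegral_gaussPower_zero (t : ℝ) :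
    expIntegral (gaussPower 0) t = cexp (-Real.pi * (t : ℂ) ^ 2) := by
  have h := congrFun (fourier_gaussian_pi (b := 1) (by simp)) (-t)
  rw [expIntegral_eq_fourier]
  have e : gaussPower 0 = fun x : ℝ => cexp (-Real.pi * 1 * (x : ℂ) ^ 2) := by
    funext x; simp [gaussPower]
  rw [e, h]
  simp

theorem expIntegral_gaussPower_one (t : ℝ) :
    expIntegral (gaussPower 1) t = I * t * cexp (-Real.pi * (t : ℂ) ^ 2) := by
  have hpi : (Real.pi : ℂ) ≠ 0 := by exact_mod_cast Real.pi_ne_zero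
  -- The odd Gaussian is a multiple of the derivative of the even one, so its transform follows from
  -- the self-duality of `exp (-πx²)`.
  have e : gaussPower 1 = fun x => (-(1 / (2 * Real.pi)) : ℂ) * deriv (gaussPower 0) x := by
    funext x
    rw [deriv_gaussPower]
    simp
    field_simp
  have hd := (integrable_iteratedDeriv_gaussPower 1 0)
  rw [iteratedDeriv_one] at hd
  rw [e, expIntegral_const_mul, expIntegral_deriv (integrable_gaussPower 0)
    (fun x => (hasDerivAt_gaussPower 0 x).differentiableAt) hd, expIntegral_gaussPower_zero]
  field_simp

theorem fourier_gaussPower (lam : ℂ) {k : ℕ} (hk : k ≤ 1) {t : ℝ} (ht : t ≠ 0) :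
    fourier lam (gaussPower k) t = (I * t) ^ k * cexp (-Real.pi * (t : ℂ) ^ 2) := by
  rw [fourier_gaussPower_eq_expIntegral lam k ht]
  interval_cases k
  · rw [expIntegral_gaussPower_zero, pow_zero, one_mul]
  · rw [expIntegral_gaussPower_one, pow_one]

theorem fourier_gaussPower_one_zero (lam : ℂ) : fourier lam (gaussPower 1) 0 = 0 := by
  rw [fourier_zero, localZeta_of_odd (fun x => by simp [gaussPower]), add_neg_cancel]

/-- For `t > 1`, `t ^ (k + m) ≤ (t²) ^ (m + 1)` because `k ≤ 1`, and `y ^ n ≤ n! e^y` at `y = t²`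
finishes; below `1` everything is at most `1`. -/
theorem rapidDecay_gaussPower {k : ℕ} (hk : k ≤ 1) : RapidDecay (gaussPower k) := by
  obtain ⟨D, hD, h'⟩ := exists_logExponent_affine_le (zero_le_one) (zero_le_one (α := ℝ))
  refine ⟨(contDiff_gaussPower k).continuous.continuousOn, D, hD, 0, fun m _ t ht => ?_⟩
  have hm0 : (0 : ℝ) ≤ m := by positivity
  rw [le_div_iff₀ (by positivity), gaussPower, norm_mul, norm_pow, Complex.norm_real,
    Real.norm_of_nonneg ht.le, Complex.norm_exp]
  have e : (-Real.pi * (t : ℂ) ^ 2).re = -Real.pi * t ^ 2 := by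
    have : (-Real.pi * (t : ℂ) ^ 2) = ((-Real.pi * t ^ 2 : ℝ) : ℂ) := by push_cast; ring
    rw [this, Complex.ofReal_re]
  rw [e]
  have h1 : ((m + 1 : ℕ).factorial : ℝ) ≤ Real.exp (D * logExponent m) :=
    (factorial_le_exp_logExponent _).trans (Real.exp_le_exp.mpr
      (h' m hm0 _ (by positivity) (by push_cast; linarith)))
  refine le_trans ?_ h1
  have hle : Real.exp (-Real.pi * t ^ 2) ≤ Real.exp (-(t ^ 2)) :=
    Real.exp_le_exp.mpr (by nlinarith [Real.pi_gt_three, sq_nonneg t])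
  have h2 := Real.pow_div_factorial_le_exp (x := t ^ 2) (by positivity) (m + 1)
  rw [div_le_iff₀ (by positivity)] at h2
  rcases le_or_gt t 1 with h | h
  · have hfac : (1 : ℝ) ≤ (m + 1 : ℕ).factorial := by
      exact_mod_cast Nat.one_le_iff_ne_zero.mpr (Nat.factorial_ne_zero _)
    have h3 : t ^ k ≤ 1 := pow_le_one₀ ht.le h
    have h4 : t ^ m ≤ 1 := pow_le_one₀ ht.le h
    have h5 : Real.exp (-Real.pi * t ^ 2) ≤ 1 :=
      Real.exp_le_one_iff.mpr (by nlinarith [Real.pi_pos, sq_nonneg t])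
    calc t ^ k * Real.exp (-Real.pi * t ^ 2) * t ^ m ≤ 1 * 1 * 1 := by gcongr
      _ ≤ _ := by linarith
  · calc t ^ k * Real.exp (-Real.pi * t ^ 2) * t ^ m
        = t ^ (k + m) * Real.exp (-Real.pi * t ^ 2) := by ring
      _ ≤ t ^ (2 * (m + 1)) * Real.exp (-(t ^ 2)) :=
          mul_le_mul (pow_le_pow_right₀ h.le (by omega)) hle (Real.exp_pos _).le (by positivity)
      _ ≤ (Real.exp (t ^ 2) * (m + 1).factorial) * Real.exp (-(t ^ 2)) := by
          rw [pow_mul]; gcongr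
      _ = (m + 1).factorial := by
          rw [mul_right_comm, ← Real.exp_add]; simp

theorem fourier_gaussPower_sign (lam : ℂ) {k : ℕ} (hk : k ≤ 1) (ε : ℤˣ) {t : ℝ} (ht : 0 < t) :
    fourier lam (gaussPower k) (((ε : ℤ) : ℝ) * t) = ((ε : ℤ) * I) ^ k * gaussPower k t := by
  rw [fourier_gaussPower lam hk (sign_mul_ne_zero ε ht.ne'), gaussPower]
  rcases Int.units_eq_one_or ε with h | h <;> subst h <;> simp <;> ring

theorem rapidDecay_fourier_gaussPower (lam : ℂ) {k : ℕ} (hk : k ≤ 1) (ε : ℤˣ) :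
    RapidDecay fun t => fourier lam (gaussPower k) (((ε : ℤ) : ℝ) * t) :=
  ((rapidDecay_gaussPower hk).const_mul _).congr fun _ ht => fourier_gaussPower_sign lam hk ε ht

theorem mellin_gaussPower (k : ℕ) {w : ℂ} (hw : 0 < w.re) :
    mellin (gaussPower k) w = Gammaℝ (w + k) / 2 := by
  have hcv : (w + k) / ((2 : ℝ) : ℂ) = (w + k) / 2 := by push_cast; ring
  have hw' : 0 < ((w + k) / 2).re := by
    rw [← hcv, Complex.div_ofReal_re]
    simp
    positivity
  have h1 := (hasMellin_exp_neg_pi hw').2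
  set g : ℝ → ℂ := fun t : ℝ => cexp (-(Real.pi * t : ℝ)) with hg
  have h2 : mellin (fun t : ℝ => (t : ℂ) ^ (k : ℂ) • g (t ^ (2 : ℝ))) w = Gammaℝ (w + k) / 2 := by
    rw [mellin_cpow_smul, mellin_comp_rpow, hcv, h1, Gammaℝ_def, neg_div]
    simp
    ring
  rw [← h2, mellin, mellin]
  refine setIntegral_congr_fun measurableSet_Ioi fun t ht => ?_
  simp [gaussPower, hg]

theorem mellin_fourier_gaussPower (lam : ℂ) {k : ℕ} (hk : k ≤ 1) (ε : ℤˣ) {w : ℂ} (hw : 0 < w.re) :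
    mellin (fun t => fourier lam (gaussPower k) (((ε : ℤ) : ℝ) * t)) w =
      ((ε : ℤ) * I) ^ k * (Gammaℝ (w + k) / 2) := by
  rw [← mellin_gaussPower k hw, ← smul_eq_mul, ← mellin_const_smul, mellin, mellin]
  refine setIntegral_congr_fun measurableSet_Ioi fun t ht => ?_
  simp only [fourier_gaussPower_sign lam hk ε ht, smul_eq_mul]

/-! ### The inversion on the line model -/

theorem cpow_ne_zero_of_pos {c : ℝ} (hc : 0 < c) (s : ℂ) : (c : ℂ) ^ s ≠ 0 := by
  rw [Complex.cpow_def_of_ne_zero (by exact_mod_cast hc.ne')]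
  exact Complex.exp_ne_zero _

theorem inversionFormula_gaussPower (lam : ℂ) (ell : ℤ) (k : ℕ) {x : ℝ} (hx : x ≠ 0) :
    twoSidedFlat (2 * lam + k) ((-1) ^ k) (I ^ ell) x =
      inversionFormula lam ell (gaussPower k) x := by
  have key : ∀ y : ℝ, 0 < y → flatPower (2 * lam + k) y =
      (y : ℂ) ^ (-2 * lam) * (((y : ℂ)⁻¹) ^ k * cexp (-Real.pi * ((y : ℂ)⁻¹) ^ 2)) := by
    intro y hy
    have hy0 : (y : ℂ) ≠ 0 := by exact_mod_cast hy.ne'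
    rw [flatPower_of_pos _ hy, show -(2 * lam + k) = -2 * lam - k by ring,
      Complex.cpow_sub _ _ hy0, Complex.cpow_natCast]
    have : -Real.pi / (y : ℂ) ^ 2 = -Real.pi * ((y : ℂ)⁻¹) ^ 2 := by field_simp
    rw [this, inv_pow (y : ℂ) k, div_eq_mul_inv]
    ring
  rcases lt_or_gt_of_ne hx with h | h
  · rw [twoSidedFlat, flatPower_of_nonpos _ h.le, key (-x) (by linarith), inversionFormula,
      sgnHalfPow, if_neg (not_lt.mpr h.le), abs_of_neg h, gaussPower]
    have : ((-1 / x : ℝ) : ℂ) = (((-x : ℝ)) : ℂ)⁻¹ := by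
      push_cast
      rw [inv_neg, neg_div, one_div]
    rw [this]
    ring
  · rw [twoSidedFlat, flatPower_of_nonpos _ (show -x ≤ 0 by linarith), key x h, inversionFormula,
      sgnHalfPow, if_pos h, abs_of_pos h, gaussPower]
    have : ((-1 / x : ℝ) : ℂ) = -(x : ℂ)⁻¹ := by
      push_cast
      rw [neg_div, one_div]
    rw [this, neg_pow (x : ℂ)⁻¹ k, neg_sq]
    ring

theorem gaussPower_mem_lineModel (lam : ℂ) (ell : ℤ) (k : ℕ) : gaussPower k ∈ lineModel lam ell :=
  ⟨contDiff_gaussPower k, _, contDiff_twoSidedFlat _ _ _,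
    fun _ hx => inversionFormula_gaussPower lam ell k hx⟩

theorem atInfty_gaussPower (lam : ℂ) (ell : ℤ) (k : ℕ) : atInfty lam ell (gaussPower k) =
    twoSidedFlat (2 * lam + k) ((-1) ^ k) (I ^ ell) :=
  atInfty_eq (contDiff_twoSidedFlat _ _ _).continuous
    fun _ hx => inversionFormula_gaussPower lam ell k hx

theorem atInfty_of_ne_zero (lam : ℂ) (ell : ℤ) (f : ℝ → ℂ) {x : ℝ} (hx : x ≠ 0) :
    atInfty lam ell f x = inversionFormula lam ell f x := if_neg hx

theorem dilate_inversion {lam : ℂ} {ell : ℤ} {f : ℝ → ℂ} {c : ℝ} (hc : 0 < c) {x : ℝ}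
    (hx : x ≠ 0) : (c : ℂ) ^ (-2 * lam) * atInfty lam ell f (c⁻¹ * x) =
      inversionFormula lam ell (fun x => f (c * x)) x := by
  have hci : 0 < c⁻¹ := by positivity
  rw [atInfty_of_ne_zero _ _ _ (mul_ne_zero hci.ne' hx), inversionFormula, inversionFormula]
  have e1 : sgnHalfPow ell (c⁻¹ * x) = sgnHalfPow ell x := by
    unfold sgnHalfPow
    simp [mul_pos_iff_of_pos_left hci]
  have e2 : ((|c⁻¹ * x| : ℝ) : ℂ) ^ (-2 * lam) = ((c : ℂ) ^ (-2 * lam))⁻¹ *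
      ((|x| : ℝ) : ℂ) ^ (-2 * lam) := by
    rw [abs_mul, abs_of_pos hci, Complex.ofReal_mul, Complex.mul_cpow_ofReal_nonneg hci.le
      (abs_nonneg x), Complex.ofReal_inv, Complex.inv_cpow]
    rw [Complex.arg_ofReal_of_nonneg hc.le]
    exact Real.pi_pos.ne
  have e3 : -1 / (c⁻¹ * x) = c * (-1 / x) := by field_simp
  rw [e1, e2, e3]
  linear_combination (sgnHalfPow ell x * ((|x| : ℝ) : ℂ) ^ (-2 * lam) * f (c * (-1 / x))) *
    mul_inv_cancel₀ (cpow_ne_zero_of_pos hc (-2 * lam))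

theorem contDiff_dilate {f : ℝ → ℂ} (hf : ContDiff ℝ ∞ f) (c : ℝ) :
    ContDiff ℝ ∞ fun x => f (c * x) := hf.comp (contDiff_const.mul contDiff_id)

theorem dilate_mem_lineModel {lam : ℂ} {ell : ℤ} {f : ℝ → ℂ} (hf : f ∈ lineModel lam ell) {c : ℝ}
    (hc : 0 < c) : (fun x => f (c * x)) ∈ lineModel lam ell :=
  ⟨contDiff_dilate hf.1 c, fun x => (c : ℂ) ^ (-2 * lam) * atInfty lam ell f (c⁻¹ * x),
    contDiff_const.mul (contDiff_dilate (contDiff_atInfty hf) _),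
    fun _ hx => dilate_inversion hc hx⟩

theorem atInfty_dilate {lam : ℂ} {ell : ℤ} {f : ℝ → ℂ} (hf : f ∈ lineModel lam ell) {c : ℝ}
    (hc : 0 < c) : atInfty lam ell (fun x => f (c * x)) =
      fun x => (c : ℂ) ^ (-2 * lam) * atInfty lam ell f (c⁻¹ * x) :=
  atInfty_eq (contDiff_const.mul (contDiff_dilate (contDiff_atInfty hf) _)).continuous
    fun _ hx => dilate_inversion hc hx

/-- Exactly one of `x` and `-1/x` is negative, so applying the inversion twice yields a single
factor `i^ℓ`. -/
theorem inversion_atInfty {lam : ℂ} {ell : ℤ} {f : ℝ → ℂ} {x : ℝ} (hx : x ≠ 0) :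
    I ^ ell * f x = inversionFormula lam ell (atInfty lam ell f) x := by
  have hx' : -1 / x ≠ 0 := div_ne_zero (by norm_num) hx
  rw [inversionFormula, atInfty_of_ne_zero _ _ _ hx', inversionFormula]
  have e1 : sgnHalfPow ell x * sgnHalfPow ell (-1 / x) = I ^ ell := by
    unfold sgnHalfPow
    rcases lt_or_gt_of_ne hx with h | h
    · rw [if_neg (not_lt.mpr h.le), if_pos (div_pos_of_neg_of_neg (by norm_num) h), mul_one]
    · rw [if_pos h, if_neg (not_lt.mpr (div_nonpos_of_nonpos_of_nonneg (by norm_num) h.le)),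
        one_mul]
  have e2 : ((|x| : ℝ) : ℂ) ^ (-2 * lam) * ((|-1 / x| : ℝ) : ℂ) ^ (-2 * lam) = 1 := by
    rw [← Complex.mul_cpow_ofReal_nonneg (abs_nonneg _) (abs_nonneg _), ← Complex.ofReal_mul,
      ← abs_mul, mul_div_cancel₀ _ hx]
    simp
  have e3 : -1 / (-1 / x) = x := by field_simp
  rw [e3, ← e1]
  linear_combination -(sgnHalfPow ell x * sgnHalfPow ell (-1 / x) * f x) * e2

theorem atInfty_mem_lineModel {lam : ℂ} {ell : ℤ} {f : ℝ → ℂ} (hf : f ∈ lineModel lam ell) :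
    atInfty lam ell f ∈ lineModel lam ell :=
  ⟨contDiff_atInfty hf, fun x => I ^ ell * f x, contDiff_const.mul hf.1,
    fun _ hx => inversion_atInfty hx⟩

theorem atInfty_atInfty {lam : ℂ} {ell : ℤ} {f : ℝ → ℂ} (hf : f ∈ lineModel lam ell) :
    atInfty lam ell (atInfty lam ell f) = fun x => I ^ ell * f x :=
  atInfty_eq (contDiff_const.mul hf.1).continuous fun _ hx => inversion_atInfty hx

/-! ### The summation formula for Gaussians -/

/-- The image of `gaussPower k` under the inversion. -/
def gaussFlat (lam : ℂ) (ell : ℤ) (k : ℕ) : ℝ → ℂ :=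
  twoSidedFlat (2 * lam + k) ((-1) ^ k) (I ^ ell)

/-- The summation formula for dilated Gaussians. -/
def GaussRelation (lam : ℂ) (ell : ℤ) (N : ℕ) (a b : ℤ → ℂ) (c : ℂ) : Prop :=
  ∀ k : ℕ, k ≤ 1 → ∀ t : ℝ, 0 < t →
    t * ∑' n : ℤ, a n * fourier lam (gaussPower k) (n * t) = c * gaussPower k 0 +
      (t : ℂ) ^ (2 * lam - 1) * ∑' n : ℤ, b n * fourier lam (gaussFlat lam ell k) (n * (N * t)⁻¹)

theorem gaussFlat_zero (lam : ℂ) (ell : ℤ) (k : ℕ) : gaussFlat lam ell k 0 = 0 := by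
  simp [gaussFlat, twoSidedFlat, flatPower_of_nonpos]

theorem contDiff_gaussFlat (lam : ℂ) (ell : ℤ) (k : ℕ) : ContDiff ℝ ∞ (gaussFlat lam ell k) :=
  contDiff_twoSidedFlat _ _ _

theorem I_zpow_ne_zero (ell : ℤ) : (I ^ ell : ℂ) ≠ 0 := zpow_ne_zero _ I_ne_zero

theorem atInfty_dilate_gaussPower (lam : ℂ) (ell : ℤ) (k : ℕ) {c : ℝ} (hc : 0 < c) :
    atInfty lam ell (fun x => gaussPower k (c * x)) =
      fun x => (c : ℂ) ^ (-2 * lam) * gaussFlat lam ell k (c⁻¹ * x) := by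
  rw [atInfty_dilate (gaussPower_mem_lineModel lam ell k) hc, atInfty_gaussPower, gaussFlat]

theorem fourier_dilate_gaussFlat (lam : ℂ) (ell : ℤ) (k : ℕ) {c : ℝ} (hc : 0 < c) (y : ℝ) :
    fourier lam (fun x => (c : ℂ) ^ (-2 * lam) * gaussFlat lam ell k (c⁻¹ * x)) y =
      (c : ℂ) ^ (1 - 2 * lam) * fourier lam (gaussFlat lam ell k) (y * c) := by
  have hc0 : (c : ℂ) ≠ 0 := by exact_mod_cast hc.ne'
  rw [fourier_const_mul _ (cpow_ne_zero_of_pos hc _),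
    fourier_comp_mul_left (contDiff_gaussFlat lam ell k) (inv_pos.mpr hc), div_inv_eq_mul,
    show 1 - 2 * lam = -2 * lam + 1 by ring, Complex.cpow_add _ _ hc0, Complex.cpow_one]
  push_cast
  rw [inv_inv]
  ring

/-- The test function is the Gaussian dilated by `1/t`. Its inversion vanishes at `0`, which kills
`α(∞)`, while `f_∞(∞) = i^ℓ f(0)` gives the constant `i^ℓ β(∞)`. -/
theorem gaussRelation_of_summationFormula {lam : ℂ} {ell : ℤ} {N : ℕ} {α β : ℤ → ℂ}
    {αinf βinf : ℂ}
    (hsum : ∀ f ∈ lineModel lam ell, SummationFormula lam ell N α β αinf βinf f) :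
    GaussRelation lam ell N α β (I ^ ell * βinf) := by
  intro k _ t ht
  have hc : 0 < t⁻¹ := by positivity
  have ht0 : (t : ℂ) ≠ 0 := by exact_mod_cast ht.ne'
  have hmem := dilate_mem_lineModel (gaussPower_mem_lineModel lam ell k) hc
  have h := hsum _ hmem
  rw [SummationFormula, atInfty_atInfty hmem, atInfty_dilate_gaussPower lam ell k hc] at h
  simp only [mul_zero, gaussFlat_zero, zero_add, fourier_dilate_gaussFlat lam ell k hc,
    fourier_comp_mul_left (contDiff_gaussPower k) hc] at h
  have e1 : ∀ n : ℤ, α n * ((((t⁻¹ : ℝ)) : ℂ)⁻¹ * fourier lam (gaussPower k) (n / t⁻¹)) =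
      t * (α n * fourier lam (gaussPower k) (n * t)) := fun n => by
    rw [div_inv_eq_mul]; push_cast; rw [inv_inv]; ring
  have e2 : ∀ n : ℤ, β n * (((t⁻¹ : ℝ) : ℂ) ^ (1 - 2 * lam) *
      fourier lam (gaussFlat lam ell k) (n / N * t⁻¹)) =
      (t : ℂ) ^ (2 * lam - 1) * (β n * fourier lam (gaussFlat lam ell k) (n * (N * t)⁻¹)) :=
    fun n => by
      rw [Complex.ofReal_inv, Complex.inv_cpow _ _ (by
        rw [Complex.arg_ofReal_of_nonneg ht.le]; exact Real.pi_pos.ne), ← Complex.cpow_neg,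
        neg_sub, mul_inv, div_eq_mul_inv, mul_assoc ((n : ℤ) : ℝ)]
      ring
  simp only [e1, e2] at h
  rw [tsum_mul_left, tsum_mul_left] at h
  rw [h]
  ring

/-- Here the test function is the inversion of the Gaussian dilated by `1/(Nt)`, so `β` meets the
Gaussian and `α` the flat function. Now `β(∞)` drops out. Dividing by `i^ℓ N` gives the relation,
with the factor `N^(2λ-2)` and the constant `α(∞)/N`. -/
theorem gaussRelation_of_summationFormula_symm {lam : ℂ} {ell : ℤ} {N : ℕ} (hN : 0 < N)
    {α β : ℤ → ℂ} {αinf βinf : ℂ}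
    (hsum : ∀ f ∈ lineModel lam ell, SummationFormula lam ell N α β αinf βinf f) :
    GaussRelation lam ell N β (fun n => I ^ (-ell) * (N : ℂ) ^ (2 * lam - 2) * α n) (αinf / N) := by
  intro k _ t ht
  have hN0 : (0 : ℝ) < N := by exact_mod_cast hN
  have hNc : (N : ℂ) ≠ 0 := by exact_mod_cast hN.ne'
  have ht0 : (t : ℂ) ≠ 0 := by exact_mod_cast ht.ne'
  have hNt : 0 < N * t := by positivity
  have hc : 0 < (N * t)⁻¹ := by positivity
  have hmem := dilate_mem_lineModel (gaussPower_mem_lineModel lam ell k) hc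
  have h := hsum _ (atInfty_mem_lineModel hmem)
  rw [SummationFormula, atInfty_atInfty (atInfty_mem_lineModel hmem), atInfty_atInfty hmem,
    atInfty_dilate_gaussPower lam ell k hc] at h
  simp only [mul_zero, gaussFlat_zero, zero_add, fourier_dilate_gaussFlat lam ell k hc,
    fourier_const_mul _ (I_zpow_ne_zero ell),
    fourier_comp_mul_left (contDiff_gaussPower k) hc] at h
  have e1 : ∀ n : ℤ, β n * (I ^ ell * ((((N * t)⁻¹ : ℝ) : ℂ)⁻¹ *
      fourier lam (gaussPower k) (n / N / (N * t)⁻¹))) =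
      (I ^ ell * (N * t)) * (β n * fourier lam (gaussPower k) (n * t)) := fun n => by
    have : (n : ℝ) / N / (N * t)⁻¹ = n * t := by field_simp
    rw [this]
    push_cast
    rw [inv_inv]
    ring
  have hpow : (N : ℂ) ^ (2 * lam - 2) = (N : ℂ) ^ (2 * lam - 1) * (N : ℂ)⁻¹ := by
    rw [show 2 * lam - 2 = (2 * lam - 1) - 1 by ring, Complex.cpow_sub _ (1 : ℂ) hNc,
      Complex.cpow_one, div_eq_mul_inv]
  have e2 : ∀ n : ℤ, α n * ((((N * t)⁻¹ : ℝ) : ℂ) ^ (1 - 2 * lam) *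
      fourier lam (gaussFlat lam ell k) (n * (N * t)⁻¹)) =
      (I ^ ell * N * (t : ℂ) ^ (2 * lam - 1)) * ((I ^ (-ell) * (N : ℂ) ^ (2 * lam - 2) * α n) *
        fourier lam (gaussFlat lam ell k) (n * (N * t)⁻¹)) :=
    fun n => by
      rw [Complex.ofReal_inv, Complex.inv_cpow _ _ (by
        rw [Complex.arg_ofReal_of_nonneg hNt.le]; exact Real.pi_pos.ne), ← Complex.cpow_neg,
        neg_sub, Complex.ofReal_mul, Complex.mul_cpow_ofReal_nonneg hN0.le ht.le, hpow,
        Complex.ofReal_natCast, zpow_neg]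
      have := I_zpow_ne_zero ell
      generalize (N : ℂ) ^ (2 * lam - 1) = P
      generalize (t : ℂ) ^ (2 * lam - 1) = Q
      field_simp
  simp only [e1, e2] at h
  rw [tsum_mul_left, tsum_mul_left] at h
  have hI := I_zpow_ne_zero ell
  have h2 : (I ^ ell * N : ℂ) ≠ 0 := mul_ne_zero hI hNc
  apply mul_left_cancel₀ h2
  have h3 : I ^ ell * N * (αinf / N * gaussPower k 0) = αinf * (I ^ ell * gaussPower k 0) := by
    field_simp
  linear_combination -h - h3

/-! ### Two-sided theta series -/

theorem PolynomialGrowth.natGrowth_coeff {a : ℤ → ℂ} (ha : PolynomialGrowth a) (ε : ℤˣ) :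
    NatGrowth (coeff a ε) := by
  obtain ⟨C, k, h⟩ := ha
  refine ⟨|C| * 2 ^ k, by positivity, k, fun n hn => ?_⟩
  have h1 := h ((ε : ℤ) * n)
  have hn1 : (1 : ℝ) ≤ n := by exact_mod_cast Nat.one_le_iff_ne_zero.mpr hn
  have h2 : |(((ε : ℤ) * (n : ℤ) : ℤ) : ℝ)| = n := by
    rcases Int.units_eq_one_or ε with h | h <;> subst h <;> simp
  rw [h2] at h1
  refine h1.trans ?_
  rw [mul_assoc, ← mul_pow]
  calc C * (1 + (n : ℝ)) ^ k ≤ |C| * (1 + (n : ℝ)) ^ k := by gcongr; exact le_abs_self C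
    _ ≤ _ := by gcongr; linarith

theorem PolynomialGrowth.const_mul {a : ℤ → ℂ} (ha : PolynomialGrowth a) (c : ℂ) :
    PolynomialGrowth fun n => c * a n := by
  obtain ⟨C, k, h⟩ := ha
  refine ⟨‖c‖ * C, k, fun n => ?_⟩
  rw [norm_mul, mul_assoc]
  exact mul_le_mul_of_nonneg_left (h n) (norm_nonneg c)

/-- The series `∑_{n ≠ 0} a(n) K(nt)`. -/
def signedTheta (a : ℤ → ℂ) (K : ℝ → ℂ) (t : ℝ) : ℂ :=
  thetaSeries (coeff a 1) (fun t => K ((((1 : ℤˣ) : ℤ) : ℝ) * t)) t +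
    thetaSeries (coeff a (-1)) (fun t => K ((((-1 : ℤˣ) : ℤ) : ℝ) * t)) t

theorem rapidDecay_signedTheta {a : ℤ → ℂ} {K : ℝ → ℂ} (ha : PolynomialGrowth a)
    (hK : ∀ ε : ℤˣ, RapidDecay fun t => K (((ε : ℤ) : ℝ) * t)) : RapidDecay (signedTheta a K) :=
  ((hK 1).thetaSeries (ha.natGrowth_coeff 1)).add ((hK (-1)).thetaSeries (ha.natGrowth_coeff (-1)))

theorem tsum_int_eq_signedTheta {a : ℤ → ℂ} {K : ℝ → ℂ} (ha : PolynomialGrowth a)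
    (hK : ∀ ε : ℤˣ, RapidDecay fun t => K (((ε : ℤ) : ℝ) * t)) {t : ℝ} (ht : 0 < t) :
    ∑' n : ℤ, a n * K (n * t) = a 0 * K 0 + signedTheta a K t := by
  have h1 := ((hK 1).summable_thetaSeries (ha.natGrowth_coeff 1) ht).hasSum
  have h2 := ((hK (-1)).summable_thetaSeries (ha.natGrowth_coeff (-1)) ht).hasSum
  have h3 : HasSum (fun n : ℕ => a ((n : ℤ) + 1) * K ((((n : ℤ) + 1 : ℤ) : ℝ) * t))
      (thetaSeries (coeff a 1) (fun t => K ((((1 : ℤˣ) : ℤ) : ℝ) * t)) t) := by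
    refine h1.congr_fun fun n => ?_
    simp [coeff]
  have h4 : HasSum (fun n : ℕ => a (-((n : ℤ) + 1)) * K (((-((n : ℤ) + 1) : ℤ) : ℝ) * t))
      (thetaSeries (coeff a (-1)) (fun t => K ((((-1 : ℤˣ) : ℤ) : ℝ) * t)) t) := by
    refine h2.congr_fun fun n => ?_
    have e : (((-1 : ℤˣ) : ℤ) * ((n + 1 : ℕ) : ℤ)) = -((n : ℤ) + 1) := by simp
    simp only [coeff, e]
    congr 2
    push_cast
    ring
  have h5 := (HasSum.of_add_one_of_neg_add_one (f := fun n : ℤ => a n * K (n * t)) h3 h4).tsum_eq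
  rw [h5, signedTheta]
  simp
  ring

theorem exists_mellin_signedTheta {a : ℤ → ℂ} {K : ℝ → ℂ} (ha : PolynomialGrowth a)
    (hK : ∀ ε : ℤˣ, RapidDecay fun t => K (((ε : ℤ) : ℝ) * t)) :
    ∃ σ : ℝ, ∀ s : ℂ, σ < s.re → (∀ ε : ℤˣ, LSeriesSummable (coeff a ε) s) ∧
      mellin (signedTheta a K) s =
        LSeries (coeff a 1) s * mellin (fun t => K ((((1 : ℤˣ) : ℤ) : ℝ) * t)) s +
        LSeries (coeff a (-1)) s * mellin (fun t => K ((((-1 : ℤˣ) : ℤ) : ℝ) * t)) s := by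
  obtain ⟨σ₁, h₁⟩ := (hK 1).exists_mellin_thetaSeries (ha.natGrowth_coeff 1)
  obtain ⟨σ₂, h₂⟩ := (hK (-1)).exists_mellin_thetaSeries (ha.natGrowth_coeff (-1))
  refine ⟨max σ₁ σ₂, fun s hs => ?_⟩
  have a1 := h₁ s (lt_of_le_of_lt (le_max_left _ _) hs)
  have a2 := h₂ s (lt_of_le_of_lt (le_max_right _ _) hs)
  refine ⟨fun ε => ?_, ?_⟩
  · rcases Int.units_eq_one_or ε with h | h <;> subst h
    exacts [a1.1, a2.1]
  · have := (hasMellin_add a1.2.1 a2.2.1).2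
    rw [a1.2.2, a2.2.2] at this
    exact this

/-! ### Splitting for a pair of theta series -/

/-- The relation can be solved for `K'`, giving one of the same shape in which `s` becomes `k - s`.
The sum of incomplete Mellin transforms is symmetric under this exchange, so the same function
continues both sides; this is the functional equation. -/
theorem exists_mellin_split {K K' : ℝ → ℂ} (hK : RapidDecay K) (hK' : RapidDecay K')
    {k c₀ c₁ c₂ : ℂ}
    (h : ∀ t : ℝ, 0 < t → K t = (t : ℂ) ^ (-k) * K' t⁻¹ +
      (c₁ * (t : ℂ) ^ (-1 : ℂ) + c₂ * (t : ℂ) ^ (-k) + -c₀ * (t : ℂ) ^ (0 : ℂ))) :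
    ∃ E : ℂ → ℂ, Differentiable ℂ E ∧ LogGrowth E ∧ ∃ σ : ℝ,
      (∀ s : ℂ, σ < s.re → mellin K s = E s + c₁ / (s - 1) + c₂ / (s - k) - c₀ / s) ∧
      (∀ s : ℂ, σ < (k - s).re →
        mellin K' (k - s) = E s + c₁ / (s - 1) + c₂ / (s - k) - c₀ / s) := by
  have hd : Differentiable ℂ fun s => upperMellin K s + upperMellin K' (k - s) :=
    hK.differentiable_upperMellin.add
      (hK'.differentiable_upperMellin.comp ((differentiable_const k).sub differentiable_id))
  have hg : LogGrowth fun s => upperMellin K s + upperMellin K' (k - s) := by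
    have h1 := hK'.logGrowth_upperMellin.comp_affine (-1) k
    simp only [neg_one_mul, neg_add_eq_sub] at h1
    exact hK.logGrowth_upperMellin.add h1
  have h' : ∀ t : ℝ, 0 < t → K' t = (t : ℂ) ^ (-k) * K t⁻¹ +
      (-c₁ * (t : ℂ) ^ (1 - k) + -c₂ * (t : ℂ) ^ (0 : ℂ) + c₀ * (t : ℂ) ^ (-k)) := by
    intro t ht
    have ht0 : (t : ℂ) ≠ 0 := by exact_mod_cast ht.ne'
    have h2 := h t⁻¹ (by positivity)
    have e : ∀ z : ℂ, ((t⁻¹ : ℝ) : ℂ) ^ (-z) = (t : ℂ) ^ z := fun z => by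
      rw [Complex.ofReal_inv, Complex.inv_cpow _ _ (by
        rw [Complex.arg_ofReal_of_nonneg ht.le]; exact Real.pi_pos.ne), ← Complex.cpow_neg, neg_neg]
    rw [inv_inv, e, e, Complex.cpow_one, Complex.cpow_zero] at h2
    rw [h2, Complex.cpow_zero, Complex.cpow_sub _ _ ht0, Complex.cpow_one, Complex.cpow_neg]
    have := cpow_ne_zero_of_pos ht k
    field_simp
    ring
  refine ⟨_, hd, hg, max (max 1 |k.re|) (|k.re| + 1), fun s hs => ?_, fun s hs => ?_⟩
  · have b1 : 1 < s.re := lt_of_le_of_lt ((le_max_left _ _).trans (le_max_left _ _)) hs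
    have b2 : |k.re| < s.re := lt_of_le_of_lt ((le_max_right _ _).trans (le_max_left _ _)) hs
    rw [hK.mellin_eq_upperMellin_add hK' h (s := s) (by simp; linarith)
      (by simp; linarith [le_abs_self k.re]) (by simp; linarith)]
    rw [← sub_eq_add_neg, ← sub_eq_add_neg, add_zero]
    ring
  · have b1 : 1 < (k - s).re := lt_of_le_of_lt ((le_max_left _ _).trans (le_max_left _ _)) hs
    have b2 : |k.re| + 1 < (k - s).re := lt_of_le_of_lt (le_max_right _ _) hs
    rw [hK'.mellin_eq_upperMellin_add hK h' (s := k - s)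
      (by simp at b2 ⊢; linarith [le_abs_self k.re]) (by simp at b1 ⊢; linarith)
      (by simp at b2 ⊢; linarith [le_abs_self k.re])]
    rw [show k - (k - s) = s by ring, show k - s + (1 - k) = -(s - 1) by ring,
      show k - s + 0 = -(s - k) by ring, show k - s + -k = -s by ring]
    simp only [div_neg, neg_div, neg_neg]
    ring

/-! ### The Fourier transform of `gaussFlat` -/

theorem two_lam_re_le (lam : ℂ) (k : ℕ) : 2 * lam.re ≤ (2 * lam + k).re := by
  simp

theorem fourier_gaussFlat_sign (lam : ℂ) (ell : ℤ) (k : ℕ) {N : ℕ} (hN : 0 < N) (ε : ℤˣ) {t : ℝ}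
    (ht : 0 < t) :
    fourier lam (gaussFlat lam ell k) (((ε : ℤ) : ℝ) * t * (N : ℝ)⁻¹) =
      (-1) ^ k * flatFourier (2 * lam + k) (fourierOrder lam)
          (((ε : ℤ) : ℝ) * ((N : ℝ)⁻¹ * t)) +
        I ^ ell * flatFourier (2 * lam + k) (fourierOrder lam)
          ((((-ε : ℤˣ) : ℤ) : ℝ) * ((N : ℝ)⁻¹ * t)) := by
  have hN0 : (0 : ℝ) < N := by exact_mod_cast hN
  have hne : ((ε : ℤ) : ℝ) * t * (N : ℝ)⁻¹ ≠ 0 :=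
    mul_ne_zero (sign_mul_ne_zero ε ht.ne') (inv_ne_zero hN0.ne')
  rw [gaussFlat, fourier_twoSidedFlat (two_lam_re_le lam k) hne]
  have e1 : ((ε : ℤ) : ℝ) * t * (N : ℝ)⁻¹ = ((ε : ℤ) : ℝ) * ((N : ℝ)⁻¹ * t) := by ring
  have e2 : -(((ε : ℤ) : ℝ) * t * (N : ℝ)⁻¹) = (((-ε : ℤˣ) : ℤ) : ℝ) * ((N : ℝ)⁻¹ * t) := by
    push_cast; ring
  rw [e2, e1]

theorem one_lt_re_add_fourierOrder (lam : ℂ) (k : ℕ) :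
    1 < (2 * lam + k).re + fourierOrder lam := by
  linarith [fourierOrder_spec lam, two_lam_re_le lam k]

theorem rapidDecay_fourier_gaussFlat (lam : ℂ) (ell : ℤ) (k : ℕ) {N : ℕ} (hN : 0 < N) (ε : ℤˣ) :
    RapidDecay fun t => fourier lam (gaussFlat lam ell k) (((ε : ℤ) : ℝ) * t * (N : ℝ)⁻¹) := by
  have hN0 : (0 : ℝ) < (N : ℝ)⁻¹ := by positivity
  have h := one_lt_re_add_fourierOrder lam k
  exact ((((rapidDecay_flatFourier h ε).comp_mul_left hN0).const_mul _).add
    (((rapidDecay_flatFourier h (-ε)).comp_mul_left hN0).const_mul _)).congr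
      fun t ht => fourier_gaussFlat_sign lam ell k hN ε ht

theorem exists_mellin_fourier_gaussFlat (lam : ℂ) (ell : ℤ) (k : ℕ) {N : ℕ} (hN : 0 < N)
    (ε : ℤˣ) : ∃ σ : ℝ, ∀ w : ℂ, σ < w.re →
      mellin (fun t => fourier lam (gaussFlat lam ell k) (((ε : ℤ) : ℝ) * t * (N : ℝ)⁻¹)) w =
        (N : ℂ) ^ w * ((2 * Real.pi : ℂ) ^ (-w) * Complex.Gamma w *
          (Gammaℝ (2 * lam + k + w - 1) / 2) *
          ((-1) ^ k * cexp ((ε : ℤ) * (Real.pi * w * I / 2)) +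
            I ^ ell * cexp (-((ε : ℤ) * (Real.pi * w * I / 2))))) := by
  have hN0 : (0 : ℝ) < (N : ℝ)⁻¹ := by positivity
  have h := one_lt_re_add_fourierOrder lam k
  obtain ⟨σ₁, h₁⟩ := exists_mellin_flatFourier h ε
  obtain ⟨σ₂, h₂⟩ := exists_mellin_flatFourier h (-ε)
  obtain ⟨σ₃, h₃⟩ := ((rapidDecay_flatFourier h ε).comp_mul_left hN0).exists_mellinConvergent
  obtain ⟨σ₄, h₄⟩ := ((rapidDecay_flatFourier h (-ε)).comp_mul_left hN0).exists_mellinConvergent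
  refine ⟨max (max σ₁ σ₂) (max σ₃ σ₄), fun w hw => ?_⟩
  have a1 := h₁ w (lt_of_le_of_lt ((le_max_left _ _).trans (le_max_left _ _)) hw)
  have a2 := h₂ w (lt_of_le_of_lt ((le_max_right _ _).trans (le_max_left _ _)) hw)
  have a3 := h₃ w (lt_of_le_of_lt ((le_max_left _ _).trans (le_max_right _ _)) hw)
  have a4 := h₄ w (lt_of_le_of_lt ((le_max_right _ _).trans (le_max_right _ _)) hw)
  have b3 := hasMellin_const_smul a3 ((-1 : ℂ) ^ k)
  have b4 := hasMellin_const_smul a4 (I ^ ell : ℂ)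
  have b := (hasMellin_add b3.1 b4.1).2
  rw [b3.2, b4.2, mellin_comp_mul_left (fun t => flatFourier (2 * lam + k) (fourierOrder lam)
    (((ε : ℤ) : ℝ) * t)) w hN0, mellin_comp_mul_left (fun t => flatFourier (2 * lam + k)
    (fourierOrder lam) ((((-ε : ℤˣ) : ℤ) : ℝ) * t)) w hN0, a1, a2] at b
  have hNw : (((N : ℝ)⁻¹ : ℝ) : ℂ) ^ (-w) = (N : ℂ) ^ w := by
    rw [Complex.ofReal_inv, Complex.inv_cpow _ _ (by
      rw [Complex.arg_ofReal_of_nonneg (by positivity)]; exact Real.pi_pos.ne),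
      ← Complex.cpow_neg, neg_neg, Complex.ofReal_natCast]
  rw [hNw] at b
  have e : mellin (fun t => fourier lam (gaussFlat lam ell k) (((ε : ℤ) : ℝ) * t * (N : ℝ)⁻¹)) w =
      mellin (fun t => (-1 : ℂ) ^ k • flatFourier (2 * lam + k) (fourierOrder lam)
          (((ε : ℤ) : ℝ) * ((N : ℝ)⁻¹ * t)) +
        (I ^ ell : ℂ) • flatFourier (2 * lam + k) (fourierOrder lam)
          ((((-ε : ℤˣ) : ℤ) : ℝ) * ((N : ℝ)⁻¹ * t))) w := by
    rw [mellin, mellin]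
    refine setIntegral_congr_fun measurableSet_Ioi fun t ht => ?_
    simp only [fourier_gaussFlat_sign lam ell k hN ε ht, smul_eq_mul]
  rw [e, b]
  simp only [smul_eq_mul, Units.val_neg, Int.cast_neg, neg_mul]
  ring

/-! ### Continuation of the even and odd parts -/

/-- The split is applied with exponent `2 - 2λ` to the theta series without their `n = 0` terms;
those terms become the polar parts at `2 - 2λ` and `0`. The two Mellin transforms are then replaced
by their Gamma factors times Dirichlet series. -/
theorem exists_parity_mellin {lam : ℂ} {ell : ℤ} {N : ℕ} (hN : 0 < N) {a b : ℤ → ℂ} {c : ℂ}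
    (ha : PolynomialGrowth a) (hb : PolynomialGrowth b) (H : GaussRelation lam ell N a b c)
    {k : ℕ} (hk : k ≤ 1) :
    ∃ E : ℂ → ℂ, Differentiable ℂ E ∧ LogGrowth E ∧ ∃ σ : ℝ,
      (∀ s : ℂ, σ < s.re → 0 < s.re ∧ (∀ ε : ℤˣ, LSeriesSummable (coeff a ε) s) ∧
        I ^ k * (Gammaℝ (s + k) / 2) *
          (LSeries (coeff a 1) s + (-1) ^ k * LSeries (coeff a (-1)) s) =
        E s + c * gaussPower k 0 / (s - 1) +
          b 0 * fourier lam (gaussFlat lam ell k) 0 / (s - (2 - 2 * lam)) -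
          a 0 * fourier lam (gaussPower k) 0 / s) ∧
      (∀ s w : ℂ, w = 2 - 2 * lam - s → σ < w.re →
        (N : ℂ) ^ w * ((2 * Real.pi : ℂ) ^ (-w) * Complex.Gamma w * (Gammaℝ (1 + k - s) / 2) *
          (LSeries (coeff b 1) w * ((-1) ^ k * cexp (Real.pi * w * I / 2) +
            I ^ ell * cexp (-(Real.pi * w * I / 2))) +
          LSeries (coeff b (-1)) w * ((-1) ^ k * cexp (-(Real.pi * w * I / 2)) +
            I ^ ell * cexp (Real.pi * w * I / 2)))) =
        E s + c * gaussPower k 0 / (s - 1) +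
          b 0 * fourier lam (gaussFlat lam ell k) 0 / (s - (2 - 2 * lam)) -
          a 0 * fourier lam (gaussPower k) 0 / s) := by
  set G : ℝ → ℂ := fourier lam (gaussPower k) with hG
  set F : ℝ → ℂ := fun y => fourier lam (gaussFlat lam ell k) (y * (N : ℝ)⁻¹) with hF
  have hGd : ∀ ε : ℤˣ, RapidDecay fun t => G (((ε : ℤ) : ℝ) * t) :=
    fun ε => rapidDecay_fourier_gaussPower lam hk ε
  have hFd : ∀ ε : ℤˣ, RapidDecay fun t => F (((ε : ℤ) : ℝ) * t) :=
    fun ε => rapidDecay_fourier_gaussFlat lam ell k hN ε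
  have hF0 : F 0 = fourier lam (gaussFlat lam ell k) 0 := by simp [hF]
  have hrel : ∀ t : ℝ, 0 < t → signedTheta a G t =
      (t : ℂ) ^ (-(2 - 2 * lam)) * signedTheta b F t⁻¹ +
      (c * gaussPower k 0 * (t : ℂ) ^ (-1 : ℂ) + b 0 * F 0 * (t : ℂ) ^ (-(2 - 2 * lam)) +
        -(a 0 * G 0) * (t : ℂ) ^ (0 : ℂ)) := by
    intro t ht
    have ht0 : (t : ℂ) ≠ 0 := by exact_mod_cast ht.ne'
    have h1 := H k hk t ht
    have h2 : ∀ n : ℤ, b n * fourier lam (gaussFlat lam ell k) (n * (N * t)⁻¹) =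
        b n * F (n * t⁻¹) := fun n => by
      simp only [hF]
      congr 2
      rw [mul_inv]
      ring
    simp only [h2] at h1
    rw [tsum_int_eq_signedTheta ha hGd ht, tsum_int_eq_signedTheta hb hFd (inv_pos.mpr ht)] at h1
    rw [show -(2 - 2 * lam) = (2 * lam - 1) - 1 by ring, Complex.cpow_sub _ (1 : ℂ) ht0,
      Complex.cpow_neg, Complex.cpow_one, Complex.cpow_zero]
    generalize (t : ℂ) ^ (2 * lam - 1) = P at *
    generalize signedTheta b F t⁻¹ = Q at *
    field_simp
    linear_combination h1
  obtain ⟨E, hE, hE', σ₀, e1, e2⟩ := exists_mellin_split (rapidDecay_signedTheta ha hGd)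
    (rapidDecay_signedTheta hb hFd) hrel
  obtain ⟨σ₁, f1⟩ := exists_mellin_signedTheta ha hGd
  obtain ⟨σ₂, f2⟩ := exists_mellin_signedTheta hb hFd
  obtain ⟨σ₃, f3⟩ := exists_mellin_fourier_gaussFlat lam ell k hN 1
  obtain ⟨σ₄, f4⟩ := exists_mellin_fourier_gaussFlat lam ell k hN (-1)
  set σ := max 0 (max (max σ₀ σ₁) (max σ₂ (max σ₃ σ₄))) with hσ
  have g : 0 ≤ σ ∧ σ₀ ≤ σ ∧ σ₁ ≤ σ ∧ σ₂ ≤ σ ∧ σ₃ ≤ σ ∧ σ₄ ≤ σ := by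
    simp [hσ]
  obtain ⟨g5, g0, g1, g2, g3, g4⟩ := g
  refine ⟨E, hE, hE', σ, fun s hs => ?_, fun s w hw hs => ?_⟩
  · have hs0 : 0 < s.re := by linarith
    have q1 := e1 s (by linarith)
    have q2 := f1 s (by linarith)
    rw [q2.2, mellin_fourier_gaussPower lam hk 1 hs0,
      mellin_fourier_gaussPower lam hk (-1) hs0, hF0] at q1
    refine ⟨hs0, q2.1, ?_⟩
    rw [← q1]
    simp only [Units.val_neg, Units.val_one, Int.cast_neg, Int.cast_one, one_mul]
    rw [mul_pow (-1 : ℂ) I k]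
    ring
  · have q1 := e2 s (by rw [← hw]; linarith)
    rw [← hw] at q1
    have q2 := (f2 w (by linarith)).2
    have q3 := f3 w (by linarith)
    have q4 := f4 w (by linarith)
    rw [q2, hF0] at q1
    simp only [hF] at q1
    rw [q3, q4] at q1
    rw [← q1, show 2 * lam + k + w - 1 = 1 + k - s by rw [hw]; ring]
    simp only [Units.val_neg, Units.val_one, Int.cast_neg, Int.cast_one, one_mul, neg_mul, neg_neg]
    ring

/-! ### Functions with two simple poles -/

theorem hasSimpleResidueAt_of_eq {F A B : ℂ → ℂ} {c : ℂ} (hA : AnalyticAt ℂ A c)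
    (hB : AnalyticAt ℂ B c) (h : ∀ᶠ s in 𝓝[≠] c, F s = A s / (s - c) + B s) :
    HasSimpleResidueAt F c (A c) := by
  have hg : AnalyticAt ℂ (fun s => A s + (s - c) * B s) c :=
    hA.add ((analyticAt_id.sub analyticAt_const).mul hB)
  have hid : MeromorphicAt (fun s : ℂ => s - c) c := (analyticAt_id.sub analyticAt_const).meromorphicAt
  have h0 : ∀ᶠ s in 𝓝[≠] c, s - c ≠ 0 := by
    filter_upwards [self_mem_nhdsWithin] with s hs using sub_ne_zero.mpr hs
  have h1 : F =ᶠ[𝓝[≠] c] (fun s : ℂ => (s - c)⁻¹) * fun s => A s + (s - c) * B s := by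
    filter_upwards [h, h0] with s hs hs0
    rw [hs, Pi.mul_apply]
    field_simp
  have hinv : MeromorphicAt (fun s : ℂ => (s - c)⁻¹) c := hid.inv
  refine ⟨(hinv.mul hg.meromorphicAt).congr h1.symm, ?_, ?_⟩
  · rw [meromorphicOrderAt_congr h1, meromorphicOrderAt_mul hinv hg.meromorphicAt]
    have e : meromorphicOrderAt (fun s : ℂ => (s - c)⁻¹) c = (-1 : ℤ) := by
      rw [meromorphicOrderAt_eq_int_iff hinv]
      exact ⟨fun _ => 1, analyticAt_const, one_ne_zero, Eventually.of_forall fun s => by simp⟩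
    rw [e]
    calc (-1 : WithTop ℤ) = ((-1 : ℤ) : WithTop ℤ) + 0 := by simp
      _ ≤ _ := add_le_add le_rfl hg.meromorphicOrderAt_nonneg
  · have h2 : Tendsto (fun s => A s + (s - c) * B s) (𝓝[≠] c) (𝓝 (A c)) := by
      have := hg.continuousAt.tendsto
      simp only [sub_self, zero_mul, add_zero] at this
      exact this.mono_left nhdsWithin_le_nhds
    refine h2.congr' ?_
    filter_upwards [h, h0] with s hs hs0
    rw [hs]
    field_simp

/-- `F` is an entire function of logarithmic growth divided by `(s - p) (s - q)`, with simple poles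
of residue `x` at `p` and `y` at `q`. -/
def HasTwoPoles (p q x y : ℂ) (F : ℂ → ℂ) : Prop :=
  ∃ R P Q : ℂ → ℂ, (Differentiable ℂ R ∧ LogGrowth R) ∧ (Differentiable ℂ P ∧ LogGrowth P) ∧
    (Differentiable ℂ Q ∧ LogGrowth Q) ∧ P p = x ∧ Q q = y ∧
    ∀ s, F s = R s + P s / (s - p) + Q s / (s - q)

variable {p q x y x' y' : ℂ} {F G : ℂ → ℂ}

theorem HasTwoPoles.add (hF : HasTwoPoles p q x y F) (hG : HasTwoPoles p q x' y' G) :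
    HasTwoPoles p q (x + x') (y + y') fun s => F s + G s := by
  obtain ⟨R, P, Q, hR, hP, hQ, h1, h2, h⟩ := hF
  obtain ⟨R', P', Q', hR', hP', hQ', h1', h2', h'⟩ := hG
  refine ⟨fun s => R s + R' s, fun s => P s + P' s, fun s => Q s + Q' s,
    ⟨hR.1.add hR'.1, hR.2.add hR'.2⟩, ⟨hP.1.add hP'.1, hP.2.add hP'.2⟩,
    ⟨hQ.1.add hQ'.1, hQ.2.add hQ'.2⟩, by simp only [h1, h1'], by simp only [h2, h2'], fun s => ?_⟩
  simp only [h, h']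
  ring

theorem HasTwoPoles.const_mul (hF : HasTwoPoles p q x y F) (c : ℂ) :
    HasTwoPoles p q (c * x) (c * y) fun s => c * F s := by
  obtain ⟨R, P, Q, hR, hP, hQ, h1, h2, h⟩ := hF
  refine ⟨fun s => c * R s, fun s => c * P s, fun s => c * Q s,
    ⟨hR.1.const_mul c, hR.2.const_mul c⟩, ⟨hP.1.const_mul c, hP.2.const_mul c⟩,
    ⟨hQ.1.const_mul c, hQ.2.const_mul c⟩, by simp only [h1], by simp only [h2], fun s => ?_⟩
  simp only [h]
  ring

theorem HasTwoPoles.symm (hF : HasTwoPoles p q x y F) : HasTwoPoles q p y x F := by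
  obtain ⟨R, P, Q, hR, hP, hQ, h1, h2, h⟩ := hF
  exact ⟨R, Q, P, hR, hQ, hP, h2, h1, fun s => by rw [h, add_right_comm]⟩

theorem HasTwoPoles.analyticAt (hF : HasTwoPoles p q x y F) {s : ℂ} (hp : s ≠ p) (hq : s ≠ q) :
    AnalyticAt ℂ F s := by
  obtain ⟨R, P, Q, hR, hP, hQ, h1, h2, h⟩ := hF
  rw [funext h]
  exact ((hR.1.analyticAt s).add ((hP.1.analyticAt s).div (analyticAt_id.sub analyticAt_const)
    (sub_ne_zero.mpr hp))).add ((hQ.1.analyticAt s).div (analyticAt_id.sub analyticAt_const)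
    (sub_ne_zero.mpr hq))

theorem HasTwoPoles.hasSimpleResidueAt (hF : HasTwoPoles p q x y F) (hpq : p ≠ q) :
    HasSimpleResidueAt F p x := by
  obtain ⟨R, P, Q, hR, hP, hQ, h1, h2, h⟩ := hF
  rw [← h1]
  refine hasSimpleResidueAt_of_eq (B := fun s => R s + Q s / (s - q)) (hP.1.analyticAt p)
    ((hR.1.analyticAt p).add ((hQ.1.analyticAt p).div (analyticAt_id.sub analyticAt_const)
      (sub_ne_zero.mpr hpq))) (Eventually.of_forall fun s => ?_)
  rw [h]
  ring

theorem HasTwoPoles.meromorphic (hF : HasTwoPoles p q x y F) : Meromorphic F := by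
  obtain ⟨R, P, Q, hR, hP, hQ, h1, h2, h⟩ := hF
  rw [funext h]
  intro s
  have hid (c : ℂ) : MeromorphicAt (fun s : ℂ => s - c) s :=
    (analyticAt_id.sub analyticAt_const).meromorphicAt
  exact ((hR.1.analyticAt s).meromorphicAt.add ((hP.1.analyticAt s).meromorphicAt.div (hid p))).add
    ((hQ.1.analyticAt s).meromorphicAt.div (hid q))

theorem logGrowth_sub_const (c : ℂ) : LogGrowth fun s => s - c := by
  simpa only [sub_eq_add_neg] using logGrowth_id.add (logGrowth_const (-c))

theorem HasTwoPoles.exists_entire (hF : HasTwoPoles p q x y F) :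
    ∃ g : ℂ → ℂ, EntireOfOrderAtMost 1 g ∧
      ∀ s, s ≠ p → s ≠ q → g s = (s - p) * (s - q) * F s := by
  obtain ⟨R, P, Q, hR, hP, hQ, h1, h2, h⟩ := hF
  have hp := logGrowth_sub_const p
  have hq := logGrowth_sub_const q
  have dp : Differentiable ℂ fun s : ℂ => s - p := differentiable_id.sub_const p
  have dq : Differentiable ℂ fun s : ℂ => s - q := differentiable_id.sub_const q
  refine ⟨fun s => (s - p) * (s - q) * R s + (s - q) * P s + (s - p) * Q s,
    LogGrowth.entireOfOrderAtMost_one ((((hp.mul hq).mul hR.2).add (hq.mul hP.2)).add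
      (hp.mul hQ.2)) ((((dp.mul dq).mul hR.1).add (dq.mul hP.1)).add (dp.mul hQ.1)),
    fun s hsp hsq => ?_⟩
  have := sub_ne_zero.mpr hsp
  have := sub_ne_zero.mpr hsq
  rw [h]
  field_simp

/-! ### Continuation of the even and odd Dirichlet series -/

theorem differentiable_inv_GammaR_add (b : ℂ) : Differentiable ℂ fun s => (Gammaℝ (s + b))⁻¹ :=
  differentiable_Gammaℝ_inv.comp (differentiable_id.add_const b)

theorem GammaR_add_ne_zero {s : ℂ} (hs : ∀ n : ℕ, s ≠ -(n : ℂ)) (k : ℕ) : Gammaℝ (s + k) ≠ 0 := by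
  rw [Ne, Gammaℝ_eq_zero_iff]
  rintro ⟨n, hn⟩
  refine hs (2 * n + k) ?_
  push_cast
  linear_combination hn

theorem ne_neg_natCast_of_re_pos {s : ℂ} (hs : 0 < s.re) (n : ℕ) : s ≠ -(n : ℂ) := by
  rintro rfl
  simp only [Complex.neg_re, Complex.natCast_re] at hs
  have : (0 : ℝ) ≤ n := by positivity
  linarith

theorem exists_parity_continuation {lam : ℂ} {ell : ℤ} {N : ℕ} (hN : 0 < N) {a b : ℤ → ℂ} {c : ℂ}
    (ha : PolynomialGrowth a) (hb : PolynomialGrowth b) (H : GaussRelation lam ell N a b c)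
    {k : ℕ} (hk : k ≤ 1) :
    ∃ ξ : ℂ → ℂ,
      HasTwoPoles 1 (2 - 2 * lam) (2 * (I ^ k)⁻¹ * (Gammaℝ (1 + k))⁻¹ * (c * gaussPower k 0))
        (2 * (I ^ k)⁻¹ * (Gammaℝ (2 - 2 * lam + k))⁻¹ *
          (b 0 * fourier lam (gaussFlat lam ell k) 0)) ξ ∧
      ∃ σ : ℝ,
        (∀ s : ℂ, σ < s.re → (∀ ε : ℤˣ, LSeriesSummable (coeff a ε) s) ∧
          ξ s = LSeries (coeff a 1) s + (-1) ^ k * LSeries (coeff a (-1)) s) ∧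
        (∀ s w : ℂ, w = 2 - 2 * lam - s → σ < w.re → (∀ n : ℕ, s ≠ -(n : ℂ)) →
          I ^ k * Gammaℝ (s + k) * ξ s =
          (N : ℂ) ^ w * ((2 * Real.pi : ℂ) ^ (-w) * Complex.Gamma w * Gammaℝ (1 + k - s) *
          (LSeries (coeff b 1) w * ((-1) ^ k * cexp (Real.pi * w * I / 2) +
            I ^ ell * cexp (-(Real.pi * w * I / 2))) +
          LSeries (coeff b (-1)) w * ((-1) ^ k * cexp (-(Real.pi * w * I / 2)) +
            I ^ ell * cexp (Real.pi * w * I / 2))))) := by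
  obtain ⟨E, hE, hE', σ, h1, h2⟩ := exists_parity_mellin hN ha hb H hk
  set x := c * gaussPower k 0
  set y := b 0 * fourier lam (gaussFlat lam ell k) 0
  set d := a 0 * fourier lam (gaussPower k) 0 with hd
  have hI : I ^ k ≠ 0 := pow_ne_zero k I_ne_zero
  have hpi : (Real.pi : ℂ) ≠ 0 := by exact_mod_cast Real.pi_ne_zero
  have hG := differentiable_inv_GammaR_add k
  have hG' := logGrowth_inv_GammaR k
  -- The entire part, divided by `Gammaℝ (s + k)`, with the polar term at `0` absorbed as a multiple
  -- of `1 / Gammaℝ (s + 2)`. The numerators at the other two poles are entire functions whose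
  -- values there are the residues.
  set ξ : ℂ → ℂ := fun s => (2 * (I ^ k)⁻¹ * (Gammaℝ (s + k))⁻¹ * E s +
      -(d / Real.pi) * (Gammaℝ (s + 2))⁻¹) +
    2 * (I ^ k)⁻¹ * (Gammaℝ (s + k))⁻¹ * x / (s - 1) +
    2 * (I ^ k)⁻¹ * (Gammaℝ (s + k))⁻¹ * y / (s - (2 - 2 * lam)) with hξ
  have key : ∀ s : ℂ, (∀ n : ℕ, s ≠ -(n : ℂ)) → I ^ k * (Gammaℝ (s + k) / 2) * ξ s =
      E s + x / (s - 1) + y / (s - (2 - 2 * lam)) - d / s := by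
    intro s hs
    have g1 := GammaR_add_ne_zero hs k
    have hs0 : s ≠ 0 := by simpa using hs 0
    -- For `k = 0`, `Gammaℝ (s + 2) = Gammaℝ s * s / (2π)`, so the pole at `0` is cancelled by the
    -- zero of `1 / Gammaℝ`. For `k = 1` there is no such zero, but the odd Gaussian has transform
    -- `0` at the origin, so `d = 0`.
    have g3 : I ^ k * (Gammaℝ (s + k) / 2) * (-(d / Real.pi) * (Gammaℝ (s + 2))⁻¹) = -(d / s) := by
      obtain rfl | rfl : k = 0 ∨ k = 1 := by omega
      · have g0 : Gammaℝ s ≠ 0 := by simpa using g1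
        rw [Gammaℝ_add_two hs0]
        simp only [Nat.cast_zero, add_zero, pow_zero]
        field_simp
      · have hd0 : d = 0 := by rw [hd, fourier_gaussPower_one_zero, mul_zero]
        simp [hd0]
    rw [hξ]
    simp only [mul_add]
    rw [g3]
    field_simp
    ring
  refine ⟨ξ, ⟨_, _, _, ⟨?_, ?_⟩, ⟨?_, ?_⟩, ⟨?_, ?_⟩, ?_, ?_, fun s => rfl⟩, σ, fun s hs => ?_,
    fun s w hw hs hn => ?_⟩
  · exact ((hG.const_mul _).mul hE).add ((differentiable_inv_GammaR_add 2).const_mul _)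
  · exact ((hG'.const_mul _).mul hE').add ((logGrowth_inv_GammaR 2).const_mul _)
  · exact (hG.const_mul _).mul_const x
  · exact (hG'.const_mul _).mul (logGrowth_const x)
  · exact (hG.const_mul _).mul_const y
  · exact (hG'.const_mul _).mul (logGrowth_const y)
  · rfl
  · rfl
  · obtain ⟨q1, q2, q3⟩ := h1 s hs
    refine ⟨q2, ?_⟩
    have hn := ne_neg_natCast_of_re_pos q1
    have g1 := GammaR_add_ne_zero hn k
    rw [← key s hn] at q3
    exact (mul_left_cancel₀ (mul_ne_zero hI (div_ne_zero g1 two_ne_zero)) q3).symm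
  · have q := h2 s w hw hs
    rw [← key s hn] at q
    linear_combination -2 * q

/-! ### Residues -/

/-- The reflection formulas at `2λ - 1` turn the quotients of `Gammaℝ` into `Gammaℂ (2λ - 1)` times
a sine (even part) or a cosine (odd part), and Euler's formula recombines them. The hypothesis on
`λ` says exactly that `2λ - 1` is not a pole of `Γ`. -/
theorem residue_parity {lam : ℂ} (hlam : ∀ k : ℕ, lam ≠ 1 / 2 - (k : ℂ) / 2) (ell : ℤ) (ε : ℤˣ) :
    (1 / 2 : ℂ) * (2 * (Gammaℝ (2 - 2 * lam))⁻¹ * ((1 + I ^ ell) * (Gammaℝ (2 * lam - 1) / 2))) +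
      ((ε : ℤ) : ℂ) / 2 * (2 * I⁻¹ * (Gammaℝ (2 - 2 * lam + 1))⁻¹ *
        ((-1 + I ^ ell) * (Gammaℝ (2 * lam) / 2))) =
    ((ε : ℤ) : ℂ) * I * (2 * Real.pi : ℂ) ^ (-(2 * lam - 1)) *
      Complex.Gamma (2 * lam - 1) *
      (I ^ ell * cexp (-(((ε : ℤ) : ℂ) * lam * Real.pi * I)) -
        cexp (((ε : ℤ) : ℂ) * lam * Real.pi * I)) := by
  have hn : ∀ n : ℕ, 2 * lam - 1 ≠ -(n : ℂ) := fun n h => hlam n (by linear_combination h / 2)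
  have g1 : Gammaℝ (2 * lam) ≠ 0 := by
    have := GammaR_add_ne_zero hn 1
    rwa [Nat.cast_one, sub_add_cancel] at this
  have g0 : Gammaℝ (2 * lam - 1) ≠ 0 := by simpa using GammaR_add_ne_zero hn 0
  have e1 := inv_Gammaℝ_one_sub hn
  have e2 := inv_Gammaℝ_two_sub hn
  rw [show 1 - (2 * lam - 1) = 2 - 2 * lam by ring] at e1
  rw [show 2 - (2 * lam - 1) = 2 - 2 * lam + 1 by ring, sub_add_cancel] at e2
  have c1 : Complex.cos (Real.pi * (2 * lam - 1) / 2) = Complex.sin (lam * Real.pi) := by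
    rw [← Complex.cos_sub_pi_div_two]; congr 1; ring
  have c2 : Complex.sin (Real.pi * (2 * lam - 1) / 2) = -Complex.cos (lam * Real.pi) := by
    rw [← Complex.sin_sub_pi_div_two]; congr 1; ring
  rw [e1, e2, c1, c2, Gammaℂ_def, Complex.inv_I]
  generalize (2 * Real.pi : ℂ) ^ (-(2 * lam - 1)) = X
  generalize Complex.Gamma (2 * lam - 1) = Y
  have x1 : cexp (lam * Real.pi * I) =
      Complex.cos (lam * Real.pi) + Complex.sin (lam * Real.pi) * I := Complex.exp_mul_I _
  have x2 : cexp (-(lam * Real.pi * I)) =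
      Complex.cos (lam * Real.pi) - Complex.sin (lam * Real.pi) * I := by
    rw [← neg_mul, Complex.exp_mul_I, Complex.cos_neg, Complex.sin_neg]
    ring
  rcases Int.units_eq_one_or ε with h | h <;> subst h <;>
    simp only [Units.val_neg, Units.val_one, Int.cast_neg, Int.cast_one, one_mul, neg_mul, neg_neg,
      x1, x2] <;> field_simp
  · linear_combination X * Y * Complex.sin (lam * Real.pi) * (1 + I ^ ell) * I_sq
  · linear_combination X * Y * Complex.sin (lam * Real.pi) * (1 + I ^ ell) * I_sq

/-! ### Continuation of the Dirichlet series -/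

theorem exists_continuation {lam : ℂ} {ell : ℤ} {N : ℕ} (hN : 0 < N)
    (hlam : ∀ k : ℕ, lam ≠ 1 / 2 - (k : ℂ) / 2) {a b : ℤ → ℂ} {c : ℂ}
    (ha : PolynomialGrowth a) (hb : PolynomialGrowth b) (H : GaussRelation lam ell N a b c) :
    ∃ ξ : ℤˣ → ℂ → ℂ,
      (∀ ε : ℤˣ, HasTwoPoles 1 (2 - 2 * lam) c
        (((ε : ℤ) : ℂ) * I * (2 * Real.pi : ℂ) ^ (-(2 * lam - 1)) * Complex.Gamma (2 * lam - 1) *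
          (I ^ ell * cexp (-(((ε : ℤ) : ℂ) * lam * Real.pi * I)) -
            cexp (((ε : ℤ) : ℂ) * lam * Real.pi * I)) * b 0) (ξ ε)) ∧
      ∃ σ : ℝ,
        (∀ s : ℂ, σ < s.re → ∀ ε : ℤˣ, LSeriesSummable (coeff a ε) s ∧
          ξ ε s = LSeries (coeff a ε) s) ∧
        (∀ s w : ℂ, w = 2 - 2 * lam - s → σ < w.re → (∀ n : ℕ, s ≠ -(n : ℂ)) → ∀ k : ℕ, k ≤ 1 →
          I ^ k * Gammaℝ (s + k) * (ξ 1 s + (-1) ^ k * ξ (-1) s) =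
          (N : ℂ) ^ w * ((2 * Real.pi : ℂ) ^ (-w) * Complex.Gamma w * Gammaℝ (1 + k - s) *
          (LSeries (coeff b 1) w * ((-1) ^ k * cexp (Real.pi * w * I / 2) +
            I ^ ell * cexp (-(Real.pi * w * I / 2))) +
          LSeries (coeff b (-1)) w * ((-1) ^ k * cexp (-(Real.pi * w * I / 2)) +
            I ^ ell * cexp (Real.pi * w * I / 2))))) := by
  obtain ⟨ξ₀, r₀, σ₀, h₀, f₀⟩ := exists_parity_continuation hN ha hb H zero_le_one
  obtain ⟨ξ₁, r₁, σ₁, h₁, f₁⟩ := exists_parity_continuation hN ha hb H le_rfl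
  -- Half the sum or half the difference of the even and odd parts. The odd one contributes nothing
  -- at `s = 1`, because the odd Gaussian vanishes at `0`.
  refine ⟨fun ε s => 1 / 2 * ξ₀ s + ((ε : ℤ) : ℂ) / 2 * ξ₁ s, fun ε => ?_, max σ₀ σ₁,
    fun s hs ε => ?_, fun s w hw hs hn k hk => ?_⟩
  · have h := (r₀.const_mul (1 / 2)).add (r₁.const_mul (((ε : ℤ) : ℂ) / 2))
    convert h using 1
    · simp [gaussPower]
    · rw [← residue_parity hlam, gaussFlat, gaussFlat, fourier_twoSidedFlat_zero (two_lam_re_le lam 0),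
        fourier_twoSidedFlat_zero (two_lam_re_le lam 1)]
      simp only [Nat.cast_zero, add_zero, pow_zero, Nat.cast_one, pow_one, add_sub_cancel_right,
        inv_one, mul_one]
      ring
  · obtain ⟨p, q⟩ := h₀ s (lt_of_le_of_lt (le_max_left _ _) hs)
    obtain ⟨-, q'⟩ := h₁ s (lt_of_le_of_lt (le_max_right _ _) hs)
    refine ⟨p ε, ?_⟩
    simp only [q, q']
    rcases Int.units_eq_one_or ε with h | h <;> subst h <;> simp <;> ring
  · obtain rfl | rfl : k = 0 ∨ k = 1 := by omega
    · rw [← f₀ s w hw (lt_of_le_of_lt (le_max_left _ _) hs) hn]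
      congr 1
      simp only [Units.val_neg, Units.val_one, Int.cast_neg, Int.cast_one]
      ring
    · rw [← f₁ s w hw (lt_of_le_of_lt (le_max_right _ _) hs) hn]
      congr 1
      simp only [Units.val_neg, Units.val_one, Int.cast_neg, Int.cast_one]
      ring

/-! ### The functional equation -/

/-- By reflection the even relation carries `cos (πs/2)` and the odd one `i sin (πs/2)`. Their half
sum and half difference rebuild `e^(±πis/2)` on the left and isolate the terms with and without `L`
on the right. `Re s < 1` allows cancelling `Gammaℝ (1 - s)` and `Gammaℝ (2 - s)`. -/
theorem functional_equation_of_parity {s w ν p m P M L : ℂ} (hs : ∀ n : ℕ, s ≠ -(n : ℂ))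
    (hs1 : s.re < 1)
    (h₀ : Gammaℝ s * (p + m) = ν * ((2 * Real.pi : ℂ) ^ (-w) * Complex.Gamma w * Gammaℝ (1 - s) *
      (P * (cexp (Real.pi * w * I / 2) + L * cexp (-(Real.pi * w * I / 2))) +
        M * (cexp (-(Real.pi * w * I / 2)) + L * cexp (Real.pi * w * I / 2)))))
    (h₁ : I * Gammaℝ (s + 1) * (p - m) = ν * ((2 * Real.pi : ℂ) ^ (-w) * Complex.Gamma w *
      Gammaℝ (2 - s) *
      (P * (-cexp (Real.pi * w * I / 2) + L * cexp (-(Real.pi * w * I / 2))) +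
        M * (-cexp (-(Real.pi * w * I / 2)) + L * cexp (Real.pi * w * I / 2))))) :
    cexp (Real.pi * s * I / 2) * ((2 * Real.pi : ℂ) ^ (-s) * Complex.Gamma s * p) +
        cexp (-(Real.pi * s * I / 2)) * ((2 * Real.pi : ℂ) ^ (-s) * Complex.Gamma s * m) =
      ν * (L * (cexp (-(Real.pi * w * I / 2)) * ((2 * Real.pi : ℂ) ^ (-w) * Complex.Gamma w * P) +
        cexp (Real.pi * w * I / 2) * ((2 * Real.pi : ℂ) ^ (-w) * Complex.Gamma w * M))) ∧
    cexp (-(Real.pi * s * I / 2)) * ((2 * Real.pi : ℂ) ^ (-s) * Complex.Gamma s * p) +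
        cexp (Real.pi * s * I / 2) * ((2 * Real.pi : ℂ) ^ (-s) * Complex.Gamma s * m) =
      ν * (cexp (Real.pi * w * I / 2) * ((2 * Real.pi : ℂ) ^ (-w) * Complex.Gamma w * P) +
        cexp (-(Real.pi * w * I / 2)) * ((2 * Real.pi : ℂ) ^ (-w) * Complex.Gamma w * M)) := by
  have g0 : Gammaℝ s ≠ 0 := by simpa using GammaR_add_ne_zero hs 0
  have g1 : Gammaℝ (s + 1) ≠ 0 := by simpa using GammaR_add_ne_zero hs 1
  have g2 : Gammaℝ (1 - s) ≠ 0 := Gammaℝ_ne_zero_of_re_pos (by simp; linarith)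
  have g3 : Gammaℝ (2 - s) ≠ 0 := Gammaℝ_ne_zero_of_re_pos (by simp; linarith)
  have e1 : Gammaℝ s = Gammaℝ (1 - s) * (Gammaℂ s * Complex.cos (Real.pi * s / 2)) := by
    have := inv_Gammaℝ_one_sub hs
    field_simp at this ⊢
    linear_combination this
  have e2 : Gammaℝ (s + 1) = Gammaℝ (2 - s) * (Gammaℂ s * Complex.sin (Real.pi * s / 2)) := by
    have := inv_Gammaℝ_two_sub hs
    field_simp at this ⊢
    linear_combination this
  rw [e1] at h₀
  rw [e2] at h₁
  have k₀ := mul_left_cancel₀ g2 (by linear_combination h₀ :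
    Gammaℝ (1 - s) * (Gammaℂ s * Complex.cos (Real.pi * s / 2) * (p + m)) = Gammaℝ (1 - s) *
    (ν * ((2 * Real.pi : ℂ) ^ (-w) * Complex.Gamma w *
      (P * (cexp (Real.pi * w * I / 2) + L * cexp (-(Real.pi * w * I / 2))) +
        M * (cexp (-(Real.pi * w * I / 2)) + L * cexp (Real.pi * w * I / 2))))))
  have k₁ := mul_left_cancel₀ g3 (by linear_combination h₁ :
    Gammaℝ (2 - s) * (I * (Gammaℂ s * Complex.sin (Real.pi * s / 2)) * (p - m)) = Gammaℝ (2 - s) *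
    (ν * ((2 * Real.pi : ℂ) ^ (-w) * Complex.Gamma w *
      (P * (-cexp (Real.pi * w * I / 2) + L * cexp (-(Real.pi * w * I / 2))) +
        M * (-cexp (-(Real.pi * w * I / 2)) + L * cexp (Real.pi * w * I / 2))))))
  have x1 : cexp (Real.pi * s * I / 2) =
      Complex.cos (Real.pi * s / 2) + Complex.sin (Real.pi * s / 2) * I := by
    rw [← Complex.exp_mul_I]; congr 1; ring
  have x2 : cexp (-(Real.pi * s * I / 2)) =
      Complex.cos (Real.pi * s / 2) - Complex.sin (Real.pi * s / 2) * I := by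
    rw [show -(Real.pi * s * I / 2) = -(Real.pi * s / 2) * I by ring, Complex.exp_mul_I,
      Complex.cos_neg, Complex.sin_neg]
    ring
  rw [Gammaℂ_def] at k₀ k₁
  rw [x1, x2]
  constructor
  · linear_combination k₀ / 2 + k₁ / 2
  · linear_combination k₀ / 2 - k₁ / 2

theorem analyticAt_completed {ξ : ℂ → ℂ} {s : ℂ} (hξ : AnalyticAt ℂ ξ s)
    (hs : ∀ n : ℕ, s ≠ -(n : ℂ)) : AnalyticAt ℂ (completed ξ) s := by
  have h2pi : (2 * Real.pi : ℂ) ≠ 0 := by exact_mod_cast Real.two_pi_pos.ne'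
  have hG : AnalyticAt ℂ Complex.Gamma s := by
    rw [Complex.analyticAt_iff_eventually_differentiableAt]
    have h1 : ∀ᶠ z in 𝓝 s, (Complex.Gamma z)⁻¹ ≠ 0 :=
      (Complex.differentiable_one_div_Gamma.continuous.continuousAt).eventually_ne
        (inv_ne_zero (Complex.Gamma_ne_zero hs))
    filter_upwards [h1] with z hz
    have := (Complex.differentiable_one_div_Gamma z).fun_inv hz
    simpa only [inv_inv] using this
  have hp : AnalyticAt ℂ (fun z : ℂ => (2 * Real.pi : ℂ) ^ (-z)) s :=
    (differentiable_neg.const_cpow (Or.inl h2pi)).analyticAt s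
  exact (hp.mul hG).mul hξ

theorem functional_equation_rows {lam : ℂ} {ell : ℤ} {N : ℕ} (hN : 0 < N) {ξ η : ℤˣ → ℂ → ℂ}
    {b : ℤ → ℂ} {σ τ : ℝ}
    (hξ : ∀ ε s, s ≠ 1 → s ≠ 2 - 2 * lam → AnalyticAt ℂ (ξ ε) s)
    (hη : ∀ ε s, s ≠ 1 → s ≠ 2 - 2 * lam → AnalyticAt ℂ (η ε) s)
    (hL : ∀ s : ℂ, τ < s.re → ∀ ε : ℤˣ, η ε s = LSeries (coeff b ε) s)
    (H : ∀ s w : ℂ, w = 2 - 2 * lam - s → σ < w.re → (∀ n : ℕ, s ≠ -(n : ℂ)) → ∀ k : ℕ, k ≤ 1 →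
      I ^ k * Gammaℝ (s + k) * (ξ 1 s + (-1) ^ k * ξ (-1) s) =
      (N : ℂ) ^ w * ((2 * Real.pi : ℂ) ^ (-w) * Complex.Gamma w * Gammaℝ (1 + k - s) *
      (LSeries (coeff b 1) w * ((-1) ^ k * cexp (Real.pi * w * I / 2) +
        I ^ ell * cexp (-(Real.pi * w * I / 2))) +
      LSeries (coeff b (-1)) w * ((-1) ^ k * cexp (-(Real.pi * w * I / 2)) +
        I ^ ell * cexp (Real.pi * w * I / 2)))))
    {s : ℂ} (hs : s ≠ 1) (hs' : 2 - 2 * lam - s ≠ 1) (hn : ∀ k : ℕ, s ≠ -(k : ℂ))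
    (hn' : ∀ k : ℕ, 2 - 2 * lam - s ≠ -(k : ℂ)) :
    cexp (Real.pi * s * I / 2) * completed (ξ 1) s +
        cexp (-(Real.pi * s * I / 2)) * completed (ξ (-1)) s =
      (N : ℂ) ^ (2 - 2 * lam - s) *
        (I ^ ell * (cexp (-(Real.pi * (2 - 2 * lam - s) * I / 2)) *
          completed (η 1) (2 - 2 * lam - s) +
        cexp (Real.pi * (2 - 2 * lam - s) * I / 2) * completed (η (-1)) (2 - 2 * lam - s))) ∧
    cexp (-(Real.pi * s * I / 2)) * completed (ξ 1) s +
        cexp (Real.pi * s * I / 2) * completed (ξ (-1)) s =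
      (N : ℂ) ^ (2 - 2 * lam - s) *
        (cexp (Real.pi * (2 - 2 * lam - s) * I / 2) * completed (η 1) (2 - 2 * lam - s) +
        cexp (-(Real.pi * (2 - 2 * lam - s) * I / 2)) *
          completed (η (-1)) (2 - 2 * lam - s)) := by
  -- All excluded points; the index `0` in the two ranges also removes `0` and `2 - 2λ`, the
  -- remaining poles of the two sides. The set is countable, so its complement in the plane is
  -- connected and the identity theorem applies.
  set T : Set ℂ := ({1} ∪ {1 - 2 * lam}) ∪
    (Set.range (fun n : ℕ => -(n : ℂ)) ∪ Set.range fun n : ℕ => 2 - 2 * lam + n) with hT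
  have hTc : T.Countable := (((Set.countable_singleton _).union (Set.countable_singleton _))).union
    ((Set.countable_range _).union (Set.countable_range _))
  have hmem : ∀ z : ℂ, z ∈ Tᶜ ↔ z ≠ 1 ∧ 2 - 2 * lam - z ≠ 1 ∧ (∀ k : ℕ, z ≠ -(k : ℂ)) ∧
      ∀ k : ℕ, 2 - 2 * lam - z ≠ -(k : ℂ) := by
    intro z
    have i1 : 2 - 2 * lam - z = 1 ↔ z = 1 - 2 * lam :=
      ⟨fun h => by linear_combination -h, fun h => by linear_combination -h⟩
    have i2 : ∀ k : ℕ, 2 - 2 * lam - z = -(k : ℂ) ↔ 2 - 2 * lam + k = z :=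
      fun k => ⟨fun h => by linear_combination h, fun h => by linear_combination h⟩
    simp only [hT, Set.mem_compl_iff, Set.mem_union, Set.mem_singleton_iff, Set.mem_range, not_or,
      not_exists, Ne, i1, i2, and_assoc, eq_comm (a := z)]
  have hconn : IsPreconnected Tᶜ := (hTc.isConnected_compl_of_one_lt_rank (by
    rw [Complex.rank_real_complex]; norm_num)).isPreconnected
  have hN0 : (N : ℂ) ≠ 0 := by exact_mod_cast hN.ne'
  set r : ℝ := max (max σ τ) (max 1 (2 - 2 * lam).re) with hr
  obtain ⟨r1, r2, r3, r4⟩ : σ ≤ r ∧ τ ≤ r ∧ 1 ≤ r ∧ (2 - 2 * lam).re ≤ r := by simp [hr]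
  -- Chosen with imaginary part `1` and `Re (2 - 2λ - z₀) = r + 1`: off the nonpositive integers,
  -- and with the dual point in the half-plane of convergence.
  set z₀ : ℂ := 2 - 2 * lam - ((r + 1 : ℝ) : ℂ) + (1 - (2 - 2 * lam).im : ℝ) * I with hz₀
  have hopen : ∀ᶠ z : ℂ in 𝓝 z₀, r < (2 - 2 * lam - z).re ∧ 0 < z.im := by
    refine (((Complex.continuous_re.comp (continuous_const.sub continuous_id)).tendsto
      z₀).eventually_const_lt ?_).and ((Complex.continuous_im.tendsto z₀).eventually_const_lt ?_)
    · simp [hz₀]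
    · simp [hz₀]
  have good : ∀ z : ℂ, r < (2 - 2 * lam - z).re → 0 < z.im → z ∈ Tᶜ ∧ z.re < 1 ∧
      ∀ n : ℕ, z ≠ -(n : ℂ) := by
    intro z h1 h2
    have i1 : ∀ n : ℕ, z ≠ -(n : ℂ) := by rintro n rfl; simp at h2
    refine ⟨(hmem z).mpr ⟨by rintro rfl; simp at h2, fun h => ?_, i1,
      ne_neg_natCast_of_re_pos (by linarith)⟩, ?_, i1⟩
    · rw [h] at h1
      simp at h1
      linarith
    · rw [Complex.sub_re] at h1
      linarith
  have hz₀T : z₀ ∈ Tᶜ := (good z₀ hopen.self_of_nhds.1 hopen.self_of_nhds.2).1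
  have local_eq : ∀ z : ℂ, r < (2 - 2 * lam - z).re ∧ 0 < z.im → _ := fun z hz => by
    obtain ⟨-, g2, g3⟩ := good z hz.1 hz.2
    have q₀ := H z _ rfl (by linarith [hz.1]) g3 0 zero_le_one
    have q₁ := H z _ rfl (by linarith [hz.1]) g3 1 le_rfl
    rw [← hL _ (by linarith [hz.1]) 1, ← hL _ (by linarith [hz.1]) (-1)] at q₀ q₁
    simp only [pow_zero, one_mul, Nat.cast_zero, add_zero] at q₀
    simp only [pow_one, neg_mul, one_mul, Nat.cast_one, ← sub_eq_add_neg] at q₁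
    rw [one_add_one_eq_two] at q₁
    exact functional_equation_of_parity (ν := (N : ℂ) ^ (2 - 2 * lam - z)) (L := I ^ ell) g3 g2 q₀ q₁
  have hsub : ∀ z, AnalyticAt ℂ (fun z : ℂ => 2 - 2 * lam - z) z := fun z =>
    analyticAt_const.sub analyticAt_id
  have aξ : ∀ ε, AnalyticOnNhd ℂ (completed (ξ ε)) Tᶜ := fun ε z hz => by
    obtain ⟨h1, h2, h3, h4⟩ := (hmem z).mp hz
    refine analyticAt_completed (hξ ε z h1 fun h => h4 0 ?_) h3
    rw [h]; simp
  have aη : ∀ ε, AnalyticOnNhd ℂ (fun z => completed (η ε) (2 - 2 * lam - z)) Tᶜ := fun ε z hz => by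
    obtain ⟨h1, h2, h3, h4⟩ := (hmem z).mp hz
    refine AnalyticAt.fun_comp (analyticAt_completed (hη ε _ h2 fun h => h3 0 ?_) h4) (hsub z)
    linear_combination -h
  have aN : AnalyticOnNhd ℂ (fun z => (N : ℂ) ^ (2 - 2 * lam - z)) Tᶜ := fun z _ =>
    ((differentiable_id.const_sub _).const_cpow (Or.inl hN0)).analyticAt z
  have e1 : AnalyticOnNhd ℂ (fun z : ℂ => cexp (Real.pi * z * I / 2)) Tᶜ := fun z _ => by fun_prop
  have e2 : AnalyticOnNhd ℂ (fun z : ℂ => cexp (-(Real.pi * z * I / 2))) Tᶜ :=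
    fun z _ => by fun_prop
  have e3 : AnalyticOnNhd ℂ (fun z : ℂ => cexp (Real.pi * (2 - 2 * lam - z) * I / 2)) Tᶜ :=
    fun z _ => by fun_prop
  have e4 : AnalyticOnNhd ℂ (fun z : ℂ => cexp (-(Real.pi * (2 - 2 * lam - z) * I / 2))) Tᶜ :=
    fun z _ => by fun_prop
  have hsT := (hmem s).mpr ⟨hs, hs', hn, hn'⟩
  constructor
  · exact AnalyticOnNhd.eqOn_of_preconnected_of_eventuallyEq
      ((e1.mul (aξ 1)).add (e2.mul (aξ (-1))))
      (aN.mul ((analyticOnNhd_const (v := I ^ ell)).mul ((e4.mul (aη 1)).add (e3.mul (aη (-1))))))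
      hconn hz₀T (hopen.mono fun z hz => (local_eq z hz).1) hsT
  · exact AnalyticOnNhd.eqOn_of_preconnected_of_eventuallyEq
      ((e2.mul (aξ 1)).add (e1.mul (aξ (-1))))
      (aN.mul ((e3.mul (aη 1)).add (e4.mul (aη (-1)))))
      hconn hz₀T (hopen.mono fun z hz => (local_eq z hz).2) hsT

end FerrarSuzuki

end

theorem mainTheorem4 (lam : ℂ) (ell : ℤ) (N : ℕ) (hN : 0 < N)
    (hlam : ∀ k : ℕ, lam ≠ 1 / 2 - (k : ℂ) / 2)
    (α β : ℤ → ℂ) (αinf βinf : ℂ)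
    (hα : FerrarSuzuki.PolynomialGrowth α) (hβ : FerrarSuzuki.PolynomialGrowth β)
    (hsum : ∀ f ∈ FerrarSuzuki.lineModel lam ell,
      FerrarSuzuki.SummationFormula lam ell N α β αinf βinf f) :
    ∃ ξα ξβ : ℤˣ → ℂ → ℂ,
      -- meromorphic continuations of the L-functions
      (∀ ε : ℤˣ, FerrarSuzuki.IsContinuationOfXi α ε (ξα ε) ∧
        FerrarSuzuki.IsContinuationOfXi β ε (ξβ ε)) ∧
      -- (1) no poles outside `1` and `2 - 2λ`, at most simple poles there, and the residues
      (∀ ε : ℤˣ, ∀ s : ℂ, s ≠ 1 → s ≠ 2 - 2 * lam →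
        AnalyticAt ℂ (ξα ε) s ∧ AnalyticAt ℂ (ξβ ε) s) ∧
      (∀ ε : ℤˣ,
        FerrarSuzuki.HasSimpleResidueAt (ξα ε) 1 (Complex.I ^ ell * βinf) ∧
        FerrarSuzuki.HasSimpleResidueAt (ξα ε) (2 - 2 * lam)
          (((ε : ℤ) : ℂ) * Complex.I * (2 * Real.pi : ℂ) ^ (-(2 * lam - 1)) *
            Complex.Gamma (2 * lam - 1) *
            (Complex.I ^ ell * Complex.exp (-(((ε : ℤ) : ℂ) * lam * Real.pi * Complex.I)) -
              Complex.exp (((ε : ℤ) : ℂ) * lam * Real.pi * Complex.I)) * β 0) ∧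
        FerrarSuzuki.HasSimpleResidueAt (ξβ ε) 1 (αinf / N) ∧
        FerrarSuzuki.HasSimpleResidueAt (ξβ ε) (2 - 2 * lam)
          (-(((ε : ℤ) : ℂ) * Complex.I) * (N : ℂ) ^ (2 * lam - 2) *
            (2 * Real.pi : ℂ) ^ (-(2 * lam - 1)) * Complex.Gamma (2 * lam - 1) *
            (Complex.I ^ (-ell) * Complex.exp (((ε : ℤ) : ℂ) * Real.pi * Complex.I * lam) -
              Complex.exp (-(((ε : ℤ) : ℂ) * Real.pi * Complex.I * lam))) * α 0)) ∧
      -- (2) the functional equation, at every `s` where neither side has a pole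
      (∀ s : ℂ, s ≠ 1 → 2 - 2 * lam - s ≠ 1 → (∀ k : ℕ, s ≠ -(k : ℂ)) →
        (∀ k : ℕ, 2 - 2 * lam - s ≠ -(k : ℂ)) →
        (FerrarSuzuki.gammaMatrix s).mulVec
            ![FerrarSuzuki.completed (ξα 1) s, FerrarSuzuki.completed (ξα (-1)) s] =
          (N : ℂ) ^ (2 - 2 * lam - s) •
            (FerrarSuzuki.sigmaMatrix ell * FerrarSuzuki.gammaMatrix (2 - 2 * lam - s)).mulVec
              ![FerrarSuzuki.completed (ξβ 1) (2 - 2 * lam - s),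
                FerrarSuzuki.completed (ξβ (-1)) (2 - 2 * lam - s)]) ∧
      -- (3) `(s - 1)(s + 2λ - 2) ξ` is entire of order at most `1`
      (∀ ε : ℤˣ,
        (∃ g : ℂ → ℂ, FerrarSuzuki.EntireOfOrderAtMost 1 g ∧
          ∀ s : ℂ, s ≠ 1 → s ≠ 2 - 2 * lam → g s = (s - 1) * (s + 2 * lam - 2) * ξα ε s) ∧
        (∃ g : ℂ → ℂ, FerrarSuzuki.EntireOfOrderAtMost 1 g ∧
          ∀ s : ℂ, s ≠ 1 → s ≠ 2 - 2 * lam → g s = (s - 1) * (s + 2 * lam - 2) * ξβ ε s)) := by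
  obtain ⟨ξα, rα, σα, hLα, fα⟩ := FerrarSuzuki.exists_continuation hN hlam hα hβ
    (FerrarSuzuki.gaussRelation_of_summationFormula hsum)
  -- The dual relation is used only to continue the series of `β`; the functional equation is taken
  -- from the first relation.
  obtain ⟨ξβ, rβ, σβ, hLβ, -⟩ := FerrarSuzuki.exists_continuation hN hlam hβ
    (hα.const_mul (Complex.I ^ (-ell) * (N : ℂ) ^ (2 * lam - 2)))
    (FerrarSuzuki.gaussRelation_of_summationFormula_symm hN hsum)
  -- The two poles are distinct because `λ ≠ 1/2`, so each is at most simple.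
  have h12 : (1 : ℂ) ≠ 2 - 2 * lam := fun h => hlam 0 (by
    push_cast
    linear_combination h / 2)
  have hI : (Complex.I ^ ell : ℂ) ≠ 0 := zpow_ne_zero ell Complex.I_ne_zero
  refine ⟨ξα, ξβ, fun ε => ⟨⟨(rα ε).meromorphic, σα, fun s hs => hLα s hs ε⟩,
      ⟨(rβ ε).meromorphic, σβ, fun s hs => hLβ s hs ε⟩⟩,
    fun ε s h1 h2 => ⟨(rα ε).analyticAt h1 h2, (rβ ε).analyticAt h1 h2⟩,
    fun ε => ⟨(rα ε).hasSimpleResidueAt h12, (rα ε).symm.hasSimpleResidueAt h12.symm,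
      (rβ ε).hasSimpleResidueAt h12, ?_⟩, fun s h1 h2 h3 h4 => ?_, fun ε => ⟨?_, ?_⟩⟩
  -- Multiplying `i^ℓ e^(-x) - e^x` by the factor `i^(-ℓ)` of the dual sequence gives `-(i^(-ℓ) e^x
  -- - e^(-x))`, whence the opposite sign and the exchanged exponentials.
  · convert (rβ ε).symm.hasSimpleResidueAt h12.symm using 1
    rw [zpow_neg, show ((ε : ℤ) : ℂ) * Real.pi * Complex.I * lam =
      ((ε : ℤ) : ℂ) * lam * Real.pi * Complex.I by ring]
    field_simp
    ring
  · obtain ⟨e1, e2⟩ := FerrarSuzuki.functional_equation_rows hN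
      (fun ε z => (rα ε).analyticAt) (fun ε z => (rβ ε).analyticAt)
      (fun z hz ε => (hLβ z hz ε).2) fα h1 h2 h3 h4
    ext i
    fin_cases i
    · simpa [FerrarSuzuki.gammaMatrix, FerrarSuzuki.sigmaMatrix, Matrix.mulVec, dotProduct,
        Matrix.mul_apply, Fin.sum_univ_two, mul_add, mul_assoc, mul_comm, mul_left_comm] using e1
    · simpa [FerrarSuzuki.gammaMatrix, FerrarSuzuki.sigmaMatrix, Matrix.mulVec, dotProduct,
        Matrix.mul_apply, Fin.sum_univ_two, mul_add, mul_assoc, mul_comm, mul_left_comm] using e2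
  · obtain ⟨g, hg, h⟩ := (rα ε).exists_entire
    exact ⟨g, hg, fun s h1 h2 => by rw [h s h1 h2]; ring⟩
  · obtain ⟨g, hg, h⟩ := (rβ ε).exists_entire
    exact ⟨g, hg, fun s h1 h2 => by rw [h s h1 h2]; ring⟩
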